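/- **Setting.** Let $n\in\mathbb N$, $\Xi=\mathbb R^n\times\mathbb R^n$ with points $X=(x,\xi)$, symplectic form $\sigma((x,\xi),(y,\eta))=y\cdot\xi-x\cdot\eta$ and Haar measure $dX=(2\pi)^{-n}\,dx\,d\xi$ (with $dX\,dY$ on $\Xi\times\Xi$). Let $(\mathfrak F f)(Y)=\widehat f(Y)=\int_\Xi e^{-i\sigma(Y,Z)}f(Z)\,dZ$ and $\mathfrak e_X(Z)=e^{i\sigma(X,Z)}$. Write $\langle f,g\rangle=\int_\Xi f g\,dX$, extended to the (bilinear) duality of $\mathcal S'(\Xi)$ and $\mathcal S(\Xi)$, and similarly $\langle\!\langle\cdot,\cdot\rangle\!\rangle$ on $\Xi\times\Xi$; $\mathcal S\subset\mathcal S'$ via these pairings, and $\mathcal S'$ carries the weak topology. Let $\#:\mathcal S(\Xi)\times\mathcal S(\Xi)\to\mathcal S(\Xi)$ be a bilinear, separately continuous composition law. For $f\in\mathcal S'(\Xi)$, $g\in\mathcal S(\Xi)$ define $f\#g,\ g\#f\in\mathcal S'(\Xi)$ by $\langle f\#g,k\rangle=\langle f,g\#k\rangle$ and $\langle g\#f,k\rangle=\langle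 f,k\#g\rangle$ for all $k\in\mathcal S(\Xi)$. Assume: * (A) $\#$ is associative, $\overline{f\#g}=\overline g\#\overline f$, and $\int_\Xi f\#g\,dX=\int_\Xi fg\,dX$ for all $f,g\in\mathcal S(\Xi)$; * (B) $\mathcal S(\Xi)\#\mathcal S'(\Xi)\#\mathcal S(\Xi)\subset\mathcal S(\Xi)$; * (C) $\int_\Xi\langle\Theta_Z(f),g\rangle\,dZ=\int_\Xi f\,dX\int_\Xi g\,dX$ for all $f,g\in\mathcal S(\Xi)$, where $\Theta_Z(f)=\mathfrak e_{-Z}\#f\#\mathfrak e_Z\in\mathcal S'(\Xi)$ is given by $\langle\Theta_Z(f),g\rangle=\langle\mathfrak e_{-Z},f\#\mathfrak e_Z\#g\rangle$. *Composition laws on $\mathcal S(\Xi\times\Xi)$.* Let $\square$ be the separately continuous bilinear law determined by $(f\otimes h)\square(g\otimes k)=(f\#g)\otimes(k\#h)$, with involution $F^\square=\overline F$. Let $$(F\diamond G)(X,Y)=\int_\Xi F(X,Z)\,G(X-Z,Y-Z)\,dZ,\qquad F^\diamond(X,Y)=\overline{F(X-Y,-Y)}.$$ For $\diamond$, use the duality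 $\langle\!\langle F,G\rangle\!\rangle'=\iint F(X,X-Y)\,G(Y,Y-X)\,dX\,dY=\iint F(X,Y)\,G(X-Y,-Y)\,dX\,dY$, extended to $\mathcal S'(\Xi\times\Xi)\times\mathcal S(\Xi\times\Xi)$. The products of a distribution with a Schwartz function for $\square$ and $\diamond$ are defined from $\langle\!\langle\cdot,\cdot\rangle\!\rangle$ and $\langle\!\langle\cdot,\cdot\rangle\!\rangle'$ respectively, by the same formulas as for $\#$. The involutions ($f^\#=\overline f$, $F^\square$, $F^\diamond$) extend to distributions by $T^*(k)=\overline{T(k^*)}$. *Moyal algebras.* $\mathcal S'_\#(\Xi)=\{f\in\mathcal S'(\Xi): f\#\mathcal S(\Xi)\subset\mathcal S(\Xi),\ \mathcal S(\Xi)\#f\subset\mathcal S(\Xi)\}$, with product given by $\langle f\#g,k\rangle=\langle f,g\#k\rangle$ for $k\in\mathcal S(\Xi)$. In the same way one defines $\mathcal S'_\square(\Xi\times\Xi)$ and $\mathcal S'_\diamond(\Xi\times\Xi)$, using the respective dualities. *Modulation mapping.* Let $\mathbf N:\mathcal S'(\Xi\times\Xi)\to\mathcal S'(\Xi\times\Xi)$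 be the continuous linear map determined by $$\langle\!\langle\mathbf N(f_1\otimes f_2),g_1\otimes g_2\rangle\!\rangle=\langle\widehat g_1\#f_1,\widehat g_2\#f_2\rangle\qquad(f_i,g_i\in\mathcal S(\Xi)),$$ and $\mathbf M(F)=\mathbf N(F)\circ C$ with $C(X,Y)=(-X,X-Y)$; so $[\mathbf M(f\otimes g)](X,Y)=\langle\mathfrak e_{-X}\#f,\mathfrak e_{X-Y}\#g\rangle$ for $f,g\in\mathcal S(\Xi)$. For $h\in\mathcal S(\Xi)\setminus\{0\}$ put $\mathbf M_h:\mathcal S'(\Xi)\to\mathcal S'(\Xi\times\Xi)$, $\mathbf M_h(f)=\mathbf M(f\otimes h)$, and $\mathfrak L^{\mathbf M}_h=\mathbf M_h^{-1}(\mathfrak L)\subset\mathcal S'(\Xi)$ for each linear subspace $\mathfrak L\subset\mathcal S'(\Xi\times\Xi)$. **Statement.** Under (A), (B), (C), the law $\square$ and the map $\mathbf N$ exist and are unique, the three Moyal algebras, with the products and involutions above, are (well-defined) $^*$-algebras, and: 1. $\mathbf M$ restricts to an isomorphism of $^*$-algebras $\mathcal S'_\square(\Xi\times\Xi)\to\mathcal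 S'_\diamond(\Xi\times\Xi)$. 2. If $h\in\mathcal S(\Xi)\setminus\{0\}$ satisfies $h\#h=h=\overline h$, then $\mathbf M_h$ restricts to an injective morphism of $^*$-algebras $\mathcal S'_\#(\Xi)\to\mathcal S'_\diamond(\Xi\times\Xi)$, and $\mathcal S'_\diamond(\Xi\times\Xi)^{\mathbf M}_h=\mathcal S'_\#(\Xi)$. 3. For $h$ as in 2, if $\mathfrak L$ is a $^*$-subalgebra of $\mathcal S'_\diamond(\Xi\times\Xi)$, then $\mathfrak L^{\mathbf M}_h$ is a $^*$-subalgebra of $\mathcal S'_\#(\Xi)$. -/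

import Mathlib

open scoped SchwartzMap ContDiff
open MeasureTheory

namespace MoyalModulation

set_option linter.unusedSectionVars false

section Tensor
variable {E F : Type*} [NormedAddCommGroup E] [NormedSpace ℝ E]
  [NormedAddCommGroup F] [NormedSpace ℝ F]

theorem tensor_bound (f : 𝓢(E, ℂ)) (g : 𝓢(F, ℂ)) (k n : ℕ) (z : E × F) :
    ‖z‖ ^ k * ‖iteratedFDeriv ℝ n (fun z : E × F => f z.1 * g z.2) z‖ ≤
      ∑ i ∈ Finset.range (n + 1), (n.choose i : ℝ) *
        (SchwartzMap.seminorm ℂ k i f * SchwartzMap.seminorm ℂ 0 (n - i) g +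
          SchwartzMap.seminorm ℂ 0 i f * SchwartzMap.seminorm ℂ k (n - i) g) := by
  have hf : ContDiff ℝ n (fun z : E × F => f z.1) := (f.smooth n).comp contDiff_fst
  have hg : ContDiff ℝ n (fun z : E × F => g z.2) := (g.smooth n).comp contDiff_snd
  have h1 : ∀ i, ‖iteratedFDeriv ℝ i (fun z : E × F => f z.1) z‖ ≤
      ‖iteratedFDeriv ℝ i f z.1‖ := by
    intro i
    have := (ContinuousLinearMap.fst ℝ E F).iteratedFDeriv_comp_right (f.smooth i) z
      (i := i) le_rfl
    change ‖iteratedFDeriv ℝ i (f ∘ (ContinuousLinearMap.fst ℝ E F)) z‖ ≤ _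
    rw [this]
    refine (ContinuousMultilinearMap.norm_compContinuousLinearMap_le _ _).trans ?_
    refine mul_le_of_le_one_right (norm_nonneg _) ?_
    exact Finset.prod_le_one (fun _ _ => norm_nonneg _)
      (fun _ _ => ContinuousLinearMap.norm_fst_le ℝ E F)
  have h2 : ∀ i, ‖iteratedFDeriv ℝ i (fun z : E × F => g z.2) z‖ ≤
      ‖iteratedFDeriv ℝ i g z.2‖ := by
    intro i
    have := (ContinuousLinearMap.snd ℝ E F).iteratedFDeriv_comp_right (g.smooth i) z
      (i := i) le_rfl
    change ‖iteratedFDeriv ℝ i (g ∘ (ContinuousLinearMap.snd ℝ E F)) z‖ ≤ _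
    rw [this]
    refine (ContinuousMultilinearMap.norm_compContinuousLinearMap_le _ _).trans ?_
    refine mul_le_of_le_one_right (norm_nonneg _) ?_
    exact Finset.prod_le_one (fun _ _ => norm_nonneg _)
      (fun _ _ => ContinuousLinearMap.norm_snd_le ℝ E F)
  have hz : ‖z‖ ^ k ≤ ‖z.1‖ ^ k + ‖z.2‖ ^ k := by
    rcases le_total ‖z.1‖ ‖z.2‖ with h | h
    · rw [Prod.norm_def, max_eq_right h]
      exact le_add_of_nonneg_left (by positivity)
    · rw [Prod.norm_def, max_eq_left h]
      exact le_add_of_nonneg_right (by positivity)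
  have hmul := norm_iteratedFDeriv_mul_le (𝕜 := ℝ) hf hg z (n := n) le_rfl
  refine (mul_le_mul_of_nonneg_left hmul (by positivity)).trans ?_
  rw [Finset.mul_sum]
  refine Finset.sum_le_sum fun i _ => ?_
  have a1 := SchwartzMap.le_seminorm ℂ k i f z.1
  have a2 := SchwartzMap.le_seminorm ℂ 0 i f z.1
  have b1 := SchwartzMap.le_seminorm ℂ k (n - i) g z.2
  have b2 := SchwartzMap.le_seminorm ℂ 0 (n - i) g z.2
  rw [pow_zero, one_mul] at a2 b2
  calc _ ≤ (‖z.1‖ ^ k + ‖z.2‖ ^ k) * ((n.choose i : ℝ) * ‖iteratedFDeriv ℝ i f z.1‖ *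
        ‖iteratedFDeriv ℝ (n - i) g z.2‖) := by
        gcongr
        · exact h1 i
        · exact h2 (n - i)
    _ = (n.choose i : ℝ) * ((‖z.1‖ ^ k * ‖iteratedFDeriv ℝ i f z.1‖) *
          ‖iteratedFDeriv ℝ (n - i) g z.2‖ + ‖iteratedFDeriv ℝ i f z.1‖ *
          (‖z.2‖ ^ k * ‖iteratedFDeriv ℝ (n - i) g z.2‖)) := by ring
    _ ≤ _ := by gcongr

/-- The elementary tensor `f ⊗ g`, `(x, y) ↦ f x * g y`, of two Schwartz functions. -/
noncomputable def tensor (f : 𝓢(E, ℂ)) (g : 𝓢(F, ℂ)) : 𝓢(E × F, ℂ) where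
  toFun z := f z.1 * g z.2
  smooth' := ((f.smooth ⊤).comp contDiff_fst).mul ((g.smooth ⊤).comp contDiff_snd)
  decay' k n := ⟨_, tensor_bound f g k n⟩

@[simp]
theorem tensor_apply (f : 𝓢(E, ℂ)) (g : 𝓢(F, ℂ)) (z : E × F) :
    tensor f g z = f z.1 * g z.2 := rfl


/-- For fixed `f`, the map `g ↦ f ⊗ g` is linear and continuous. -/
noncomputable def tensorCLM (f : 𝓢(E, ℂ)) : 𝓢(F, ℂ) →L[ℂ] 𝓢(E × F, ℂ) :=
  SchwartzMap.mkCLM (fun g => tensor f g) (fun g g' z => by simp [mul_add])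
    (fun c g z => by simp [mul_left_comm]) (fun g => (tensor f g).smooth ⊤) (by
      rintro ⟨k, n⟩
      refine ⟨Finset.Iic (k, n), ∑ i ∈ Finset.range (n + 1), (n.choose i : ℝ) *
        (SchwartzMap.seminorm ℂ k i f + SchwartzMap.seminorm ℂ 0 i f), by positivity, ?_⟩
      intro g z
      refine (tensor_bound f g k n z).trans ?_
      rw [Finset.sum_mul]
      refine Finset.sum_le_sum fun i _ => ?_
      have h0 : SchwartzMap.seminorm ℂ 0 (n - i) g ≤
          (Finset.Iic (k, n)).sup (schwartzSeminormFamily ℂ F ℂ) g :=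
        Seminorm.le_finset_sup_apply (p := schwartzSeminormFamily ℂ F ℂ) (i := (0, n - i))
          (Finset.mem_Iic.2 (Prod.mk_le_mk.2 ⟨Nat.zero_le _, Nat.sub_le _ _⟩))
      have hk : SchwartzMap.seminorm ℂ k (n - i) g ≤
          (Finset.Iic (k, n)).sup (schwartzSeminormFamily ℂ F ℂ) g :=
        Seminorm.le_finset_sup_apply (p := schwartzSeminormFamily ℂ F ℂ) (i := (k, n - i))
          (Finset.mem_Iic.2 (Prod.mk_le_mk.2 ⟨le_rfl, Nat.sub_le _ _⟩))
      rw [mul_assoc, add_mul]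
      gcongr)

theorem tensorCLM_apply (f : 𝓢(E, ℂ)) (g : 𝓢(F, ℂ)) : tensorCLM f g = tensor f g := rfl

theorem continuous_tensor_right (f : 𝓢(E, ℂ)) :
    Continuous fun g : 𝓢(F, ℂ) => tensor f g := (tensorCLM f).continuous

theorem continuous_tensor_left (g : 𝓢(F, ℂ)) :
    Continuous fun f : 𝓢(E, ℂ) => tensor f g := by
  have h : (fun f : 𝓢(E, ℂ) => tensor f g) = fun f =>
      SchwartzMap.compCLMOfContinuousLinearEquiv ℂ (ContinuousLinearEquiv.prodComm ℝ E F)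
        (tensorCLM g f) := by
    funext f
    ext z
    simp [tensorCLM_apply, mul_comm]
  rw [h]
  exact (ContinuousLinearMap.continuous _).comp (tensorCLM g).continuous

end Tensor

section PartialIntegral
universe u
variable {E F : Type u} [NormedAddCommGroup E] [NormedSpace ℝ E]
  [NormedAddCommGroup F] [NormedSpace ℝ F] [MeasurableSpace F] [BorelSpace F]
  [SecondCountableTopology F] (μ : Measure F) [μ.HasTemperateGrowth]

theorem slice_bound {V : Type*} [NormedAddCommGroup V] [NormedSpace ℝ V] (k n : ℕ)
    (G : 𝓢(E × F, V)) (x : E) (y : F) :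
    ‖x‖ ^ k * ‖iteratedFDeriv ℝ n G (x, y)‖ ≤
      (1 + ‖y‖) ^ (-(μ.integrablePower : ℝ)) * (2 ^ (k + μ.integrablePower) *
        (Finset.Iic (k + μ.integrablePower, n)).sup (schwartzSeminormFamily ℝ (E × F) V) G) := by
  have h := SchwartzMap.one_add_le_sup_seminorm_apply (𝕜 := ℝ)
    (m := (k + μ.integrablePower, n)) le_rfl le_rfl G (x, y)
  rw [Real.rpow_neg (by positivity), Real.rpow_natCast, ← div_eq_inv_mul,
    le_div_iff₀ (by positivity)]
  refine le_trans ?_ h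
  have hx : ‖x‖ ≤ 1 + ‖(x, y)‖ := (norm_fst_le (x, y)).trans (by simp)
  have hy : 1 + ‖y‖ ≤ 1 + ‖(x, y)‖ := by gcongr; exact norm_snd_le (x, y)
  calc _ = (‖x‖ ^ k * (1 + ‖y‖) ^ μ.integrablePower) * ‖iteratedFDeriv ℝ n G (x, y)‖ := by ring
    _ ≤ ((1 + ‖(x, y)‖) ^ k * (1 + ‖(x, y)‖) ^ μ.integrablePower) *
          ‖iteratedFDeriv ℝ n G (x, y)‖ := by gcongr
    _ = _ := by rw [← pow_add]

theorem slice_continuous {V : Type*} [NormedAddCommGroup V] [NormedSpace ℝ V] (n : ℕ)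
    (G : 𝓢(E × F, V)) (x : E) : Continuous fun y => iteratedFDeriv ℝ n G (x, y) :=
  ((G.smooth ⊤).continuous_iteratedFDeriv (mod_cast le_top)).comp (by fun_prop)

theorem slice_integrable_iter {V : Type*} [NormedAddCommGroup V] [NormedSpace ℝ V] (n : ℕ)
    (G : 𝓢(E × F, V)) (x : E) : Integrable (fun y => ‖iteratedFDeriv ℝ n G (x, y)‖) μ := by
  refine ((Measure.integrable_pow_neg_integrablePower μ).mul_const
    (2 ^ (0 + μ.integrablePower) * (Finset.Iic (0 + μ.integrablePower, n)).sup
      (schwartzSeminormFamily ℝ (E × F) V) G)).mono'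
    (slice_continuous n G x).norm.aestronglyMeasurable (Filter.Eventually.of_forall fun y => ?_)
  have := slice_bound μ 0 n G x y
  rw [pow_zero, one_mul] at this
  rw [norm_norm]
  exact this

theorem slice_integrable {V : Type*} [NormedAddCommGroup V] [NormedSpace ℝ V]
    (G : 𝓢(E × F, V)) (x : E) : Integrable (fun y => G (x, y)) μ := by
  have h := slice_integrable_iter μ 0 G x
  simp only [norm_iteratedFDeriv_zero] at h
  have hc : Continuous fun y => G (x, y) := G.continuous.comp (by fun_prop)
  exact h.mono hc.aestronglyMeasurable (Filter.Eventually.of_forall fun y => by simp)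

/-- The Schwartz function `z ↦ (D G)(z) ∘ inl`, the derivative in the first variable. -/
noncomputable def fderivFst {V : Type*} [NormedAddCommGroup V] [NormedSpace ℝ V]
    (G : 𝓢(E × F, V)) : 𝓢(E × F, E →L[ℝ] V) :=
  SchwartzMap.postcompCLM
    ((ContinuousLinearMap.compL ℝ E (E × F) V).flip (ContinuousLinearMap.inl ℝ E F))
    (SchwartzMap.fderivCLM ℝ (E × F) V G)

theorem fderivFst_apply {V : Type*} [NormedAddCommGroup V] [NormedSpace ℝ V]
    (G : 𝓢(E × F, V)) (z : E × F) :
    fderivFst G z = (fderiv ℝ G z).comp (ContinuousLinearMap.inl ℝ E F) := rfl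

theorem fderivFst_norm {V : Type*} [NormedAddCommGroup V] [NormedSpace ℝ V]
    (G : 𝓢(E × F, V)) (n : ℕ) (z : E × F) :
    ‖iteratedFDeriv ℝ n (fderivFst G) z‖ ≤ ‖iteratedFDeriv ℝ (n + 1) G z‖ := by
  let L := ((ContinuousLinearMap.compL ℝ E (E × F) V).flip (ContinuousLinearMap.inl ℝ E F))
  have hL : ‖L‖ ≤ 1 := by
    refine ContinuousLinearMap.opNorm_le_bound _ zero_le_one fun T => ?_
    rw [one_mul]
    refine (ContinuousLinearMap.opNorm_comp_le T _).trans ?_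
    exact mul_le_of_le_one_right (norm_nonneg _) (ContinuousLinearMap.norm_inl_le_one ℝ E F)
  have h : iteratedFDeriv ℝ n (fderivFst G) z =
      L.compContinuousMultilinearMap (iteratedFDeriv ℝ n (fderiv ℝ G) z) :=
    L.iteratedFDeriv_comp_left
      ((SchwartzMap.fderivCLM ℝ (E × F) V G).smooth ⊤).contDiffAt (mod_cast le_top)
  rw [h, ← norm_iteratedFDeriv_fderiv]
  refine (L.norm_compContinuousMultilinearMap_le _).trans ?_
  exact mul_le_of_le_one_left (norm_nonneg _) hL

theorem hasFDerivAt_partialIntegral {V : Type*} [NormedAddCommGroup V] [NormedSpace ℝ V]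
    (G : 𝓢(E × F, V)) (x : E) :
    HasFDerivAt (fun x => ∫ y, G (x, y) ∂μ) (∫ y, fderivFst G (x, y) ∂μ) x := by
  refine hasFDerivAt_integral_of_dominated_of_fderiv_le (𝕜 := ℝ) (s := Set.univ)
    (F' := fun x y => fderivFst G (x, y))
    (bound := fun y => (1 + ‖y‖) ^ (-(μ.integrablePower : ℝ)) * (2 ^ (0 + μ.integrablePower) *
        (Finset.Iic (0 + μ.integrablePower, 0)).sup
          (schwartzSeminormFamily ℝ (E × F) (E →L[ℝ] V)) (fderivFst G)))
    Filter.univ_mem (Filter.Eventually.of_forall fun x => (slice_integrable μ G x).1)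
    (slice_integrable μ G x) (slice_integrable μ (fderivFst G) x).1
    (Filter.Eventually.of_forall fun y x _ => ?_)
    ((Measure.integrable_pow_neg_integrablePower μ).mul_const _)
    (Filter.Eventually.of_forall fun y x _ => ?_)
  · have := slice_bound μ 0 0 (fderivFst G) x y
    rw [pow_zero, one_mul, norm_iteratedFDeriv_zero] at this
    exact this
  · exact (G.hasFDerivAt (x, y)).comp x (hasFDerivAt_prodMk_left x y)

theorem partialIntegral_aux (n : ℕ) : ∀ {V : Type u} [NormedAddCommGroup V] [NormedSpace ℝ V]
    (G : 𝓢(E × F, V)), ContDiff ℝ n (fun x => ∫ y, G (x, y) ∂μ) ∧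
      ∀ x, ‖iteratedFDeriv ℝ n (fun x => ∫ y, G (x, y) ∂μ) x‖ ≤
        ∫ y, ‖iteratedFDeriv ℝ n G (x, y)‖ ∂μ := by
  induction n with
  | zero =>
    intro V _ _ G
    refine ⟨?_, fun x => ?_⟩
    · have hd : Differentiable ℝ (fun x => ∫ y, G (x, y) ∂μ) := fun x =>
        (hasFDerivAt_partialIntegral μ G x).differentiableAt
      exact contDiff_zero.2 hd.continuous
    · simp only [norm_iteratedFDeriv_zero]
      exact norm_integral_le_integral_norm _
  | succ n ih =>
    intro V _ _ G
    have hd : fderiv ℝ (fun x => ∫ y, G (x, y) ∂μ) = fun x => ∫ y, fderivFst G (x, y) ∂μ :=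
      funext fun x => (hasFDerivAt_partialIntegral μ G x).fderiv
    obtain ⟨h1, h2⟩ := ih (fderivFst G)
    refine ⟨?_, fun x => ?_⟩
    · have : ((n + 1 : ℕ) : ℕ∞ω) = (n : ℕ∞ω) + 1 := by norm_cast
      rw [this, contDiff_succ_iff_fderiv]
      refine ⟨fun x => (hasFDerivAt_partialIntegral μ G x).differentiableAt, by simp, ?_⟩
      rw [hd]
      exact h1
    · rw [← norm_iteratedFDeriv_fderiv, hd]
      refine (h2 x).trans ?_
      exact integral_mono (slice_integrable_iter μ n (fderivFst G) x)
        (slice_integrable_iter μ (n + 1) G x) fun y => fderivFst_norm G n (x, y)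

/-- Integration in the second variable, `G ↦ (x ↦ ∫ G (x, y) dμ(y))`. -/
noncomputable def partialIntegral {E F : Type} [NormedAddCommGroup E] [NormedSpace ℝ E]
    [NormedAddCommGroup F] [NormedSpace ℝ F] [MeasurableSpace F] [BorelSpace F]
    [SecondCountableTopology F] (μ : Measure F) [μ.HasTemperateGrowth] :
    𝓢(E × F, ℂ) →L[ℂ] 𝓢(E, ℂ) :=
  SchwartzMap.mkCLM (fun G x => ∫ y, G (x, y) ∂μ)
    (fun G G' x => integral_add (slice_integrable μ G x) (slice_integrable μ G' x))
    (fun c G x => integral_const_mul c _)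
    (fun G => contDiff_infty.2 fun n => (partialIntegral_aux μ n G).1) (by
      rintro ⟨k, n⟩
      refine ⟨Finset.Iic (k + μ.integrablePower, n),
        (∫ y, (1 + ‖y‖) ^ (-(μ.integrablePower : ℝ)) ∂μ) * 2 ^ (k + μ.integrablePower),
        by positivity, fun G x => ?_⟩
      calc ‖x‖ ^ k * ‖iteratedFDeriv ℝ n (fun x => ∫ y, G (x, y) ∂μ) x‖
          ≤ ‖x‖ ^ k * ∫ y, ‖iteratedFDeriv ℝ n G (x, y)‖ ∂μ := by
            gcongr
            exact (partialIntegral_aux μ n G).2 x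
        _ = ∫ y, ‖x‖ ^ k * ‖iteratedFDeriv ℝ n G (x, y)‖ ∂μ := (integral_const_mul _ _).symm
        _ ≤ ∫ y, (1 + ‖y‖) ^ (-(μ.integrablePower : ℝ)) * (2 ^ (k + μ.integrablePower) *
              (Finset.Iic (k + μ.integrablePower, n)).sup
                (schwartzSeminormFamily ℝ (E × F) ℂ) G) ∂μ :=
            integral_mono ((slice_integrable_iter μ n G x).const_mul _)
              ((Measure.integrable_pow_neg_integrablePower μ).mul_const _)
              fun y => slice_bound μ k n G x y
        _ = _ := by
            rw [integral_mul_const, mul_assoc]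
            congr 2
            simp only [Seminorm.finset_sup_apply]
            rfl)

theorem partialIntegral_apply {E F : Type} [NormedAddCommGroup E] [NormedSpace ℝ E]
    [NormedAddCommGroup F] [NormedSpace ℝ F] [MeasurableSpace F] [BorelSpace F]
    [SecondCountableTopology F] (μ : Measure F) [μ.HasTemperateGrowth] (G : 𝓢(E × F, ℂ)) (x : E) :
    partialIntegral μ G x = ∫ y, G (x, y) ∂μ := rfl

end PartialIntegral

/-! ### Composition laws on a Schwartz space and their extension by duality -/

section Abstract
variable {E : Type} [NormedAddCommGroup E] [NormedSpace ℝ E]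

/-- A separately continuous bilinear composition law on `𝓢(E)`. -/
structure CompositionLaw (E : Type) [NormedAddCommGroup E] [NormedSpace ℝ E] where
  /-- the bilinear product -/
  mul : 𝓢(E, ℂ) →ₗ[ℂ] 𝓢(E, ℂ) →ₗ[ℂ] 𝓢(E, ℂ)
  continuous_mul_right : ∀ f, Continuous fun g => mul f g
  continuous_mul_left : ∀ g, Continuous fun f => mul f g

/-- Left multiplication `L_f(g) = f # g`. -/
noncomputable def CompositionLaw.L (m : CompositionLaw E) (f : 𝓢(E, ℂ)) : 𝓢(E, ℂ) →L[ℂ] 𝓢(E, ℂ) where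
  toLinearMap := m.mul f
  cont := m.continuous_mul_right f

/-- Right multiplication `R_f(g) = g # f`. -/
noncomputable def CompositionLaw.R (m : CompositionLaw E) (f : 𝓢(E, ℂ)) : 𝓢(E, ℂ) →L[ℂ] 𝓢(E, ℂ) where
  toLinearMap := m.mul.flip f
  cont := m.continuous_mul_left f

/-- Composition `f ↦ f ∘ τ` with a linear change of variables. -/
noncomputable def comp (τ : E ≃L[ℝ] E) : 𝓢(E, ℂ) →L[ℂ] 𝓢(E, ℂ) :=
  SchwartzMap.compCLMOfContinuousLinearEquiv ℂ τ

/-- Complex conjugation of Schwartz functions. -/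
noncomputable def conjS : 𝓢(E, ℂ) →L[ℝ] 𝓢(E, ℂ) :=
  SchwartzMap.postcompCLM (𝕜 := ℝ) (Complex.conjCLE : ℂ →L[ℝ] ℂ)

theorem conjS_apply (f : 𝓢(E, ℂ)) (x : E) : conjS f x = starRingEnd ℂ (f x) := rfl

/-- The involution `f ↦ conj (f ∘ τ)` attached to a change of variables `τ`
(with `τ = id` it is complex conjugation). -/
noncomputable def starS (τ : E ≃L[ℝ] E) (f : 𝓢(E, ℂ)) : 𝓢(E, ℂ) := conjS (comp τ f)

theorem starS_apply (τ : E ≃L[ℝ] E) (f : 𝓢(E, ℂ)) (x : E) :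
    starS τ f x = starRingEnd ℂ (f (τ x)) := rfl

/-- The involution on tempered distributions, `T^*(h) = conj (T (h^*))`. When `τ ∘ τ = id` and
`τ` preserves the measure, it extends the involution `starS τ` of Schwartz functions. -/
noncomputable def starD (τ : E ≃L[ℝ] E) (T : 𝓢'(E, ℂ)) : 𝓢'(E, ℂ) :=
  ContinuousLinearMap.toPointwiseConvergenceCLM _ _ _ _
    { toFun := fun h => starRingEnd ℂ (T (starS τ h))
      map_add' := fun h h' => by simp [starS]
      map_smul' := fun c h => by
        have : starS τ (c • h) = starRingEnd ℂ c • starS τ h := by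
          ext x; simp [starS_apply]
        simp [this]
      cont := Complex.continuous_conj.comp
        (T.continuous.comp (conjS.continuous.comp (comp τ).continuous)) }

theorem starD_apply (τ : E ≃L[ℝ] E) (T : 𝓢'(E, ℂ)) (h : 𝓢(E, ℂ)) :
    starD τ T h = starRingEnd ℂ (T (starS τ h)) := rfl

/-- The duality `⟨T, h⟩_τ = T (h ∘ τ)` between `𝓢'(E)` and `𝓢(E)`; formally it is
`∫ T(x) h(τ x) dx`, so `τ = id` gives the usual bilinear pairing. -/
noncomputable def dual (τ : E ≃L[ℝ] E) (T : 𝓢'(E, ℂ)) (h : 𝓢(E, ℂ)) : ℂ := T (comp τ h)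

/-- `T # g` for `T ∈ 𝓢'`, `g ∈ 𝓢`, defined by `⟨T # g, h⟩_τ = ⟨T, g # h⟩_τ`. -/
noncomputable def mulDS (m : CompositionLaw E) (τ : E ≃L[ℝ] E) (T : 𝓢'(E, ℂ)) (g : 𝓢(E, ℂ)) :
    𝓢'(E, ℂ) :=
  PointwiseConvergenceCLM.precomp ℂ ((comp τ).comp ((m.L g).comp (comp τ.symm))) T

/-- `g # T` for `T ∈ 𝓢'`, `g ∈ 𝓢`, defined by `⟨g # T, h⟩_τ = ⟨T, h # g⟩_τ`. -/
noncomputable def mulSD (m : CompositionLaw E) (τ : E ≃L[ℝ] E) (g : 𝓢(E, ℂ)) (T : 𝓢'(E, ℂ)) :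
    𝓢'(E, ℂ) :=
  PointwiseConvergenceCLM.precomp ℂ ((comp τ).comp ((m.R g).comp (comp τ.symm))) T

theorem comp_symm_comp (τ : E ≃L[ℝ] E) (h : 𝓢(E, ℂ)) : comp τ.symm (comp τ h) = h := by
  ext x; simp [comp]

theorem dual_mulDS (m : CompositionLaw E) (τ : E ≃L[ℝ] E) (T : 𝓢'(E, ℂ)) (g h : 𝓢(E, ℂ)) :
    dual τ (mulDS m τ T g) h = dual τ T (m.mul g h) := by
  change T (comp τ (m.mul g (comp τ.symm (comp τ h)))) = _
  rw [comp_symm_comp]; rfl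

theorem dual_mulSD (m : CompositionLaw E) (τ : E ≃L[ℝ] E) (T : 𝓢'(E, ℂ)) (g h : 𝓢(E, ℂ)) :
    dual τ (mulSD m τ g T) h = dual τ T (m.mul h g) := by
  change T (comp τ (m.mul (comp τ.symm (comp τ h)) g)) = _
  rw [comp_symm_comp]; rfl

variable [MeasurableSpace E] [BorelSpace E] [SecondCountableTopology E]

/-- The embedding `𝓢(E) ⊂ 𝓢'(E)`, `f ↦ (h ↦ ∫ h f dμ)`. -/
noncomputable def toDist (μ : Measure E) [μ.HasTemperateGrowth] : 𝓢(E, ℂ) →L[ℂ] 𝓢'(E, ℂ) :=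
  SchwartzMap.toTemperedDistributionCLM E ℂ μ

variable (m : CompositionLaw E) (τ : E ≃L[ℝ] E) (μ : Measure E) [μ.HasTemperateGrowth]

/-- The Moyal algebra of a composition law, as a subspace of `𝓢'(E)`:
`{T ∈ 𝓢' | T # 𝓢 ⊂ 𝓢, 𝓢 # T ⊂ 𝓢}`. -/
noncomputable def moyal : Submodule ℂ 𝓢'(E, ℂ) where
  carrier := {T | ∀ g : 𝓢(E, ℂ), mulDS m τ T g ∈ (toDist μ).range ∧
    mulSD m τ g T ∈ (toDist μ).range}
  zero_mem' g := by
    simp only [mulDS, mulSD, map_zero]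
    exact ⟨Submodule.zero_mem _, Submodule.zero_mem _⟩
  add_mem' hT hU g := by
    simp only [mulDS, mulSD, map_add]
    exact ⟨Submodule.add_mem _ (hT g).1 (hU g).1, Submodule.add_mem _ (hT g).2 (hU g).2⟩
  smul_mem' c T hT g := by
    simp only [mulDS, mulSD, map_smul]
    exact ⟨Submodule.smul_mem _ c (hT g).1, Submodule.smul_mem _ c (hT g).2⟩

theorem mem_moyal (T : 𝓢'(E, ℂ)) : T ∈ moyal m τ μ ↔
    ∀ g : 𝓢(E, ℂ), (∃ k, toDist μ k = mulDS m τ T g) ∧ (∃ k, toDist μ k = mulSD m τ g T) :=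
  Iff.rfl

/-- `V` is the product `T # U` in the Moyal algebra: `⟨V, h⟩_τ = ⟨T, U # h⟩_τ` for all `h ∈ 𝓢`,
where `k = U # h` is a Schwartz function since `U` is in the Moyal algebra. -/
def IsMoyalProduct (T U V : 𝓢'(E, ℂ)) : Prop :=
  ∀ h k : 𝓢(E, ℂ), toDist μ k = mulDS m τ U h → dual τ V h = dual τ T k

open Classical in
/-- The product of the Moyal algebra: the distribution `T # U` with
`⟨T # U, h⟩_τ = ⟨T, U # h⟩_τ` for all `h ∈ 𝓢` (and `0` if there is none). -/
noncomputable def moyalMul (T U : 𝓢'(E, ℂ)) : 𝓢'(E, ℂ) :=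
  if H : ∃ V, IsMoyalProduct m τ μ T U V then H.choose else 0

/-- The Moyal algebra is a `*`-algebra: the formula `⟨T # U, h⟩_τ = ⟨T, U # h⟩_τ` does define a
product on it, which is associative and bilinear, and it is stable under the involution, which is
involutive, conjugate linear and reverses products. -/
structure IsMoyalStarAlgebra : Prop where
  mul_spec : ∀ T ∈ moyal m τ μ, ∀ U ∈ moyal m τ μ,
    IsMoyalProduct m τ μ T U (moyalMul m τ μ T U)
  mul_mem : ∀ T ∈ moyal m τ μ, ∀ U ∈ moyal m τ μ, moyalMul m τ μ T U ∈ moyal m τ μ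
  mul_assoc : ∀ T ∈ moyal m τ μ, ∀ U ∈ moyal m τ μ, ∀ V ∈ moyal m τ μ,
    moyalMul m τ μ (moyalMul m τ μ T U) V = moyalMul m τ μ T (moyalMul m τ μ U V)
  add_mul : ∀ T ∈ moyal m τ μ, ∀ U ∈ moyal m τ μ, ∀ V ∈ moyal m τ μ,
    moyalMul m τ μ (T + U) V = moyalMul m τ μ T V + moyalMul m τ μ U V
  mul_add : ∀ T ∈ moyal m τ μ, ∀ U ∈ moyal m τ μ, ∀ V ∈ moyal m τ μ,
    moyalMul m τ μ T (U + V) = moyalMul m τ μ T U + moyalMul m τ μ T V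
  smul_mul : ∀ (c : ℂ), ∀ T ∈ moyal m τ μ, ∀ U ∈ moyal m τ μ,
    moyalMul m τ μ (c • T) U = c • moyalMul m τ μ T U
  mul_smul : ∀ (c : ℂ), ∀ T ∈ moyal m τ μ, ∀ U ∈ moyal m τ μ,
    moyalMul m τ μ T (c • U) = c • moyalMul m τ μ T U
  star_mem : ∀ T ∈ moyal m τ μ, starD τ T ∈ moyal m τ μ
  star_star : ∀ T ∈ moyal m τ μ, starD τ (starD τ T) = T
  star_add : ∀ T ∈ moyal m τ μ, ∀ U ∈ moyal m τ μ, starD τ (T + U) = starD τ T + starD τ U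
  star_smul : ∀ (c : ℂ), ∀ T ∈ moyal m τ μ, starD τ (c • T) = starRingEnd ℂ c • starD τ T
  star_mul : ∀ T ∈ moyal m τ μ, ∀ U ∈ moyal m τ μ,
    starD τ (moyalMul m τ μ T U) = moyalMul m τ μ (starD τ U) (starD τ T)

/-- `𝔏` is a `*`-subalgebra of the Moyal algebra. -/
structure IsMoyalStarSubalgebra (𝔏 : Submodule ℂ 𝓢'(E, ℂ)) : Prop where
  le_moyal : 𝔏 ≤ moyal m τ μ
  mul_mem : ∀ T ∈ 𝔏, ∀ U ∈ 𝔏, moyalMul m τ μ T U ∈ 𝔏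
  star_mem : ∀ T ∈ 𝔏, starD τ T ∈ 𝔏

/-- The continuous linear map `Φ` restricts to a morphism of `*`-algebras from the Moyal algebra
of `m` to that of `m'`. -/
structure IsMoyalStarHom {E' : Type} [NormedAddCommGroup E'] [NormedSpace ℝ E']
    [MeasurableSpace E'] [BorelSpace E'] [SecondCountableTopology E']
    (m' : CompositionLaw E') (τ' : E' ≃L[ℝ] E') (μ' : Measure E') [μ'.HasTemperateGrowth]
    (Φ : 𝓢'(E, ℂ) →L[ℂ] 𝓢'(E', ℂ)) : Prop where
  mapsTo : ∀ T ∈ moyal m τ μ, Φ T ∈ moyal m' τ' μ'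
  map_mul : ∀ T ∈ moyal m τ μ, ∀ U ∈ moyal m τ μ,
    Φ (moyalMul m τ μ T U) = moyalMul m' τ' μ' (Φ T) (Φ U)
  map_star : ∀ T ∈ moyal m τ μ, Φ (starD τ T) = starD τ' (Φ T)

open Classical in
/-- The Schwartz function that represents a tempered distribution (`0` if there is none). -/
noncomputable def repS (T : 𝓢'(E, ℂ)) : 𝓢(E, ℂ) :=
  if H : ∃ k, toDist μ k = T then H.choose else 0

/-- The distribution `T ⊗ h` on `E × F`: `⟨T ⊗ h, G⟩ = ⟨T, x ↦ ∫ h(y) G(x, y) dμ(y)⟩`. As a map of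
`T`, this is the localization map `J_h`. -/
noncomputable def tensorDist {F : Type} [NormedAddCommGroup F] [NormedSpace ℝ F]
    (h : 𝓢(E, ℂ)) : 𝓢'(F, ℂ) →L[ℂ] 𝓢'(F × E, ℂ) :=
  PointwiseConvergenceCLM.precomp ℂ
    ((partialIntegral μ).comp (SchwartzMap.smulLeftCLM ℂ fun z : F × E => h z.2))

theorem tensorDist_apply {F : Type} [NormedAddCommGroup F] [NormedSpace ℝ F]
    (h : 𝓢(E, ℂ)) (T : 𝓢'(F, ℂ)) (G : 𝓢(F × E, ℂ)) (k : 𝓢(F, ℂ))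
    (hk : ∀ x, k x = ∫ y, h y * G (x, y) ∂μ) : tensorDist μ h T G = T k := by
  have hg : (fun z : F × E => h z.2).HasTemperateGrowth :=
    h.hasTemperateGrowth.comp (ContinuousLinearMap.snd ℝ F E).hasTemperateGrowth
  change T (partialIntegral μ (SchwartzMap.smulLeftCLM ℂ (fun z : F × E => h z.2) G)) = T k
  congr 1
  ext x
  rw [hk, partialIntegral_apply]
  simp [SchwartzMap.smulLeftCLM_apply_apply hg]

end Abstract

/-! ### Phase space -/

/-- The phase space `Ξ = ℝⁿ × ℝⁿ`, with points `X = (x, ξ)`. -/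
abbrev Phase (n : ℕ) : Type := EuclideanSpace ℝ (Fin n) × EuclideanSpace ℝ (Fin n)

section PhaseSpace
variable {n : ℕ}

/-- The symplectic form `σ((x, ξ), (y, η)) = y · ξ - x · η`. -/
noncomputable def sigma (X Y : Phase n) : ℝ := inner ℝ Y.1 X.2 - inner ℝ X.1 Y.2

/-- The Haar measure `dX = (2π)⁻ⁿ dx dξ`, for which the symplectic Fourier transformation is
unitary. -/
noncomputable def haar (n : ℕ) : Measure (Phase n) :=
  ENNReal.ofReal ((2 * Real.pi)⁻¹ ^ n) • volume

instance : (haar n).IsAddHaarMeasure := by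
  have h : (volume : Measure (Phase n)).IsAddHaarMeasure :=
    Measure.prod.instIsAddHaarMeasure volume volume
  exact Measure.IsAddHaarMeasure.smul volume (by simp [Real.pi_pos]) (by simp)

/-- The product Haar measure on `Ξ × Ξ`. -/
noncomputable def haar2 (n : ℕ) : Measure (Phase n × Phase n) := (haar n).prod (haar n)

instance : (haar2 n).IsAddHaarMeasure := by
  have : SFinite (haar n) := inferInstance
  have : SigmaFinite (haar n) := inferInstance
  exact Measure.prod.instIsAddHaarMeasure (haar n) (haar n)

/-- The linear isomorphism `(y, η) ↦ (2π)⁻¹ (η, -y)` onto the Euclidean space `ℝⁿ × ℝⁿ`. -/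
noncomputable def fourierVar (n : ℕ) :
    Phase n ≃L[ℝ] WithLp 2 (EuclideanSpace ℝ (Fin n) × EuclideanSpace ℝ (Fin n)) :=
  ((((ContinuousLinearEquiv.prodComm ℝ _ _).trans
    ((ContinuousLinearEquiv.refl ℝ _).prodCongr (ContinuousLinearEquiv.neg ℝ))).trans
      (ContinuousLinearEquiv.smulLeft (Units.mk0 (2 * Real.pi)⁻¹ (by positivity)))).trans
        (WithLp.prodContinuousLinearEquiv 2 ℝ _ _).symm)

open scoped FourierTransform in
/-- The symplectic Fourier transformation `(𝔉 f)(Y) = ∫ e^{-iσ(Y,Z)} f(Z) dZ`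
(see `symplecticFourier_apply`), as a continuous linear map on `𝓢(Ξ)`. -/
noncomputable def symplecticFourier (n : ℕ) : 𝓢(Phase n, ℂ) →L[ℂ] 𝓢(Phase n, ℂ) :=
  (((2 * Real.pi)⁻¹ ^ n : ℝ) : ℂ) •
    ((SchwartzMap.compCLMOfContinuousLinearEquiv ℂ (fourierVar n)).comp
      ((SchwartzMap.fourierTransformCLM ℂ).comp
        (SchwartzMap.compCLMOfContinuousLinearEquiv ℂ (WithLp.prodContinuousLinearEquiv 2 ℝ _ _))))

theorem integral_haar (f : Phase n → ℂ) :
    ∫ Z, f Z ∂(haar n) = (((2 * Real.pi)⁻¹ ^ n : ℝ) : ℂ) * ∫ Z, f Z := by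
  rw [haar, integral_smul_measure, ENNReal.toReal_ofReal (by positivity)]
  simp

theorem symplecticFourier_apply (f : 𝓢(Phase n, ℂ)) (Y : Phase n) :
    symplecticFourier n f Y = ∫ Z, Complex.exp (-(Complex.I * sigma Y Z)) * f Z ∂(haar n) := by
  have h1 : symplecticFourier n f Y = (((2 * Real.pi)⁻¹ ^ n : ℝ) : ℂ) *
      FourierTransform.fourier
        (fun v : WithLp 2 (EuclideanSpace ℝ (Fin n) × EuclideanSpace ℝ (Fin n)) => f v.ofLp)
        (fourierVar n Y) := rfl
  rw [integral_haar, h1, Real.fourier_eq']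
  congr 1
  rw [← (WithLp.volume_preserving_toLp (EuclideanSpace ℝ (Fin n))
    (EuclideanSpace ℝ (Fin n))).integral_comp
      (MeasurableEquiv.toLp 2 _).measurableEmbedding]
  congr 1
  funext Z
  rw [smul_eq_mul]
  congr 2
  have hv : fourierVar n Y = WithLp.toLp 2 ((2 * Real.pi)⁻¹ • Y.2, (2 * Real.pi)⁻¹ • (-Y.1)) := rfl
  have hpi : (Real.pi : ℂ) ≠ 0 := by exact_mod_cast Real.pi_ne_zero
  rw [hv]
  simp only [WithLp.prod_inner_apply, inner_smul_right, inner_neg_right, sigma]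
  rw [real_inner_comm Z.2 Y.1]
  push_cast
  field_simp
  ring

/-- The plane wave `e_X(Z) = exp(i σ(X, Z))`, as a tempered distribution. -/
noncomputable def planeWave (X : Phase n) : 𝓢'(Phase n, ℂ) :=
  ContinuousLinearMap.toPointwiseConvergenceCLM _ _ _ _
    ((TemperedDistribution.delta (-X)).comp (symplecticFourier n))

theorem planeWave_apply (X : Phase n) (h : 𝓢(Phase n, ℂ)) :
    planeWave X h = ∫ Z, Complex.exp (Complex.I * sigma X Z) * h Z ∂(haar n) := by
  change symplecticFourier n h (-X) = _
  rw [symplecticFourier_apply]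
  congr 1
  funext Z
  congr 2
  simp only [sigma, Prod.fst_neg, Prod.snd_neg, inner_neg_right, inner_neg_left]
  push_cast
  ring

/-- The linear change of variables `((X, Y), Z) ↦ ((X, Z), (X - Z, Y - Z))`. -/
noncomputable def crossedVar (n : ℕ) :
    (Phase n × Phase n) × Phase n →L[ℝ] (Phase n × Phase n) × (Phase n × Phase n) :=
  ContinuousLinearMap.mk
    { toFun := fun z => ((z.1.1, z.2), (z.1.1 - z.2, z.1.2 - z.2))
      map_add' := fun z w => by ext <;> simp <;> ring
      map_smul' := fun c z => by ext <;> simp <;> ring }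
    (by dsimp only; fun_prop)

theorem crossedVar_apply (X Y Z : Phase n) :
    crossedVar n ((X, Y), Z) = ((X, Z), (X - Z, Y - Z)) := rfl

/-- Composition of Schwartz functions with `crossedVar`. -/
noncomputable def crossedPull (n : ℕ) :
    𝓢((Phase n × Phase n) × (Phase n × Phase n), ℂ) →L[ℂ] 𝓢((Phase n × Phase n) × Phase n, ℂ) :=
  SchwartzMap.compCLM ℂ (crossedVar n).hasTemperateGrowth ⟨1, 2, by
    rintro ⟨⟨X, Y⟩, Z⟩
    rw [crossedVar_apply, pow_one]
    have hX : ‖X‖ ≤ ‖((X, Z), (X - Z, Y - Z))‖ :=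
      (norm_fst_le (X, Z)).trans (norm_fst_le ((X, Z), (X - Z, Y - Z)))
    have hZ : ‖Z‖ ≤ ‖((X, Z), (X - Z, Y - Z))‖ :=
      (norm_snd_le (X, Z)).trans (norm_fst_le ((X, Z), (X - Z, Y - Z)))
    have hYZ : ‖Y - Z‖ ≤ ‖((X, Z), (X - Z, Y - Z))‖ :=
      (norm_snd_le (X - Z, Y - Z)).trans (norm_snd_le ((X, Z), (X - Z, Y - Z)))
    have hY : ‖Y‖ ≤ ‖Y - Z‖ + ‖Z‖ := by simpa using norm_add_le (Y - Z) Z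
    have h0 : 0 ≤ ‖((X, Z), (X - Z, Y - Z))‖ := norm_nonneg _
    rw [Prod.norm_def, Prod.norm_def]
    refine max_le (max_le ?_ ?_) ?_ <;> dsimp only <;> linarith⟩

/-- The crossed product composition `(F ⋄ G)(X, Y) = ∫ F(X, Z) G(X - Z, Y - Z) dZ` on `𝓢(Ξ × Ξ)`
(see `diamond_apply`). -/
noncomputable def diamond (n : ℕ) : CompositionLaw (Phase n × Phase n) where
  mul := LinearMap.mk₂ ℂ
    (fun F G => partialIntegral (haar n) (crossedPull n (tensor F G)))
    (fun F F' G => by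
      rw [← map_add, ← map_add]; congr 2; ext z; simp [add_mul])
    (fun c F G => by
      rw [← map_smul, ← map_smul]; congr 2; ext z; simp [mul_assoc])
    (fun F G G' => by
      rw [← map_add, ← map_add]; congr 2; ext z; simp [mul_add])
    (fun c F G => by
      rw [← map_smul, ← map_smul]; congr 2; ext z; simp [mul_left_comm])
  continuous_mul_right F := (partialIntegral (haar n)).continuous.comp
    ((crossedPull n).continuous.comp (continuous_tensor_right F))
  continuous_mul_left G := (partialIntegral (haar n)).continuous.comp
    ((crossedPull n).continuous.comp (continuous_tensor_left G))

theorem diamond_apply (F G : 𝓢(Phase n × Phase n, ℂ)) (X Y : Phase n) :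
    (diamond n).mul F G (X, Y) = ∫ Z, F (X, Z) * G (X - Z, Y - Z) ∂(haar n) := rfl

/-- The trivial change of variables, for the laws whose involution is complex conjugation. -/
noncomputable def tId (n : ℕ) : Phase n ≃L[ℝ] Phase n := ContinuousLinearEquiv.refl ℝ _

/-- The trivial change of variables on `Ξ × Ξ`. -/
noncomputable def tId2 (n : ℕ) : (Phase n × Phase n) ≃L[ℝ] (Phase n × Phase n) :=
  ContinuousLinearEquiv.refl ℝ _

/-- The change of variables `(X, Y) ↦ (X - Y, -Y)`. The involution of the crossed product is
`F^⋄(X, Y) = conj (F (X - Y, -Y))`, and the duality for which `⋄` is cyclic,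
`∫∫ F(X, X - Y) G(Y, Y - X) dX dY`, equals `∫∫ F(X, Y) G(X - Y, -Y) dX dY`. -/
noncomputable def tDiamond (n : ℕ) : (Phase n × Phase n) ≃L[ℝ] (Phase n × Phase n) :=
  ContinuousLinearEquiv.mk
    { toFun := fun z => (z.1 - z.2, -z.2)
      invFun := fun z => (z.1 - z.2, -z.2)
      map_add' := fun z w => by ext <;> simp <;> ring
      map_smul' := fun c z => by ext <;> simp <;> ring
      left_inv := fun z => by ext <;> simp
      right_inv := fun z => by ext <;> simp }
    (by dsimp only; fun_prop) (by dsimp only; fun_prop)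

theorem tDiamond_apply (X Y : Phase n) : tDiamond n (X, Y) = (X - Y, -Y) := rfl

/-- The change of variables `C(X, Y) = (-X, X - Y)`. -/
noncomputable def modVar (n : ℕ) : (Phase n × Phase n) ≃L[ℝ] (Phase n × Phase n) :=
  ContinuousLinearEquiv.mk
    { toFun := fun z => (-z.1, z.1 - z.2)
      invFun := fun z => (-z.1, -z.1 - z.2)
      map_add' := fun z w => by ext <;> simp <;> ring
      map_smul' := fun c z => by ext <;> simp <;> ring
      left_inv := fun z => by ext <;> simp
      right_inv := fun z => by ext <;> simp }
    (by dsimp only; fun_prop) (by dsimp only; fun_prop)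

theorem modVar_apply (X Y : Phase n) : modVar n (X, Y) = (-X, X - Y) := rfl

/-- Hypothesis A: `(𝓢(Ξ), #)`, with complex conjugation, is a `*`-algebra (`#` being bilinear and
separately continuous) and `∫ f # g = ∫ f g`. -/
structure HypothesisA (P : CompositionLaw (Phase n)) : Prop where
  assoc : ∀ f g h, P.mul (P.mul f g) h = P.mul f (P.mul g h)
  conj_mul : ∀ f g, conjS (P.mul f g) = P.mul (conjS g) (conjS f)
  integral_mul : ∀ f g, ∫ X, P.mul f g X ∂(haar n) = ∫ X, f X * g X ∂(haar n)

/-- Hypothesis B: `𝓢(Ξ) # 𝓢'(Ξ) # 𝓢(Ξ) ⊂ 𝓢(Ξ)`. -/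
def HypothesisB (P : CompositionLaw (Phase n)) : Prop :=
  ∀ (f g : 𝓢(Phase n, ℂ)) (T : 𝓢'(Phase n, ℂ)), ∃ k,
    toDist (haar n) k = mulDS P (tId n) (mulSD P (tId n) f T) g

/-- The value at `h ∈ 𝓢(Ξ)` of the distribution `S # f # T`, where `S, T ∈ 𝓢'(Ξ)` and
`f ∈ 𝓢(Ξ)`: `⟨S # f # T, h⟩ = ⟨S, f # T # h⟩` (under Hypothesis B, `f # T # h ∈ 𝓢(Ξ)`). -/
noncomputable def sandwich (P : CompositionLaw (Phase n)) (S : 𝓢'(Phase n, ℂ))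
    (f : 𝓢(Phase n, ℂ)) (T : 𝓢'(Phase n, ℂ)) (h : 𝓢(Phase n, ℂ)) : ℂ :=
  S (repS (haar n) (mulDS P (tId n) (mulSD P (tId n) f T) h))

/-- Hypothesis C: `∫∫ [Θ_Z(f)](Y) g(Y) dY dZ = ∫ f · ∫ g`, where `Θ_Z(f) = e_{-Z} # f # e_Z`. -/
def HypothesisC (P : CompositionLaw (Phase n)) : Prop :=
  ∀ f g : 𝓢(Phase n, ℂ),
    ∫ Z, sandwich P (planeWave (-Z)) f (planeWave Z) g ∂(haar n) =
      (∫ X, f X ∂(haar n)) * ∫ X, g X ∂(haar n)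

/-- `B` is the law `□` on `𝓢(Ξ × Ξ)`: `(f ⊗ h) □ (g ⊗ k) = (f # g) ⊗ (k # h)`. -/
def IsSquare (P : CompositionLaw (Phase n)) (B : CompositionLaw (Phase n × Phase n)) : Prop :=
  ∀ f h g k : 𝓢(Phase n, ℂ),
    B.mul (tensor f h) (tensor g k) = tensor (P.mul f g) (P.mul k h)

/-- `N` is the continuous linear map `𝐍` of `𝓢'(Ξ × Ξ)`:
`⟨𝐍(f₁ ⊗ f₂), g₁ ⊗ g₂⟩ = ⟨ĝ₁ # f₁, ĝ₂ # f₂⟩` for Schwartz functions. -/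
def IsNMap (P : CompositionLaw (Phase n))
    (N : 𝓢'(Phase n × Phase n, ℂ) →L[ℂ] 𝓢'(Phase n × Phase n, ℂ)) : Prop :=
  ∀ f₁ f₂ g₁ g₂ : 𝓢(Phase n, ℂ),
    N (toDist (haar2 n) (tensor f₁ f₂)) (tensor g₁ g₂) =
      ∫ X, P.mul (symplecticFourier n g₁) f₁ X * P.mul (symplecticFourier n g₂) f₂ X ∂(haar n)

/-- The modulation mapping `𝐌` on `𝓢'(Ξ × Ξ)`: `𝐌(F) = 𝐍(F) ∘ C` with `C(X, Y) = (-X, X - Y)`,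
so that `[𝐌(f ⊗ g)](X, Y) = [𝐍(f ⊗ g)](-X, X - Y) = ⟨e_{-X} # f, e_{X-Y} # g⟩`. The composition of
a distribution with the measure preserving map `C` is `⟨T ∘ C, G⟩ = ⟨T, G ∘ C⁻¹⟩`. -/
noncomputable def modulation
    (N : 𝓢'(Phase n × Phase n, ℂ) →L[ℂ] 𝓢'(Phase n × Phase n, ℂ)) :
    𝓢'(Phase n × Phase n, ℂ) →L[ℂ] 𝓢'(Phase n × Phase n, ℂ) :=
  (PointwiseConvergenceCLM.precomp ℂ (comp (modVar n).symm)).comp N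

/-- The localized modulation mapping `𝐌_h(f) = 𝐌(f ⊗ h)`, `𝓢'(Ξ) → 𝓢'(Ξ × Ξ)`. -/
noncomputable def modulationAt
    (N : 𝓢'(Phase n × Phase n, ℂ) →L[ℂ] 𝓢'(Phase n × Phase n, ℂ)) (h : 𝓢(Phase n, ℂ)) :
    𝓢'(Phase n, ℂ) →L[ℂ] 𝓢'(Phase n × Phase n, ℂ) :=
  (modulation N).comp (tensorDist (haar n) h)

/-- The induced space `𝔏^𝐌_h = 𝐌_h⁻¹(𝔏) ⊂ 𝓢'(Ξ)`. -/
noncomputable def induced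
    (N : 𝓢'(Phase n × Phase n, ℂ) →L[ℂ] 𝓢'(Phase n × Phase n, ℂ)) (h : 𝓢(Phase n, ℂ))
    (𝔏 : Submodule ℂ 𝓢'(Phase n × Phase n, ℂ)) : Submodule ℂ 𝓢'(Phase n, ℂ) :=
  𝔏.comap (modulationAt N h).toLinearMap

end PhaseSpace
end MoyalModulation

/-! The theorem rests on Schwartz kernels. By (B) the operator `k ↦ f # k # g` maps `𝓢'` into `𝓢`,
so it has a kernel in `𝓢(Ξ × Ξ)`, and by the kernel theorem these kernels are the values on `f ⊗ g`
of one continuous linear map `κ` (`exists_kernelMap`). Since `(f # g) # u # (k # h) = f # (g # u #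
k) # h`, the map `κ` turns `□` into composition of kernels, and conjugation into the operator
adjoint.

A partial Fourier transformation with a shear, `kernelToCrossed`, turns composition of kernels into
`⋄`, the adjoint into the involution of `⋄`, and the operator trace into `F ↦ ∫ F(X, 0) dX`. In
these terms (C) says that the trace of `κ F` is `∫ F` (`trace`). As `∫ F □ G = ∫ F G`, the map `Φ =
kernelToCrossed ∘ κ` carries one duality to the other (`pair_map`). The transpose of `κ` is `κ` up
to flips (`transpose`), and together these facts give `κ ∘ κ = id` (`involutive`). So `Φ` is a
`*`-isomorphism of Schwartz algebras that respects the dualities.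

The modulation map is the transpose of `Φ⁻¹` for the two dualities (`dual_modulation`), and Moyal
algebras are defined by the product and the duality alone; hence they correspond under `𝐌`. The
axioms needed for a Moyal `*`-algebra are collected in `MoyalData`; they are checked for `#` and
`□`, and reach `⋄` through `Φ`. For an idempotent `h`, the identity `(T ⊗ h) □ (U ⊗ h) = (T # U) ⊗
(h # h)` makes `T ↦ T ⊗ h` multiplicative. The Moyal algebra of `□` contains `T ⊗ h` only if that of
`#` contains `T`, because a contraction recovers `T # g` from `(T # g) ⊗ h`.

The functional analysis comes from one device, a Gabor expansion `g = ∑ ⟨c j, g⟩ e j` with rapidly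
decreasing coefficients and polynomially bounded atoms. It yields the kernel theorem
(`exists_lift`), density of elementary tensors, a substitute for the closed graph theorem
(`continuous_of_pairing`) and smooth kernels for operators `𝓢' → 𝓢` (`exists_kernel`). -/

namespace MoyalModulation

set_option linter.unusedSectionVars false

/-! ### Summable families and completeness of the Schwartz space -/

section Summation
open Filter Topology
variable {E : Type*} [NormedAddCommGroup E] [NormedSpace ℝ E]

/-- A family of Schwartz functions whose seminorms are summable has a sum. -/
theorem schwartz_hasSum {J : Type*} (u : J → 𝓢(E, ℂ))
    (hu : ∀ k n, Summable fun j => SchwartzMap.seminorm ℂ k n (u j)) :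
    ∃ s : 𝓢(E, ℂ), HasSum u s ∧ ∀ x, HasSum (fun j => u j x) (s x) := by
  have hb : ∀ (n : ℕ) (j : J) (x : E), ‖iteratedFDeriv ℝ n (u j) x‖ ≤
      SchwartzMap.seminorm ℂ 0 n (u j) := fun n j x => by
    simpa using SchwartzMap.le_seminorm ℂ 0 n (u j) x
  have hsm : ContDiff ℝ ∞ (fun x => ∑' j, u j x) :=
    contDiff_tsum (N := ⊤) (v := fun n j => SchwartzMap.seminorm ℂ 0 n (u j))
      (fun j => (u j).smooth ⊤) (fun n _ => hu 0 n) (fun n j x _ => hb n j x)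
  have hd : ∀ n x, iteratedFDeriv ℝ n (fun x => ∑' j, u j x) x =
      ∑' j, iteratedFDeriv ℝ n (u j) x := fun n x =>
    iteratedFDeriv_tsum_apply (N := ⊤) (v := fun n j => SchwartzMap.seminorm ℂ 0 n (u j))
      (fun j => (u j).smooth ⊤) (fun n _ => hu 0 n) (fun n j x _ => hb n j x) le_top x
  have hds : ∀ n x, Summable fun j => iteratedFDeriv ℝ n (u j) x := fun n x =>
    Summable.of_norm_bounded (hu 0 n) (fun j => hb n j x)
  have hp : ∀ x, Summable fun j => u j x := fun x =>
    Summable.of_norm_bounded (hu 0 0) (fun j => by simpa using hb 0 j x)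
  -- One bound for sums over any index set: with all indices it gives the decay of the sum, with the
  -- complement of a finite set the convergence of the partial sums.
  have key : ∀ (t : Set J) (k n : ℕ) (x : E),
      ‖x‖ ^ k * ‖∑' j : t, iteratedFDeriv ℝ n (u j) x‖ ≤
        ∑' j : t, SchwartzMap.seminorm ℂ k n (u j) := by
    intro t k n x
    have h1 : Summable fun j : t => ‖iteratedFDeriv ℝ n (u j) x‖ :=
      (Summable.of_nonneg_of_le (fun _ => norm_nonneg _) (fun j => hb n j x) (hu 0 n)).subtype t
    calc _ ≤ ‖x‖ ^ k * ∑' j : t, ‖iteratedFDeriv ℝ n (u j) x‖ := by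
            gcongr
            exact norm_tsum_le_tsum_norm h1
      _ = ∑' j : t, ‖x‖ ^ k * ‖iteratedFDeriv ℝ n (u j) x‖ := tsum_mul_left.symm
      _ ≤ _ := (h1.mul_left _).tsum_le_tsum
          (fun j => SchwartzMap.le_seminorm ℂ k n (u j) x) ((hu k n).subtype t)
  let s : 𝓢(E, ℂ) :=
    { toFun := fun x => ∑' j, u j x
      smooth' := hsm
      decay' := fun k n => ⟨∑' j, SchwartzMap.seminorm ℂ k n (u j), fun x => by
        rw [hd]
        have := key Set.univ k n x
        rwa [tsum_univ (fun j => iteratedFDeriv ℝ n (u j) x),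
          tsum_univ (fun j => SchwartzMap.seminorm ℂ k n (u j))] at this⟩ }
  refine ⟨s, ?_, fun x => (hp x).hasSum⟩
  rw [HasSum, SummationFilter.unconditional_filter, (schwartz_withSeminorms ℂ E ℂ).tendsto_nhds]
  rintro ⟨k, n⟩ ε hε
  have ht := (tendsto_tsum_compl_atTop_zero fun j => SchwartzMap.seminorm ℂ k n (u j)).eventually
    (gt_mem_nhds hε)
  filter_upwards [ht] with A hA
  refine lt_of_le_of_lt ?_ hA
  rw [map_sub_rev]
  refine SchwartzMap.seminorm_le_bound ℂ k n _ (tsum_nonneg fun j => apply_nonneg _ _) fun x => ?_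
  have : iteratedFDeriv ℝ n (s - ∑ j ∈ A, u j : 𝓢(E, ℂ)) x =
      ∑' j : {j // j ∉ A}, iteratedFDeriv ℝ n (u j) x := by
    have e1 : (⇑(s - ∑ j ∈ A, u j : 𝓢(E, ℂ)) : E → ℂ) = ⇑s - fun x => ∑ j ∈ A, u j x := by
      funext y
      simp
    rw [e1, iteratedFDeriv_sub_apply (s.smooth n).contDiffAt
      (ContDiff.sum fun j _ => (u j).smooth n).contDiffAt,
      iteratedFDeriv_fun_sum_apply fun j _ => ((u j).smooth n).contDiffAt, sub_eq_iff_eq_add']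
    change iteratedFDeriv ℝ n (fun x => ∑' j, u j x) x = _
    rw [hd]
    exact ((hds n x).sum_add_tsum_compl).symm
  rw [this]
  exact key (Aᶜ : Set J) k n x

theorem continuous_sup_schwartzSeminorm (s : Finset (ℕ × ℕ)) :
    Continuous (s.sup (schwartzSeminormFamily ℂ E ℂ) : Seminorm ℂ 𝓢(E, ℂ)) := by
  classical
  induction s using Finset.induction_on with
  | empty => simpa using! continuous_const
  | insert i s _ ih =>
    rw [Finset.sup_insert, Seminorm.coe_sup]
    exact ((schwartz_withSeminorms ℂ E ℂ).continuous_seminorm i).sup ih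

/-- The uniformity is countably generated, so sequences with prescribed rate of convergence suffice.
The differences of consecutive terms of such a sequence have summable seminorms, and the telescoping
series converges by `schwartz_hasSum`. -/
instance schwartz_completeSpace : CompleteSpace 𝓢(E, ℂ) := by
  have : (uniformity 𝓢(E, ℂ)).IsCountablyGenerated :=
    IsUniformAddGroup.uniformity_countably_generated
  have hp := fun N : ℕ => continuous_sup_schwartzSeminorm (E := E) (Finset.Iic (N, N))
  refine UniformSpace.complete_of_convergent_controlled_sequences
    (fun N => {z | (Finset.Iic (N, N)).sup (schwartzSeminormFamily ℂ E ℂ) (z.2 - z.1) <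
      (1 / 2) ^ N}) (fun N => ?_) fun u hu => ?_
  · rw [uniformity_eq_comap_nhds_zero]
    refine ⟨_, (IsOpen.mem_nhds (isOpen_lt (hp N) continuous_const) ?_), Set.Subset.rfl⟩
    simp
  · have hs : ∀ k n, Summable fun j => SchwartzMap.seminorm ℂ k n (u (j + 1) - u j) := by
      intro k n
      refine Summable.of_norm_bounded_eventually_nat (g := fun j => (1 / 2 : ℝ) ^ j)
        (summable_geometric_of_lt_one (by norm_num) (by norm_num)) ?_
      filter_upwards [eventually_ge_atTop (max k n)] with j hj
      have h1 := hu j j (j + 1) le_rfl (Nat.le_succ j)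
      rw [Real.norm_of_nonneg (apply_nonneg _ _)]
      refine le_trans ?_ (le_of_lt h1)
      exact Seminorm.le_finset_sup_apply (p := schwartzSeminormFamily ℂ E ℂ) (i := (k, n))
        (Finset.mem_Iic.2 (Prod.mk_le_mk.2 ⟨(le_max_left _ _).trans hj,
          (le_max_right _ _).trans hj⟩))
    obtain ⟨s, hs, -⟩ := schwartz_hasSum _ hs
    refine ⟨s + u 0, ?_⟩
    have := hs.tendsto_sum_nat.add_const (u 0)
    simpa only [Finset.sum_range_sub, sub_add_cancel] using this

instance schwartz_baireSpace : BaireSpace 𝓢(E, ℂ) := by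
  have : (uniformity 𝓢(E, ℂ)).IsCountablyGenerated :=
    IsUniformAddGroup.uniformity_countably_generated
  infer_instance

end Summation

/-! ### Norm estimates, uniform boundedness and bilinear maps -/

section Bounds
open Filter Topology
variable {E : Type*} [NormedAddCommGroup E] [NormedSpace ℝ E]
  {G : Type*} [NormedAddCommGroup G] [NormedSpace ℝ G]
  {H : Type*} [NormedAddCommGroup H] [NormedSpace ℝ H]

/-- The increasing sequence of norms that defines the topology of the Schwartz space. -/
noncomputable def schwartzNorm (N : ℕ) : Seminorm ℂ 𝓢(E, ℂ) :=
  (Finset.Iic (N, N)).sup (schwartzSeminormFamily ℂ E ℂ)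

theorem continuous_schwartzNorm (N : ℕ) : Continuous (schwartzNorm N : Seminorm ℂ 𝓢(E, ℂ)) :=
  continuous_sup_schwartzSeminorm _

theorem schwartzNorm_mono {M N : ℕ} (h : M ≤ N) (f : 𝓢(E, ℂ)) :
    schwartzNorm M f ≤ schwartzNorm N f :=
  Seminorm.le_def.1 (Finset.sup_mono (Finset.Iic_subset_Iic.2 (Prod.mk_le_mk.2 ⟨h, h⟩))) f

theorem seminorm_le_schwartzNorm {k n N : ℕ} (hk : k ≤ N) (hn : n ≤ N) (f : 𝓢(E, ℂ)) :
    SchwartzMap.seminorm ℂ k n f ≤ schwartzNorm N f :=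
  Seminorm.le_finset_sup_apply (p := schwartzSeminormFamily ℂ E ℂ) (i := (k, n))
    (Finset.mem_Iic.2 (Prod.mk_le_mk.2 ⟨hk, hn⟩))

theorem schwartzNorm_le {N : ℕ} {f : 𝓢(E, ℂ)} {C : ℝ} (hC : 0 ≤ C)
    (h : ∀ k ≤ N, ∀ n ≤ N, SchwartzMap.seminorm ℂ k n f ≤ C) : schwartzNorm N f ≤ C :=
  Seminorm.finset_sup_apply_le hC fun i hi =>
    h i.1 (Prod.mk_le_mk.1 (Finset.mem_Iic.1 hi)).1 i.2 (Prod.mk_le_mk.1 (Finset.mem_Iic.1 hi)).2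

theorem norm_le_schwartzNorm (N : ℕ) (f : 𝓢(E, ℂ)) (x : E) : ‖f x‖ ≤ schwartzNorm N f :=
  (SchwartzMap.norm_le_seminorm ℂ f x).trans
    (seminorm_le_schwartzNorm (Nat.zero_le _) (Nat.zero_le _) f)

theorem exists_sup_le_schwartzNorm (s : Finset (ℕ × ℕ)) :
    ∃ N, ∀ f : 𝓢(E, ℂ), s.sup (schwartzSeminormFamily ℂ E ℂ) f ≤ schwartzNorm N f := by
  refine ⟨s.sup fun i => max i.1 i.2, fun f => ?_⟩
  refine Seminorm.finset_sup_apply_le (apply_nonneg _ _) fun i hi => ?_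
  have := Finset.le_sup (f := fun i : ℕ × ℕ => max i.1 i.2) hi
  exact seminorm_le_schwartzNorm ((le_max_left _ _).trans this) ((le_max_right _ _).trans this) f

/-- A continuous seminorm on the Schwartz space is bounded by one of the defining norms. -/
theorem exists_bound_of_continuous (q : Seminorm ℂ 𝓢(E, ℂ)) (hq : Continuous q) :
    ∃ N, ∃ C : ℝ, 0 ≤ C ∧ ∀ f, q f ≤ C * schwartzNorm N f := by
  obtain ⟨s, C, -, h⟩ := Seminorm.bound_of_continuous (schwartz_withSeminorms ℂ E ℂ) q hq
  obtain ⟨N, hN⟩ := exists_sup_le_schwartzNorm (E := E) s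
  exact ⟨N, C, C.2, fun f => (h f).trans (mul_le_mul_of_nonneg_left (hN f) C.2)⟩

/-- The uniform boundedness principle for continuous seminorms on the Schwartz space. -/
theorem exists_uniform_bound {J : Type*} (q : J → Seminorm ℂ 𝓢(E, ℂ))
    (hq : ∀ j, Continuous (q j)) (hb : ∀ f, ∃ C, ∀ j, q j f ≤ C) :
    ∃ N, ∃ C : ℝ, 0 ≤ C ∧ ∀ j f, q j f ≤ C * schwartzNorm N f := by
  have bdd : BddAbove (Set.range q) := by
    rw [Seminorm.bddAbove_range_iff]
    exact fun f => (hb f).imp fun C hC => by rintro _ ⟨j, rfl⟩; exact hC j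
  -- The Schwartz space is a Baire space, hence barrelled, so a pointwise finite supremum of
  -- continuous seminorms is continuous.
  have hc : Continuous (⨆ j, q j : Seminorm ℂ 𝓢(E, ℂ)) := by
    rw [Seminorm.coe_iSup_eq bdd]
    exact Seminorm.continuous_iSup q hq bdd
  obtain ⟨N, C, hC, h⟩ := exists_bound_of_continuous _ hc
  refine ⟨N, C, hC, fun j f => ?_⟩
  have hle : q j f ≤ (⨆ j, q j : Seminorm ℂ 𝓢(E, ℂ)) f := by
    rw [Seminorm.coe_iSup_eq bdd, iSup_apply]
    obtain ⟨C', hC'⟩ := hb f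
    exact le_ciSup (f := fun j => q j f) ⟨C', by rintro _ ⟨j, rfl⟩; exact hC' j⟩ j
  exact hle.trans (h f)

theorem exists_uniform_bound_clm {J : Type*} (A : J → 𝓢(E, ℂ) →L[ℂ] 𝓢(G, ℂ)) (M : ℕ)
    (hb : ∀ f, ∃ C, ∀ j, schwartzNorm M (A j f) ≤ C) :
    ∃ N, ∃ C : ℝ, 0 ≤ C ∧ ∀ j f, schwartzNorm M (A j f) ≤ C * schwartzNorm N f :=
  exists_uniform_bound (fun j => (schwartzNorm M).comp (A j).toLinearMap)
    (fun j => (continuous_schwartzNorm M).comp (A j).continuous) hb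

theorem exists_bound_clm (A : 𝓢(E, ℂ) →L[ℂ] 𝓢(G, ℂ)) (M : ℕ) :
    ∃ N, ∃ C : ℝ, 0 ≤ C ∧ ∀ f, schwartzNorm M (A f) ≤ C * schwartzNorm N f :=
  exists_bound_of_continuous ((schwartzNorm M).comp A.toLinearMap)
    ((continuous_schwartzNorm M).comp A.continuous)

theorem schwartz_hasSum_of_norm {J : Type*} (u : J → 𝓢(E, ℂ))
    (hu : ∀ N, Summable fun j => schwartzNorm N (u j)) :
    ∃ s : 𝓢(E, ℂ), HasSum u s ∧ ∀ x, HasSum (fun j => u j x) (s x) :=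
  schwartz_hasSum u fun k n => Summable.of_nonneg_of_le (fun _ => apply_nonneg _ _)
    (fun j => seminorm_le_schwartzNorm (le_max_left k n) (le_max_right k n) (u j)) (hu (max k n))

/-- Homogeneity. Since `P u` may vanish, `u` is rescaled by `ε / (P u + δ)`, and then `δ` tends to
zero. -/
theorem seminorm_le_of_ball {X : Type*} [AddCommGroup X] [Module ℂ X] (P q : Seminorm ℂ X)
    {ε B : ℝ} (hε : 0 < ε) (h : ∀ u, P u < ε → q u ≤ B) (u : X) :
    q u ≤ B / ε * P u := by
  have hP := apply_nonneg P u
  have key : ∀ δ > 0, q u ≤ B / ε * (P u + δ) := by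
    intro δ hδ
    have ht : 0 < P u + δ := by linarith
    have h1 := h (((ε / (P u + δ) : ℝ) : ℂ) • u) (by
      rw [map_smul_eq_mul, Complex.norm_real, Real.norm_of_nonneg (by positivity),
        div_mul_eq_mul_div, div_lt_iff₀ ht]
      nlinarith)
    rw [map_smul_eq_mul, Complex.norm_real, Real.norm_of_nonneg (by positivity),
      div_mul_eq_mul_div, div_le_iff₀ ht] at h1
    rw [div_mul_eq_mul_div, le_div_iff₀ hε]
    linarith
  have hc : Tendsto (fun δ : ℝ => B / ε * (P u + δ)) (𝓝[>] 0) (𝓝 (B / ε * (P u + 0))) := by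
    refine Tendsto.mono_left ?_ nhdsWithin_le_nhds
    exact Continuous.tendsto (by fun_prop) _
  rw [add_zero] at hc
  exact ge_of_tendsto hc (eventually_mem_nhdsWithin.mono key)

/-- A separately continuous bilinear map on Schwartz spaces is jointly continuous. -/
theorem exists_bound_bilinear (b : 𝓢(E, ℂ) →ₗ[ℂ] 𝓢(G, ℂ) →ₗ[ℂ] 𝓢(H, ℂ))
    (hr : ∀ f, Continuous fun g => b f g) (hl : ∀ g, Continuous fun f => b f g) (M : ℕ) :
    ∃ N, ∃ C : ℝ, 0 ≤ C ∧
      ∀ f g, schwartzNorm M (b f g) ≤ C * (schwartzNorm N f * schwartzNorm N g) := by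
  -- Baire category: continuity in `f` makes these sets closed, continuity in `g` makes them cover
  -- the space. So one of them contains a neighbourhood of some `f₀`, and writing a small `u` as
  -- `(f₀ + u) - f₀` costs the factor 2 below.
  let A : ℕ → Set 𝓢(E, ℂ) := fun N => {f | ∀ g, schwartzNorm M (b f g) ≤ N * schwartzNorm N g}
  have hclosed : ∀ N, IsClosed (A N) := fun N => by
    simp only [A, Set.ofPred_forall]
    exact isClosed_iInter fun g =>
      isClosed_le ((continuous_schwartzNorm M).comp (hl g)) continuous_const
  have hcover : (⋃ N, A N) = Set.univ := by
    refine Set.eq_univ_of_forall fun f => ?_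
    obtain ⟨N, C, hC, h⟩ := exists_bound_clm (⟨b f, hr f⟩ : 𝓢(G, ℂ) →L[ℂ] 𝓢(H, ℂ)) M
    refine Set.mem_iUnion.2 ⟨max N ⌈C⌉₊, fun g => (h g).trans ?_⟩
    refine mul_le_mul ?_ (schwartzNorm_mono (le_max_left _ _) g) (apply_nonneg _ _) (by positivity)
    exact (Nat.le_ceil C).trans (mod_cast le_max_right _ _)
  obtain ⟨N, f₀, hf₀⟩ := nonempty_interior_of_iUnion_of_closed hclosed hcover
  have hf : f₀ ∈ A N := interior_subset hf₀
  rw [mem_interior_iff_mem_nhds, ← map_add_left_nhds_zero, mem_map] at hf₀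
  obtain ⟨⟨s, ε⟩, hε, hball⟩ :=
    ((schwartz_withSeminorms ℂ E ℂ).hasBasis_zero_ball.mem_iff).1 hf₀
  obtain ⟨K, hK⟩ := exists_sup_le_schwartzNorm (E := E) s
  refine ⟨max N K, 2 * N / ε, by positivity, fun f g => ?_⟩
  have h1 : ∀ u : 𝓢(E, ℂ), schwartzNorm K u < ε →
      schwartzNorm M (b u g) ≤ 2 * N * schwartzNorm N g := by
    intro u hu
    have hu' : u ∈ (s.sup (schwartzSeminormFamily ℂ E ℂ)).ball 0 ε := by
      rw [Seminorm.mem_ball_zero]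
      exact (hK u).trans_lt hu
    have h2 : schwartzNorm M (b (f₀ + u) g) ≤ N * schwartzNorm N g := hball hu' g
    have h3 : b u g = b (f₀ + u) g - b f₀ g := by simp
    rw [h3]
    refine (map_sub_le_add _ _ _).trans ?_
    linarith [hf g]
  have h4 := seminorm_le_of_ball (schwartzNorm K) ((schwartzNorm M).comp (b.flip g))
    hε h1 f
  refine h4.trans ?_
  have e1 := schwartzNorm_mono (le_max_right N K) f
  have e2 := schwartzNorm_mono (le_max_left N K) g
  calc _ = 2 * N / ε * (schwartzNorm K f * schwartzNorm N g) := by ring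
    _ ≤ _ := by gcongr

end Bounds

/-! ### Contraction of one variable against a Schwartz function -/

section Contract
variable {E V : Type} [NormedAddCommGroup E] [NormedSpace ℝ E] [MeasurableSpace E] [BorelSpace E]
  [SecondCountableTopology E] [NormedAddCommGroup V] [NormedSpace ℝ V]
  (μ : Measure E) [μ.HasTemperateGrowth]

theorem hasTemperateGrowth_comp_snd (h : 𝓢(E, ℂ)) :
    (fun z : V × E => h z.2).HasTemperateGrowth :=
  h.hasTemperateGrowth.comp (ContinuousLinearMap.snd ℝ V E).hasTemperateGrowth

/-- Contraction with `h` in the second variable, `G ↦ (v ↦ ∫ h(y) G(v, y) dμ(y))`. -/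
noncomputable def contract (h : 𝓢(E, ℂ)) : 𝓢(V × E, ℂ) →L[ℂ] 𝓢(V, ℂ) :=
  (partialIntegral μ).comp (SchwartzMap.smulLeftCLM ℂ fun z : V × E => h z.2)

theorem contract_apply (h : 𝓢(E, ℂ)) (G : 𝓢(V × E, ℂ)) (v : V) :
    contract μ h G v = ∫ y, h y * G (v, y) ∂μ := by
  change partialIntegral μ (SchwartzMap.smulLeftCLM ℂ (fun z : V × E => h z.2) G) v = _
  rw [partialIntegral_apply]
  simp [SchwartzMap.smulLeftCLM_apply_apply (hasTemperateGrowth_comp_snd h)]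

theorem contract_integrable (h : 𝓢(E, ℂ)) (G : 𝓢(V × E, ℂ)) (v : V) :
    Integrable (fun y => h y * G (v, y)) μ := by
  have := slice_integrable μ (SchwartzMap.smulLeftCLM ℂ (fun z : V × E => h z.2) G) v
  simpa [SchwartzMap.smulLeftCLM_apply_apply (hasTemperateGrowth_comp_snd h)] using this

theorem hasFDerivAt_contract {W : Type} [NormedAddCommGroup W] [NormedSpace ℝ W] [NormedSpace ℂ W]
    [SMulCommClass ℝ ℂ W] {C : ℝ} (h : 𝓢(E, ℂ)) (hC : ∀ y, ‖h y‖ ≤ C) (G : 𝓢(V × E, W)) (v : V) :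
    HasFDerivAt (fun v => ∫ y, h y • G (v, y) ∂μ) (∫ y, h y • fderivFst G (v, y) ∂μ) v := by
  have hm : ∀ {W' : Type} [NormedAddCommGroup W'] [NormedSpace ℝ W'] [NormedSpace ℂ W']
      (G : 𝓢(V × E, W')) (v : V), Integrable (fun y => h y • G (v, y)) μ := by
    intro W' _ _ _ G v
    exact (slice_integrable μ G v).bdd_smul C h.continuous.aestronglyMeasurable
      (Filter.Eventually.of_forall hC)
  refine hasFDerivAt_integral_of_dominated_of_fderiv_le (𝕜 := ℝ) (s := Set.univ)
    (F' := fun v y => h y • fderivFst G (v, y))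
    (bound := fun y => C * ((1 + ‖y‖) ^ (-(μ.integrablePower : ℝ)) *
      (2 ^ (0 + μ.integrablePower) * (Finset.Iic (0 + μ.integrablePower, 0)).sup
          (schwartzSeminormFamily ℝ (V × E) (V →L[ℝ] W)) (fderivFst G))))
    Filter.univ_mem (Filter.Eventually.of_forall fun x => (hm G x).1)
    (hm G v) (hm (fderivFst G) v).1
    (Filter.Eventually.of_forall fun y x _ => ?_)
    (((Measure.integrable_pow_neg_integrablePower μ).mul_const _).const_mul _)
    (Filter.Eventually.of_forall fun y x _ => ?_)
  · have := slice_bound μ 0 0 (fderivFst G) x y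
    rw [pow_zero, one_mul, norm_iteratedFDeriv_zero] at this
    rw [norm_smul]
    exact mul_le_mul (hC y) this (norm_nonneg _) ((norm_nonneg _).trans (hC y))
  · exact ((G.hasFDerivAt (x, y)).comp x (hasFDerivAt_prodMk_left x y)).const_smul (h y)

/-- Derivatives in `v` fall on `G` alone, so only the supremum of `h` enters. The values lie in a
general `W` because the induction replaces `G` by its derivative. -/
theorem contract_iteratedFDeriv_le {C : ℝ} (h : 𝓢(E, ℂ)) (hC : ∀ y, ‖h y‖ ≤ C) (n : ℕ) :
    ∀ {W : Type} [NormedAddCommGroup W] [NormedSpace ℝ W] [NormedSpace ℂ W]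
    [SMulCommClass ℝ ℂ W] (G : 𝓢(V × E, W)) (v : V),
      ‖iteratedFDeriv ℝ n (fun v => ∫ y, h y • G (v, y) ∂μ) v‖ ≤
        C * ∫ y, ‖iteratedFDeriv ℝ n G (v, y)‖ ∂μ := by
  induction n with
  | zero =>
    intro W _ _ _ _ G v
    simp only [norm_iteratedFDeriv_zero]
    refine (norm_integral_le_integral_norm _).trans ?_
    rw [← integral_const_mul]
    have hi := (slice_integrable μ G v).norm.const_mul C
    refine integral_mono_of_nonneg (Filter.Eventually.of_forall fun _ => norm_nonneg _) hi
      (Filter.Eventually.of_forall fun y => ?_)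
    simp only [norm_smul]
    exact mul_le_mul_of_nonneg_right (hC y) (norm_nonneg _)
  | succ n ih =>
    intro W _ _ _ _ G v
    have hd : fderiv ℝ (fun v => ∫ y, h y • G (v, y) ∂μ) =
        fun v => ∫ y, h y • fderivFst G (v, y) ∂μ :=
      funext fun v => (hasFDerivAt_contract μ h hC G v).fderiv
    rw [← norm_iteratedFDeriv_fderiv, hd]
    refine (ih (fderivFst G) v).trans ?_
    refine mul_le_mul_of_nonneg_left ?_ ((norm_nonneg _).trans (hC 0))
    exact integral_mono (slice_integrable_iter μ n (fderivFst G) v)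
      (slice_integrable_iter μ (n + 1) G v) fun y => fderivFst_norm G n (v, y)

/-- Contractions are bounded in terms of the supremum of the contracted function only. -/
theorem contract_bound (G : 𝓢(V × E, ℂ)) (N : ℕ) : ∃ B : ℝ, 0 ≤ B ∧
    ∀ (h : 𝓢(E, ℂ)) (C : ℝ), (∀ y, ‖h y‖ ≤ C) → schwartzNorm N (contract μ h G) ≤ C * B := by
  let b : ℕ → ℕ → ℝ := fun k n => (∫ y, (1 + ‖y‖) ^ (-(μ.integrablePower : ℝ)) ∂μ) *
    (2 ^ (k + μ.integrablePower) * (Finset.Iic (k + μ.integrablePower, n)).sup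
      (schwartzSeminormFamily ℝ (V × E) ℂ) G)
  have hb : ∀ k n, 0 ≤ b k n := fun k n => by positivity
  refine ⟨∑ k ∈ Finset.range (N + 1), ∑ n ∈ Finset.range (N + 1), b k n,
    Finset.sum_nonneg fun _ _ => Finset.sum_nonneg fun _ _ => hb _ _, fun h C hC => ?_⟩
  have hC0 : 0 ≤ C := (norm_nonneg _).trans (hC 0)
  refine schwartzNorm_le (mul_nonneg hC0
    (Finset.sum_nonneg fun _ _ => Finset.sum_nonneg fun _ _ => hb _ _)) fun k hk n hn => ?_
  have h1 : b k n ≤ ∑ k ∈ Finset.range (N + 1), ∑ n ∈ Finset.range (N + 1), b k n := by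
    refine (Finset.single_le_sum (f := fun n => b k n) (fun n _ => hb k n)
      (Finset.mem_range_succ_iff.2 hn)).trans ?_
    exact Finset.single_le_sum (f := fun k => ∑ n ∈ Finset.range (N + 1), b k n)
      (fun k _ => Finset.sum_nonneg fun _ _ => hb _ _) (Finset.mem_range_succ_iff.2 hk)
  refine le_trans ?_ (mul_le_mul_of_nonneg_left h1 hC0)
  refine SchwartzMap.seminorm_le_bound ℂ k n _ (mul_nonneg hC0 (hb k n)) fun v => ?_
  have e : ⇑(contract μ h G) = fun v => ∫ y, h y • G (v, y) ∂μ :=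
    funext fun v => contract_apply μ h G v
  rw [e]
  calc _ ≤ ‖v‖ ^ k * (C * ∫ y, ‖iteratedFDeriv ℝ n G (v, y)‖ ∂μ) := by
        gcongr
        exact contract_iteratedFDeriv_le μ h hC n G v
    _ = C * ∫ y, ‖v‖ ^ k * ‖iteratedFDeriv ℝ n G (v, y)‖ ∂μ := by
        rw [integral_const_mul]; ring
    _ ≤ C * b k n := by
        refine mul_le_mul_of_nonneg_left ?_ hC0
        simp only [b]
        rw [← integral_mul_const]
        exact integral_mono ((slice_integrable_iter μ n G v).const_mul _)
          ((Measure.integrable_pow_neg_integrablePower μ).mul_const _)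
          fun y => slice_bound μ k n G v y

end Contract

/-! ### Time-frequency shifts on the line and their growth -/

section Wave
open Filter Topology

theorem iteratedDeriv_cexp_mul (c : ℂ) (n : ℕ) :
    iteratedDeriv n (fun x : ℝ => Complex.exp (c * x)) =
      fun x : ℝ => c ^ n * Complex.exp (c * x) := by
  induction n with
  | zero => simp
  | succ n ih =>
    rw [iteratedDeriv_succ, ih]
    funext x
    have h : HasDerivAt (fun x : ℝ => Complex.exp (c * x)) (Complex.exp (c * x) * (c * 1)) x :=
      ((Complex.ofRealCLM.hasDerivAt (x := x)).const_mul c).cexp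
    rw [(h.const_mul (c ^ n)).deriv]
    ring

theorem norm_cexp_I_mul (s x : ℝ) : ‖Complex.exp (Complex.I * s * x)‖ = 1 := by
  rw [show Complex.I * s * x = ((s * x : ℝ) : ℂ) * Complex.I by push_cast; ring]
  exact Complex.norm_exp_ofReal_mul_I _

theorem hasTemperateGrowth_cexp (s : ℝ) :
    (fun x : ℝ => Complex.exp (Complex.I * s * x)).HasTemperateGrowth := by
  refine ⟨(contDiff_const.mul Complex.ofRealCLM.contDiff).cexp, fun n => ⟨0, |s| ^ n, fun x => ?_⟩⟩
  rw [norm_iteratedFDeriv_eq_norm_iteratedDeriv, iteratedDeriv_cexp_mul, norm_mul,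
    norm_cexp_I_mul]
  simp

/-- The time-frequency shift `x ↦ ψ(x - t) e^{i s x}` of a Schwartz function on the line. -/
noncomputable def gaborAtom (ψ : 𝓢(ℝ, ℂ)) (t s : ℝ) : 𝓢(ℝ, ℂ) :=
  SchwartzMap.smulLeftCLM ℂ (fun x : ℝ => Complex.exp (Complex.I * s * x))
    (SchwartzMap.compSubConstCLM ℂ t ψ)

theorem gaborAtom_apply (ψ : 𝓢(ℝ, ℂ)) (t s x : ℝ) :
    gaborAtom ψ t s x = Complex.exp (Complex.I * s * x) * ψ (x - t) := by
  rw [gaborAtom, SchwartzMap.smulLeftCLM_apply_apply (hasTemperateGrowth_cexp s)]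
  rfl

theorem hasDerivAt_gaborAtom (ψ : 𝓢(ℝ, ℂ)) (t s x : ℝ) :
    HasDerivAt (gaborAtom ψ t s) ((gaborAtom (SchwartzMap.derivCLM ℂ ℂ ψ) t s +
      (Complex.I * s) • gaborAtom ψ t s) x) x := by
  have h1 : HasDerivAt (fun x : ℝ => Complex.exp (Complex.I * s * x))
      (Complex.exp (Complex.I * s * x) * (Complex.I * s * 1)) x :=
    ((Complex.ofRealCLM.hasDerivAt (x := x)).const_mul (Complex.I * s)).cexp
  have h2 : HasDerivAt (fun x : ℝ => ψ (x - t)) (deriv ψ (x - t)) x :=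
    (ψ.hasDerivAt (x - t)).comp_sub_const x t
  have h3 := h1.mul h2
  have e : ⇑(gaborAtom ψ t s) = fun x : ℝ => Complex.exp (Complex.I * s * x) * ψ (x - t) :=
    funext fun x => gaborAtom_apply ψ t s x
  rw [e]
  convert! h3 using 1
  rw [add_apply, smul_apply, gaborAtom_apply, gaborAtom_apply,
    SchwartzMap.derivCLM_apply, smul_eq_mul]
  ring

theorem seminorm_succ_le_deriv (f : 𝓢(ℝ, ℂ)) (k n : ℕ) :
    SchwartzMap.seminorm ℂ k (n + 1) f ≤
      SchwartzMap.seminorm ℂ k n (SchwartzMap.derivCLM ℂ ℂ f) := by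
  refine SchwartzMap.seminorm_le_bound' ℂ k (n + 1) f (apply_nonneg _ _) fun x => ?_
  rw [iteratedDeriv_succ']
  exact SchwartzMap.le_seminorm' ℂ k n (SchwartzMap.derivCLM ℂ ℂ f) x

/-- The derivative of the atom of `ψ` is the atom of `ψ'` plus `i s` times the atom of `ψ`, so each
derivative costs a factor `1 + |s|`; each power of `x` costs `1 + |t|` by translation. The window
changes in the induction, hence the quantifier over `ψ`. -/
theorem gaborAtom_seminorm_le (k n : ℕ) : ∀ ψ : 𝓢(ℝ, ℂ), ∃ C : ℝ, 0 ≤ C ∧ ∀ t s : ℝ,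
    SchwartzMap.seminorm ℂ k n (gaborAtom ψ t s) ≤ C * ((1 + |t|) ^ k * (1 + |s|) ^ n) := by
  induction n with
  | zero =>
    intro ψ
    refine ⟨2 ^ k * (Finset.Iic (k, 0)).sup (schwartzSeminormFamily ℂ ℝ ℂ) ψ, by positivity,
      fun t s => ?_⟩
    refine SchwartzMap.seminorm_le_bound ℂ k 0 _ (by positivity) fun x => ?_
    have h := SchwartzMap.one_add_le_sup_seminorm_apply (𝕜 := ℂ) (m := (k, 0)) le_rfl le_rfl ψ
      (x - t)
    rw [norm_iteratedFDeriv_zero] at h ⊢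
    rw [gaborAtom_apply, norm_mul, norm_cexp_I_mul, one_mul, pow_zero, mul_one]
    have hx : ‖x‖ ≤ (1 + ‖x - t‖) * (1 + |t|) := by
      have h1 : ‖x‖ ≤ ‖x - t‖ + |t| := by simpa using norm_add_le (x - t) t
      nlinarith [norm_nonneg (x - t), abs_nonneg t]
    calc _ ≤ ((1 + ‖x - t‖) * (1 + |t|)) ^ k * ‖ψ (x - t)‖ := by gcongr
      _ = (1 + ‖x - t‖) ^ k * ‖ψ (x - t)‖ * (1 + |t|) ^ k := by rw [mul_pow]; ring
      _ ≤ _ := mul_le_mul_of_nonneg_right h (by positivity)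
  | succ n ih =>
    intro ψ
    obtain ⟨C₁, h0₁, h₁⟩ := ih (SchwartzMap.derivCLM ℂ ℂ ψ)
    obtain ⟨C₂, h0₂, h₂⟩ := ih ψ
    refine ⟨C₁ + C₂, by positivity, fun t s => ?_⟩
    have e : SchwartzMap.derivCLM ℂ ℂ (gaborAtom ψ t s) =
        gaborAtom (SchwartzMap.derivCLM ℂ ℂ ψ) t s + (Complex.I * s) • gaborAtom ψ t s := by
      ext x
      exact (hasDerivAt_gaborAtom ψ t s x).deriv
    refine (seminorm_succ_le_deriv _ k n).trans ?_
    rw [e]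
    refine (map_add_le_add _ _ _).trans ?_
    rw [map_smul_eq_mul, norm_mul, Complex.norm_I, one_mul, Complex.norm_real, Real.norm_eq_abs]
    have ht : 0 ≤ |t| := abs_nonneg t
    have hs : 0 ≤ |s| := abs_nonneg s
    calc _ ≤ C₁ * ((1 + |t|) ^ k * (1 + |s|) ^ n) + |s| * (C₂ * ((1 + |t|) ^ k * (1 + |s|) ^ n)) := by
          gcongr
          · exact h₁ t s
          · exact h₂ t s
      _ ≤ C₁ * ((1 + |t|) ^ k * (1 + |s|) ^ n) * (1 + |s|) +
          (1 + |s|) * (C₂ * ((1 + |t|) ^ k * (1 + |s|) ^ n)) := by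
          refine add_le_add (le_mul_of_one_le_right (by positivity) (by linarith)) ?_
          exact mul_le_mul_of_nonneg_right (by linarith) (by positivity)
      _ = _ := by ring

theorem gaborAtom_norm_le (ψ : 𝓢(ℝ, ℂ)) (N : ℕ) : ∃ C : ℝ, 0 ≤ C ∧ ∀ t s : ℝ,
    schwartzNorm N (gaborAtom ψ t s) ≤ C * ((1 + |t|) * (1 + |s|)) ^ N := by
  choose C hC h using fun k n => gaborAtom_seminorm_le k n ψ
  refine ⟨∑ k ∈ Finset.range (N + 1), ∑ n ∈ Finset.range (N + 1), C k n,
    Finset.sum_nonneg fun _ _ => Finset.sum_nonneg fun _ _ => hC _ _, fun t s => ?_⟩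
  have ht : 0 ≤ |t| := abs_nonneg t
  have hs : 0 ≤ |s| := abs_nonneg s
  have h0 : 0 ≤ ∑ k ∈ Finset.range (N + 1), ∑ n ∈ Finset.range (N + 1), C k n :=
    Finset.sum_nonneg fun _ _ => Finset.sum_nonneg fun _ _ => hC _ _
  refine schwartzNorm_le (by positivity) fun k hk n hn => ?_
  have h1 : C k n ≤ ∑ k ∈ Finset.range (N + 1), ∑ n ∈ Finset.range (N + 1), C k n := by
    refine (Finset.single_le_sum (f := fun n => C k n) (fun n _ => hC k n)
      (Finset.mem_range_succ_iff.2 hn)).trans ?_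
    exact Finset.single_le_sum (f := fun k => ∑ n ∈ Finset.range (N + 1), C k n)
      (fun k _ => Finset.sum_nonneg fun _ _ => hC _ _) (Finset.mem_range_succ_iff.2 hk)
  refine (h k n t s).trans ?_
  rw [mul_pow]
  gcongr <;> linarith

end Wave

/-! ### Rapid decay of Gabor coefficients -/

section WaveDecay
variable {V : Type} [NormedAddCommGroup V] [NormedSpace ℝ V]

/-- Integration by parts in the last variable trades a factor `s` for a derivative of the window or
of `F`. -/
theorem integral_slice_by_parts (ψ : 𝓢(ℝ, ℂ)) (F : 𝓢(V × ℝ, ℂ)) (t s : ℝ) :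
    (Complex.I * s) • contract volume (gaborAtom ψ t s) F =
      -contract volume (gaborAtom (SchwartzMap.derivCLM ℂ ℂ ψ) t s) F -
        contract volume (gaborAtom ψ t s)
          (LineDeriv.lineDerivOpCLM ℂ 𝓢(V × ℝ, ℂ) ((0 : V), (1 : ℝ)) F) := by
  ext v
  rw [smul_apply, sub_apply, neg_apply,
    contract_apply, contract_apply, contract_apply]
  set F' := LineDeriv.lineDerivOpCLM ℂ 𝓢(V × ℝ, ℂ) ((0 : V), (1 : ℝ)) F with hF'
  have i1 := contract_integrable volume (gaborAtom (SchwartzMap.derivCLM ℂ ℂ ψ) t s) F v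
  have i2 := contract_integrable volume (gaborAtom ψ t s) F v
  have i3 := contract_integrable volume (gaborAtom ψ t s) F' v
  have hd : ∀ y, HasDerivAt (fun y => gaborAtom ψ t s y * F (v, y))
      ((gaborAtom (SchwartzMap.derivCLM ℂ ℂ ψ) t s y * F (v, y) +
        (Complex.I * s) * (gaborAtom ψ t s y * F (v, y))) +
        gaborAtom ψ t s y * F' (v, y)) y := by
    intro y
    have h1 := hasDerivAt_gaborAtom ψ t s y
    have h2 : HasDerivAt (fun y => F (v, y)) (F' (v, y)) y := by
      have h3 : HasDerivAt (fun y : ℝ => (v, y)) ((0 : V), (1 : ℝ)) y :=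
        (hasDerivAt_const y v).prodMk (hasDerivAt_id y)
      exact (F.hasFDerivAt (v, y)).comp_hasDerivAt y h3
    convert! h1.mul h2 using 1
    rw [add_apply, smul_apply, smul_eq_mul]
    ring
  have i12 : Integrable (fun y => gaborAtom (SchwartzMap.derivCLM ℂ ℂ ψ) t s y * F (v, y) +
      (Complex.I * s) * (gaborAtom ψ t s y * F (v, y))) := i1.add (i2.const_mul _)
  have h := integral_eq_zero_of_hasDerivAt_of_integrable hd (i12.add i3) i2
  rw [integral_add i12 i3, integral_add i1 (i2.const_mul _),
    integral_const_mul] at h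
  rw [smul_eq_mul]
  linear_combination h

theorem hasTemperateGrowth_snd_coord :
    (fun z : V × ℝ => (z.2 : ℂ)).HasTemperateGrowth :=
  Function.HasTemperateGrowth.comp Function.Complex.hasTemperateGrowth_ofReal
    (ContinuousLinearMap.snd ℝ V ℝ).hasTemperateGrowth

/-- Writing `t = y - (y - t)` trades a factor `t` for a multiplication of `F` or of the window by
the coordinate. -/
theorem gaborAtom_translate (ψ : 𝓢(ℝ, ℂ)) (F : 𝓢(V × ℝ, ℂ)) (t s : ℝ) :
    (t : ℂ) • contract volume (gaborAtom ψ t s) F =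
      contract volume (gaborAtom ψ t s)
          (SchwartzMap.smulLeftCLM ℂ (fun z : V × ℝ => (z.2 : ℂ)) F) -
        contract volume
          (gaborAtom (SchwartzMap.smulLeftCLM ℂ (fun x : ℝ => (x : ℂ)) ψ) t s) F := by
  ext v
  rw [smul_apply, sub_apply, contract_apply, contract_apply,
    contract_apply, ← integral_sub (contract_integrable _ _ _ _) (contract_integrable _ _ _ _),
    smul_eq_mul, ← integral_const_mul]
  congr 1
  funext y
  have h : (fun x : ℝ => (x : ℂ)).HasTemperateGrowth := Function.Complex.hasTemperateGrowth_ofReal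
  rw [gaborAtom_apply, gaborAtom_apply, SchwartzMap.smulLeftCLM_apply_apply h,
    SchwartzMap.smulLeftCLM_apply_apply hasTemperateGrowth_snd_coord, smul_eq_mul, smul_eq_mul]
  push_cast
  ring

/-- The two preceding identities are iterated, each use gaining one power of `1 + |s|` or `1 + |t|`.
They change both the window and `F`, so both are quantified inside the induction. Without weights,
the supremum of the atom does not depend on `t` and `s`, and `contract_bound` applies. -/
theorem gaborAtom_decay (N K M : ℕ) : ∀ (ψ : 𝓢(ℝ, ℂ)) (F : 𝓢(V × ℝ, ℂ)), ∃ C : ℝ, ∀ t s : ℝ,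
    (1 + |t|) ^ K * (1 + |s|) ^ M * schwartzNorm N (contract volume (gaborAtom ψ t s) F) ≤ C := by
  induction K with
  | zero =>
    induction M with
    | zero =>
      intro ψ F
      obtain ⟨B, hB, h⟩ := contract_bound volume F N
      refine ⟨schwartzNorm 0 ψ * B, fun t s => ?_⟩
      rw [pow_zero, pow_zero, one_mul, one_mul]
      refine h _ _ fun y => ?_
      rw [gaborAtom_apply, norm_mul, norm_cexp_I_mul, one_mul]
      exact norm_le_schwartzNorm 0 ψ _
    | succ M ih =>
      intro ψ F
      obtain ⟨C₀, h₀⟩ := ih ψ F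
      obtain ⟨C₁, h₁⟩ := ih (SchwartzMap.derivCLM ℂ ℂ ψ) F
      obtain ⟨C₂, h₂⟩ := ih ψ (LineDeriv.lineDerivOpCLM ℂ 𝓢(V × ℝ, ℂ) ((0 : V), (1 : ℝ)) F)
      refine ⟨C₀ + (C₁ + C₂), fun t s => ?_⟩
      have e := congrArg (schwartzNorm N) (integral_slice_by_parts ψ F t s)
      rw [map_smul_eq_mul, norm_mul, Complex.norm_I, one_mul, Complex.norm_real,
        Real.norm_eq_abs] at e
      have e' := e.le.trans (map_sub_le_add _ _ _)
      rw [map_neg_eq_map] at e'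
      have hs : 0 ≤ |s| := abs_nonneg s
      have := mul_le_mul_of_nonneg_left e' (by positivity : (0 : ℝ) ≤ (1 + |t|) ^ 0 * (1 + |s|) ^ M)
      rw [pow_succ]
      linarith [h₀ t s, h₁ t s, h₂ t s]
  | succ K ih =>
    intro ψ F
    obtain ⟨C₀, h₀⟩ := ih ψ F
    obtain ⟨C₁, h₁⟩ := ih ψ (SchwartzMap.smulLeftCLM ℂ (fun z : V × ℝ => (z.2 : ℂ)) F)
    obtain ⟨C₂, h₂⟩ := ih (SchwartzMap.smulLeftCLM ℂ (fun x : ℝ => (x : ℂ)) ψ) F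
    refine ⟨C₀ + (C₁ + C₂), fun t s => ?_⟩
    have e := congrArg (schwartzNorm N) (gaborAtom_translate ψ F t s)
    rw [map_smul_eq_mul, Complex.norm_real, Real.norm_eq_abs] at e
    have e' := e.le.trans (map_sub_le_add _ _ _)
    have hs : 0 ≤ |s| := abs_nonneg s
    have := mul_le_mul_of_nonneg_left e' (by positivity : (0 : ℝ) ≤ (1 + |t|) ^ K * (1 + |s|) ^ M)
    rw [pow_succ]
    linarith [h₀ t s, h₁ t s, h₂ t s]

end WaveDecay

/-! ### Gabor systems: reproducing expansions with rapidly decreasing coefficients -/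

section GaborDef
variable {E V : Type} [NormedAddCommGroup E] [NormedSpace ℝ E] [MeasurableSpace E] [BorelSpace E]
  [SecondCountableTopology E] [NormedAddCommGroup V] [NormedSpace ℝ V]

/-- The norms of the functions `u j` grow at most polynomially in the weight `w j`. -/
def PolyGrowth {J : Type} (w : J → ℝ) (u : J → 𝓢(E, ℂ)) : Prop :=
  ∀ N, ∃ (a : ℕ) (C : ℝ), 0 ≤ C ∧ ∀ j, schwartzNorm N (u j) ≤ C * w j ^ a

/-- Contractions with the functions `u j` decay rapidly in the weight `w j`. -/
def RapidDecay (μ : Measure E) [μ.HasTemperateGrowth] {J : Type} (w : J → ℝ)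
    (u : J → 𝓢(E, ℂ)) : Prop :=
  ∀ {V : Type} [NormedAddCommGroup V] [NormedSpace ℝ V] (F : 𝓢(V × E, ℂ)) (M N : ℕ),
    ∃ C : ℝ, ∀ j, w j ^ M * schwartzNorm N (contract μ (u j) F) ≤ C

/-- A countable reproducing system for the Schwartz space: `g = ∑ ⟨c j, g⟩ e j`, with
rapidly decreasing coefficients and polynomially bounded `e j`, `c j`. -/
structure GaborSystem (μ : Measure E) [μ.HasTemperateGrowth] where
  J : Type
  countable : Countable J
  w : J → ℝ
  one_le : ∀ j, 1 ≤ w j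
  r : ℕ
  summable : Summable fun j => (w j ^ r)⁻¹
  e : J → 𝓢(E, ℂ)
  c : J → 𝓢(E, ℂ)
  e_growth : PolyGrowth w e
  c_growth : PolyGrowth w c
  e_decay : RapidDecay μ w e
  c_decay : RapidDecay μ w c
  hasSum : ∀ (g : 𝓢(E, ℂ)) (x : E), HasSum (fun j => (∫ y, c j y * g y ∂μ) * e j x) (g x)

theorem contract_tensor (μ : Measure E) [μ.HasTemperateGrowth] (h g : 𝓢(E, ℂ)) (a : 𝓢(V, ℂ)) :
    contract μ h (tensor a g) = (∫ y, h y * g y ∂μ) • a := by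
  ext v
  rw [contract_apply, smul_apply, smul_eq_mul, ← integral_mul_const]
  congr 1
  funext y
  rw [tensor_apply]
  ring

theorem schwartzNorm_pos {f : 𝓢(E, ℂ)} (hf : f ≠ 0) (N : ℕ) : 0 < schwartzNorm N f := by
  refine (apply_nonneg _ _).lt_of_ne fun h => hf ?_
  ext x
  have := norm_le_schwartzNorm N f x
  rw [← h] at this
  simpa using this

/-- The contraction of `g ⊗ g` is the scalar coefficient times `g`; dividing by a norm of `g` leaves
the coefficient. -/
theorem RapidDecay.scalar {μ : Measure E} [μ.HasTemperateGrowth] {J : Type} {w : J → ℝ}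
    {u : J → 𝓢(E, ℂ)} (hu : RapidDecay μ w u) (g : 𝓢(E, ℂ)) (M : ℕ) :
    ∃ C : ℝ, ∀ j, w j ^ M * ‖∫ y, u j y * g y ∂μ‖ ≤ C := by
  rcases eq_or_ne g 0 with rfl | hg
  · exact ⟨0, fun j => by simp⟩
  · obtain ⟨C, hC⟩ := hu (tensor g g) M 0
    refine ⟨C / schwartzNorm 0 g, fun j => ?_⟩
    rw [le_div_iff₀ (schwartzNorm_pos hg 0)]
    have := hC j
    rw [contract_tensor, map_smul_eq_mul] at this
    linarith

/-- A polynomially bounded family paired with rapidly decreasing weights is summable. -/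
theorem summable_of_growth_decay {J : Type} {w : J → ℝ} (hw : ∀ j, 1 ≤ w j) {r : ℕ}
    (hr : Summable fun j => (w j ^ r)⁻¹) {p q : J → ℝ} (hp0 : ∀ j, 0 ≤ p j) (hq0 : ∀ j, 0 ≤ q j)
    (hp : ∃ (a : ℕ) (C : ℝ), 0 ≤ C ∧ ∀ j, p j ≤ C * w j ^ a)
    (hq : ∀ M : ℕ, ∃ C : ℝ, ∀ j, w j ^ M * q j ≤ C) : Summable fun j => q j * p j := by
  obtain ⟨a, C, hC, h⟩ := hp
  obtain ⟨D, hD⟩ := hq (a + r)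
  refine Summable.of_nonneg_of_le (fun j => mul_nonneg (hq0 j) (hp0 j)) (fun j => ?_)
    (hr.mul_left (D * C))
  have hj : 0 < w j := one_pos.trans_le (hw j)
  rw [← div_eq_mul_inv, le_div_iff₀ (by positivity)]
  calc _ ≤ q j * (C * w j ^ a) * w j ^ r := by
        have := h j
        have := hq0 j
        gcongr
    _ = (w j ^ (a + r) * q j) * C := by ring
    _ ≤ _ := mul_le_mul_of_nonneg_right (hD j) hC

end GaborDef

/-! ### A Gabor system on the real line, by Poisson summation -/

section Line

/-- With a smooth step `s`, the difference `s(x) - s(x - 1/2)` telescopes to a partition of unity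
under half-integer shifts. It vanishes outside an interval of length `5/8 < 1`, which leaves room
for a bump `ψ` that is 1 there and misses all its nonzero integer translates. -/
theorem exists_partition : ∃ ψ χ : 𝓢(ℝ, ℂ), (∀ u, ψ u * χ u = χ u) ∧
    (∀ u : ℝ, ∀ n : ℤ, n ≠ 0 → ψ u * χ (u + n) = 0) ∧
    ∀ x : ℝ, HasSum (fun k : ℤ => χ (x - k / 2)) 1 := by
  let s : ℝ → ℝ := fun x => Real.smoothTransition (8 * x + 1)
  have s0 : ∀ x, x ≤ -1 / 8 → s x = 0 := fun x hx =>
    Real.smoothTransition.zero_of_nonpos (by linarith)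
  have s1 : ∀ x, 0 ≤ x → s x = 1 := fun x hx =>
    Real.smoothTransition.one_of_one_le (by linarith)
  have hs : ContDiff ℝ ∞ s := Real.smoothTransition.contDiff.comp (by fun_prop)
  let f : ℝ → ℂ := fun x => ((s x - s (x - 1 / 2) : ℝ) : ℂ)
  have hf : ContDiff ℝ ∞ f :=
    Complex.ofRealCLM.contDiff.comp (hs.sub (hs.comp (contDiff_id.sub contDiff_const)))
  have hf0 : ∀ x, (x ≤ -1 / 8 ∨ 1 / 2 ≤ x) → f x = 0 := by
    rintro x (h | h)
    · simp only [f]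
      rw [s0 x h, s0 (x - 1 / 2) (by linarith)]
      simp
    · simp only [f]
      rw [s1 x (by linarith), s1 (x - 1 / 2) (by linarith)]
      simp
  have hfc : HasCompactSupport f := HasCompactSupport.intro (isCompact_Icc (a := -1 / 8) (b := 1 / 2))
    fun x hx => hf0 x (by
      by_contra! h
      exact hx ⟨h.1.le, h.2.le⟩)
  -- The inner ball is `[-1/8, 1/2]`, which carries `f`. The outer one is `(-1/2, 7/8)`, the exact
  -- gap between the translates of that interval by -1 and by 1.
  let b : ContDiffBump (3 / 16 : ℝ) := ⟨5 / 16, 11 / 16, by norm_num, by norm_num⟩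
  let g : ℝ → ℂ := fun x => ((b x : ℝ) : ℂ)
  have hg : ContDiff ℝ ∞ g := Complex.ofRealCLM.contDiff.comp b.contDiff
  have hgc : HasCompactSupport g := b.hasCompactSupport.comp_left Complex.ofReal_zero
  have hg0 : ∀ x, (x ≤ -1 / 2 ∨ 7 / 8 ≤ x) → g x = 0 := by
    intro x h
    simp only [g]
    rw [b.zero_of_le_dist, Complex.ofReal_zero]
    rw [Real.dist_eq]
    change 11 / 16 ≤ _
    rcases h with h | h
    · rw [abs_of_neg (by linarith)]; linarith
    · rw [abs_of_pos (by linarith)]; linarith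
  have hg1 : ∀ x, -1 / 8 ≤ x → x ≤ 1 / 2 → g x = 1 := by
    intro x h1 h2
    simp only [g]
    rw [b.one_of_mem_closedBall, Complex.ofReal_one]
    rw [Metric.mem_closedBall, Real.dist_eq]
    change _ ≤ 5 / 16
    rw [abs_le]
    constructor <;> linarith
  refine ⟨hgc.toSchwartzMap hg, hfc.toSchwartzMap hf, fun u => ?_, fun u n hn => ?_, fun x => ?_⟩
  · change g u * f u = f u
    by_cases h : u ≤ -1 / 8 ∨ 1 / 2 ≤ u
    · rw [hf0 u h, mul_zero]
    · push Not at h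
      rw [hg1 u h.1.le h.2.le, one_mul]
  · change g u * f (u + n) = 0
    by_cases h : u ≤ -1 / 2 ∨ 7 / 8 ≤ u
    · rw [hg0 u h, zero_mul]
    · push Not at h
      rw [hf0, mul_zero]
      rcases lt_or_gt_of_ne hn with h' | h'
      · left
        have : (n : ℝ) ≤ -1 := by exact_mod_cast Int.le_sub_one_of_lt h'
        linarith
      · right
        have : (1 : ℝ) ≤ n := by exact_mod_cast h'
        linarith
  · change HasSum (fun k : ℤ => f (x - k / 2)) 1
    -- Only the indices `k₀` and `k₀ + 1` contribute; the two inner steps cancel, the first outer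
    -- step equals 1 and the last equals 0.
    set k₀ : ℤ := ⌊2 * x⌋ with hk
    have h1 : (k₀ : ℝ) ≤ 2 * x := Int.floor_le _
    have h2 : 2 * x < k₀ + 1 := Int.lt_floor_add_one _
    have hz : ∀ k ∉ ({k₀, k₀ + 1} : Finset ℤ), f (x - k / 2) = 0 := by
      intro k hk'
      simp only [Finset.mem_insert, Finset.mem_singleton, not_or] at hk'
      apply hf0
      rcases lt_or_gt_of_ne hk'.1 with h' | h'
      · right
        have : (k : ℝ) ≤ k₀ - 1 := by exact_mod_cast Int.le_sub_one_of_lt h'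
        linarith
      · left
        have h3 : k₀ + 2 ≤ k := by omega
        have : (k₀ : ℝ) + 2 ≤ k := by exact_mod_cast h3
        linarith
    have : HasSum (fun k : ℤ => f (x - k / 2)) _ := hasSum_sum_of_ne_finset_zero hz
    rw [Finset.sum_pair (by omega)] at this
    convert! this using 1
    simp only [f]
    push_cast
    rw [s1 (x - k₀ / 2) (by linarith), s0 (x - (k₀ + 1) / 2 - 1 / 2) (by linarith)]
    have : x - k₀ / 2 - 1 / 2 = x - (k₀ + 1) / 2 := by ring
    rw [this]
    push_cast
    ring

theorem summable_int_weight {a : ℝ} (ha : 0 < a) :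
    Summable fun k : ℤ => ((1 + |k * a|) ^ 2)⁻¹ := by
  have h := (Real.summable_one_div_int_pow.2 one_lt_two).mul_left ((a ^ 2)⁻¹)
  refine Summable.of_norm_bounded_eventually h ?_
  have : {(0 : ℤ)}ᶜ ∈ Filter.cofinite := (Set.finite_singleton 0).compl_mem_cofinite
  filter_upwards [this] with k hk
  have hk' : (k : ℝ) ≠ 0 := by exact_mod_cast hk
  rw [Real.norm_of_nonneg (by positivity), one_div, ← mul_inv]
  have hpos : 0 < a ^ 2 * (k : ℝ) ^ 2 := by positivity
  refine inv_anti₀ hpos ?_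
  have h1 : a ^ 2 * (k : ℝ) ^ 2 = |k * a| ^ 2 := by rw [sq_abs]; ring
  rw [h1]
  exact pow_le_pow_left₀ (abs_nonneg _) (by linarith) 2

/-- The coefficients are the values at the integers of the Fourier transform of `f = χ(· - t) g`.
Poisson summation turns the series into `∑ f(x + n) ψ(x - t)`, where `ψ` removes every `n ≠ 0` and
is absorbed by `χ` for `n = 0`. -/
theorem poisson_localized (ψ χ g : 𝓢(ℝ, ℂ)) (h1 : ∀ u, ψ u * χ u = χ u)
    (h2 : ∀ u : ℝ, ∀ n : ℤ, n ≠ 0 → ψ u * χ (u + n) = 0) (t x : ℝ) :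
    ∑' m : ℤ, (∫ y, gaborAtom χ t (m * -(2 * Real.pi)) y * g y) *
      gaborAtom ψ t (m * (2 * Real.pi)) x = χ (x - t) * g x := by
  let f : 𝓢(ℝ, ℂ) := SchwartzMap.smulLeftCLM ℂ (SchwartzMap.compSubConstCLM ℂ t χ) g
  have hf : ∀ y, f y = χ (y - t) * g y := fun y => by
    simp only [f]
    rw [SchwartzMap.smulLeftCLM_apply_apply (SchwartzMap.hasTemperateGrowth _)]
    rfl
  have hF : ∀ m : ℤ, (∫ y, gaborAtom χ t (m * -(2 * Real.pi)) y * g y) =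
      FourierTransform.fourier f m := by
    intro m
    rw [SchwartzMap.fourier_coe, Real.fourier_real_eq_integral_exp_smul]
    congr 1
    funext y
    rw [gaborAtom_apply, hf, smul_eq_mul, mul_assoc]
    congr 2
    push_cast
    ring
  have hE : ∀ m : ℤ, gaborAtom ψ t (m * (2 * Real.pi)) x =
      fourier m (x : UnitAddCircle) * ψ (x - t) := by
    intro m
    rw [gaborAtom_apply, fourier_coe_apply]
    congr 2
    push_cast
    ring
  calc _ = ∑' m : ℤ, FourierTransform.fourier f m * fourier m (x : UnitAddCircle) * ψ (x - t) := by
        congr 1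
        funext m
        rw [hF, hE]
        ring
    _ = (∑' n : ℤ, f (x + n)) * ψ (x - t) := by
        rw [tsum_mul_right, SchwartzMap.tsum_eq_tsum_fourier]
    _ = ∑' n : ℤ, f (x + n) * ψ (x - t) := tsum_mul_right.symm
    _ = f (x + (0 : ℤ)) * ψ (x - t) := tsum_eq_single 0 fun n hn => by
        rw [hf, show x + n - t = x - t + n by ring]
        linear_combination g (x + n) * h2 (x - t) n hn
    _ = _ := by
        rw [Int.cast_zero, add_zero, hf]
        linear_combination g x * h1 (x - t)

/-- The Gabor system on the line. -/
theorem nonempty_gaborSystem_real : Nonempty (GaborSystem (volume : Measure ℝ)) := by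
  obtain ⟨ψ, χ, h1, h2, h3⟩ := exists_partition
  let w : ℤ × ℤ → ℝ := fun j => (1 + |j.1 * (1 / 2 : ℝ)|) * (1 + |j.2 * (2 * Real.pi)|)
  have hw : ∀ j, 1 ≤ w j := fun j => by
    simp only [w]
    exact one_le_mul_of_one_le_of_one_le (by linarith [abs_nonneg (j.1 * (1 / 2 : ℝ))])
      (by linarith [abs_nonneg (j.2 * (2 * Real.pi))])
  have hr : Summable fun j => (w j ^ 2)⁻¹ := by
    have := (summable_int_weight (a := 1 / 2) (by norm_num)).mul_of_nonneg
      (summable_int_weight (a := 2 * Real.pi) (by positivity))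
      (fun _ => by positivity) (fun _ => by positivity)
    simpa only [w, mul_pow, mul_inv] using this
  have hneg : ∀ m : ℤ, |(m : ℝ) * -(2 * Real.pi)| = |m * (2 * Real.pi)| := fun m => by
    rw [mul_neg, abs_neg]
  -- Time step `1/2` fits the partition of unity, frequency step `2π` fits Poisson summation. The
  -- analysing functions `c` carry the opposite frequency because the pairing is bilinear.
  let e : ℤ × ℤ → 𝓢(ℝ, ℂ) := fun j => gaborAtom ψ (j.1 * (1 / 2 : ℝ)) (j.2 * (2 * Real.pi))
  let c : ℤ × ℤ → 𝓢(ℝ, ℂ) := fun j => gaborAtom χ (j.1 * (1 / 2 : ℝ)) (j.2 * -(2 * Real.pi))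
  have eg : PolyGrowth w e := fun N => by
    obtain ⟨C, hC, h⟩ := gaborAtom_norm_le ψ N
    exact ⟨N, C, hC, fun j => h _ _⟩
  have cg : PolyGrowth w c := fun N => by
    obtain ⟨C, hC, h⟩ := gaborAtom_norm_le χ N
    refine ⟨N, C, hC, fun j => ?_⟩
    have := h (j.1 * (1 / 2 : ℝ)) (j.2 * -(2 * Real.pi))
    rwa [hneg] at this
  have ed : RapidDecay volume w e := fun F M N => by
    obtain ⟨C, h⟩ := gaborAtom_decay N M M ψ F
    exact ⟨C, fun j => by rw [mul_pow]; exact h _ _⟩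
  have cd : RapidDecay volume w c := fun F M N => by
    obtain ⟨C, h⟩ := gaborAtom_decay N M M χ F
    refine ⟨C, fun j => ?_⟩
    have := h (j.1 * (1 / 2 : ℝ)) (j.2 * -(2 * Real.pi))
    rw [hneg] at this
    rw [mul_pow]
    exact this
  refine ⟨⟨ℤ × ℤ, inferInstance, w, hw, 2, hr, e, c, eg, cg, ed, cd, fun g x => ?_⟩⟩
  have hs : Summable fun j => (∫ y, c j y * g y) * e j x := by
    refine Summable.of_norm_bounded (summable_of_growth_decay hw hr
      (p := fun j => schwartzNorm 0 (e j)) (q := fun j => ‖∫ y, c j y * g y‖)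
      (fun _ => apply_nonneg _ _) (fun _ => norm_nonneg _) (eg 0) (cd.scalar g)) fun j => ?_
    rw [norm_mul]
    exact mul_le_mul_of_nonneg_left (norm_le_schwartzNorm 0 _ _) (norm_nonneg _)
  have ht : ∑' j, (∫ y, c j y * g y) * e j x = g x := by
    rw [hs.tsum_prod]
    have : ∀ k : ℤ, ∑' m : ℤ, (∫ y, c (k, m) y * g y) * e (k, m) x = χ (x - k / 2) * g x := by
      intro k
      rw [div_eq_mul_one_div]
      exact poisson_localized ψ χ g h1 h2 (k * (1 / 2 : ℝ)) x
    simp_rw [this]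
    rw [tsum_mul_right, (h3 x).tsum_eq, one_mul]
  exact ht ▸ hs.hasSum

end Line

/-! ### Restriction to slices and norms of elementary tensors -/

section Slice
variable {E V : Type} [NormedAddCommGroup E] [NormedSpace ℝ E]
  [NormedAddCommGroup V] [NormedSpace ℝ V]

/-- The restriction `G ↦ G(v, ·)`. -/
noncomputable def slice (v : V) : 𝓢(V × E, ℂ) →L[ℂ] 𝓢(E, ℂ) :=
  SchwartzMap.compCLMOfAntilipschitz (g := fun y : E => (v, y)) (K := 1) ℂ
    (by
      have h := (Function.HasTemperateGrowth.const (E := E) (v, (0 : E))).add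
        (ContinuousLinearMap.inr ℝ V E).hasTemperateGrowth
      convert! h using 1
      funext y
      simp)
    (fun y y' => by
      rw [Prod.edist_eq, edist_self]
      simp)

theorem slice_apply (v : V) (G : 𝓢(V × E, ℂ)) (y : E) : slice v G y = G (v, y) := rfl

theorem exists_tensor_norm_le (N : ℕ) : ∃ C : ℝ, 0 ≤ C ∧ ∀ (f : 𝓢(V, ℂ)) (g : 𝓢(E, ℂ)),
    schwartzNorm N (tensor f g) ≤ C * (schwartzNorm N f * schwartzNorm N g) := by
  -- The binomial coefficients of the Leibniz rule sum to at most `2 ^ N`; the factor 2 comes from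
  -- splitting the weight between the two variables.
  refine ⟨2 ^ N * 2, by positivity, fun f g => ?_⟩
  have hf := apply_nonneg (schwartzNorm N) f
  have hg := apply_nonneg (schwartzNorm N) g
  refine schwartzNorm_le (by positivity) fun k hk n hn => ?_
  have hS : ∑ i ∈ Finset.range (n + 1), (n.choose i : ℝ) *
        (SchwartzMap.seminorm ℂ k i f * SchwartzMap.seminorm ℂ 0 (n - i) g +
          SchwartzMap.seminorm ℂ 0 i f * SchwartzMap.seminorm ℂ k (n - i) g) ≤
      2 ^ N * 2 * (schwartzNorm N f * schwartzNorm N g) := by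
    calc _ ≤ ∑ i ∈ Finset.range (n + 1), (n.choose i : ℝ) *
          (schwartzNorm N f * schwartzNorm N g + schwartzNorm N f * schwartzNorm N g) := by
          refine Finset.sum_le_sum fun i hi => ?_
          have hi' : i ≤ N := (Finset.mem_range_succ_iff.1 hi).trans hn
          have hi'' : n - i ≤ N := (Nat.sub_le _ _).trans hn
          have a1 := seminorm_le_schwartzNorm hk hi' f
          have a2 := seminorm_le_schwartzNorm (Nat.zero_le N) hi' f
          have b1 := seminorm_le_schwartzNorm hk hi'' g
          have b2 := seminorm_le_schwartzNorm (Nat.zero_le N) hi'' g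
          gcongr
      _ = 2 ^ n * 2 * (schwartzNorm N f * schwartzNorm N g) := by
          rw [← Finset.sum_mul, ← Nat.cast_sum, Nat.sum_range_choose]
          push_cast
          ring
      _ ≤ _ := by
          gcongr
          norm_num
  exact SchwartzMap.seminorm_le_bound ℂ k n _ (by positivity) fun x =>
    (tensor_bound f g k n x).trans hS

end Slice

theorem contract_smul_left {E V : Type} [NormedAddCommGroup E] [NormedSpace ℝ E]
    [MeasurableSpace E] [BorelSpace E] [SecondCountableTopology E] [NormedAddCommGroup V]
    [NormedSpace ℝ V] (μ : Measure E) [μ.HasTemperateGrowth] (a : ℂ) (u : 𝓢(E, ℂ))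
    (F : 𝓢(V × E, ℂ)) : contract μ (a • u) F = a • contract μ u F := by
  ext v
  rw [smul_apply, contract_apply, contract_apply, smul_eq_mul, ← integral_const_mul]
  congr 1
  funext y
  rw [smul_apply, smul_eq_mul, mul_assoc]

/-! ### Products of Gabor systems -/

section Product
variable {E₁ E₂ V : Type} [NormedAddCommGroup E₁] [NormedSpace ℝ E₁] [MeasurableSpace E₁]
  [BorelSpace E₁] [SecondCountableTopology E₁]
  [NormedAddCommGroup E₂] [NormedSpace ℝ E₂] [MeasurableSpace E₂]
  [BorelSpace E₂] [SecondCountableTopology E₂] [NormedAddCommGroup V] [NormedSpace ℝ V]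
  (μ₁ : Measure E₁) [μ₁.HasTemperateGrowth] (μ₂ : Measure E₂) [μ₂.HasTemperateGrowth]
  [SFinite μ₁] [SFinite μ₂] [(μ₁.prod μ₂).HasTemperateGrowth]

/-- Reassociation of the variables. -/
noncomputable def assocPull : 𝓢(V × (E₁ × E₂), ℂ) →L[ℂ] 𝓢((V × E₁) × E₂, ℂ) :=
  SchwartzMap.compCLMOfContinuousLinearEquiv ℂ (ContinuousLinearEquiv.prodAssoc ℝ V E₁ E₂)

theorem integral_tensor_mul (u₁ : 𝓢(E₁, ℂ)) (u₂ : 𝓢(E₂, ℂ)) (G : 𝓢(E₁ × E₂, ℂ)) :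
    ∫ z, tensor u₁ u₂ z * G z ∂(μ₁.prod μ₂) = ∫ x, u₁ x * contract μ₂ u₂ G x ∂μ₁ := by
  have hi : Integrable (fun z => tensor u₁ u₂ z * G z) (μ₁.prod μ₂) := by
    have := (SchwartzMap.smulLeftCLM ℂ (tensor u₁ u₂) G).integrable (μ := μ₁.prod μ₂)
    simpa [SchwartzMap.smulLeftCLM_apply (tensor u₁ u₂).hasTemperateGrowth] using this
  rw [integral_prod _ hi]
  congr 1
  funext x
  rw [contract_apply, ← integral_const_mul]
  congr 1
  funext y
  rw [tensor_apply]
  ring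

theorem contract_prod (u₁ : 𝓢(E₁, ℂ)) (u₂ : 𝓢(E₂, ℂ)) (F : 𝓢(V × (E₁ × E₂), ℂ)) :
    contract (μ₁.prod μ₂) (tensor u₁ u₂) F = contract μ₁ u₁ (contract μ₂ u₂ (assocPull F)) := by
  ext v
  rw [contract_apply, contract_apply]
  refine (integral_tensor_mul μ₁ μ₂ u₁ u₂ (slice v F)).trans ?_
  congr 1
  funext x
  rw [contract_apply, contract_apply]
  rfl

theorem PolyGrowth.prod {J₁ J₂ : Type} {w₁ : J₁ → ℝ} {w₂ : J₂ → ℝ} {u₁ : J₁ → 𝓢(E₁, ℂ)}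
    {u₂ : J₂ → 𝓢(E₂, ℂ)} (hw₁ : ∀ j, 1 ≤ w₁ j) (hw₂ : ∀ j, 1 ≤ w₂ j) (h₁ : PolyGrowth w₁ u₁)
    (h₂ : PolyGrowth w₂ u₂) :
    PolyGrowth (fun j : J₁ × J₂ => w₁ j.1 * w₂ j.2) fun j => tensor (u₁ j.1) (u₂ j.2) := by
  intro N
  obtain ⟨a, C₁, hC₁, h₁⟩ := h₁ N
  obtain ⟨b, C₂, hC₂, h₂⟩ := h₂ N
  obtain ⟨D, hD, h⟩ := exists_tensor_norm_le (V := E₁) (E := E₂) N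
  refine ⟨a + b, D * (C₁ * C₂), by positivity, fun j => (h _ _).trans ?_⟩
  have e1 := h₁ j.1
  have e2 := h₂ j.2
  have f1 := hw₁ j.1
  have f2 := hw₂ j.2
  have p1 : w₁ j.1 ^ a ≤ w₁ j.1 ^ (a + b) := pow_le_pow_right₀ f1 (Nat.le_add_right _ _)
  have p2 : w₂ j.2 ^ b ≤ w₂ j.2 ^ (a + b) := pow_le_pow_right₀ f2 (Nat.le_add_left _ _)
  calc _ ≤ D * ((C₁ * w₁ j.1 ^ (a + b)) * (C₂ * w₂ j.2 ^ (a + b))) := by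
        gcongr
        · exact e1.trans (by gcongr)
        · exact e2.trans (by gcongr)
    _ = _ := by rw [mul_pow]; ring

/-- The second variable is contracted before the first. The function met by the first contraction
then depends on `j₂`, so its decay must be uniform: the uniform boundedness principle bounds it by a
norm of that function, and this norm decays in `j₂`. -/
theorem RapidDecay.prod {J₁ J₂ : Type} {w₁ : J₁ → ℝ} {w₂ : J₂ → ℝ} {u₁ : J₁ → 𝓢(E₁, ℂ)}
    {u₂ : J₂ → 𝓢(E₂, ℂ)} (hw₁ : ∀ j, 1 ≤ w₁ j) (hw₂ : ∀ j, 1 ≤ w₂ j) (h₁ : RapidDecay μ₁ w₁ u₁)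
    (h₂ : RapidDecay μ₂ w₂ u₂) :
    RapidDecay (μ₁.prod μ₂) (fun j : J₁ × J₂ => w₁ j.1 * w₂ j.2)
      fun j => tensor (u₁ j.1) (u₂ j.2) := by
  intro V _ _ F M N
  let A : J₁ → 𝓢(V × E₁, ℂ) →L[ℂ] 𝓢(V, ℂ) := fun j => ((w₁ j ^ M : ℝ) : ℂ) • contract μ₁ (u₁ j)
  have hA : ∀ j G, schwartzNorm N (A j G) = w₁ j ^ M * schwartzNorm N (contract μ₁ (u₁ j) G) := by
    intro j G
    have := one_pos.trans_le (hw₁ j)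
    rw [smul_apply, map_smul_eq_mul, Complex.norm_real,
      Real.norm_of_nonneg (by positivity)]
  obtain ⟨K, C, hC, h⟩ := exists_uniform_bound_clm A N fun G => by
    obtain ⟨C, h⟩ := h₁ G M N
    exact ⟨C, fun j => by rw [hA]; exact h j⟩
  obtain ⟨D, hD⟩ := h₂ (assocPull F) M K
  refine ⟨C * D, fun j => ?_⟩
  have e1 := h j.1 (contract μ₂ (u₂ j.2) (assocPull F))
  rw [hA] at e1
  have := one_pos.trans_le (hw₂ j.2)
  rw [contract_prod, mul_pow]
  calc _ = w₂ j.2 ^ M * (w₁ j.1 ^ M * schwartzNorm N (contract μ₁ (u₁ j.1)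
          (contract μ₂ (u₂ j.2) (assocPull F)))) := by ring
    _ ≤ w₂ j.2 ^ M * (C * schwartzNorm K (contract μ₂ (u₂ j.2) (assocPull F))) := by gcongr
    _ = C * (w₂ j.2 ^ M * schwartzNorm K (contract μ₂ (u₂ j.2) (assocPull F))) := by ring
    _ ≤ _ := by
        gcongr
        exact hD j.2

theorem summable_weight_mono {J : Type} {w : J → ℝ} (hw : ∀ j, 1 ≤ w j) {r s : ℕ} (hrs : r ≤ s)
    (h : Summable fun j => (w j ^ r)⁻¹) : Summable fun j => (w j ^ s)⁻¹ := by
  refine Summable.of_nonneg_of_le (fun j => ?_) (fun j => ?_) h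
  · have := one_pos.trans_le (hw j)
    positivity
  · have := one_pos.trans_le (hw j)
    exact inv_anti₀ (by positivity) (pow_le_pow_right₀ (hw j) hrs)

/-- The product of two Gabor systems. -/
theorem nonempty_gaborSystem_prod (S₁ : GaborSystem μ₁) (S₂ : GaborSystem μ₂) :
    Nonempty (GaborSystem (μ₁.prod μ₂)) := by
  have := S₁.countable
  have := S₂.countable
  let w : S₁.J × S₂.J → ℝ := fun j => S₁.w j.1 * S₂.w j.2
  have hw : ∀ j, 1 ≤ w j := fun j =>
    one_le_mul_of_one_le_of_one_le (S₁.one_le j.1) (S₂.one_le j.2)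
  let r := max S₁.r S₂.r
  have hr : Summable fun j => (w j ^ r)⁻¹ := by
    have := (summable_weight_mono S₁.one_le (le_max_left S₁.r S₂.r) S₁.summable).mul_of_nonneg
      (summable_weight_mono S₂.one_le (le_max_right S₁.r S₂.r) S₂.summable)
      (fun j => inv_nonneg.2 (pow_nonneg (zero_le_one.trans (S₁.one_le j)) _))
      (fun j => inv_nonneg.2 (pow_nonneg (zero_le_one.trans (S₂.one_le j)) _))
    simpa only [w, mul_pow, mul_inv] using this
  let e : S₁.J × S₂.J → 𝓢(E₁ × E₂, ℂ) := fun j => tensor (S₁.e j.1) (S₂.e j.2)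
  let c : S₁.J × S₂.J → 𝓢(E₁ × E₂, ℂ) := fun j => tensor (S₁.c j.1) (S₂.c j.2)
  have eg : PolyGrowth w e := S₁.e_growth.prod S₁.one_le S₂.one_le S₂.e_growth
  have cg : PolyGrowth w c := S₁.c_growth.prod S₁.one_le S₂.one_le S₂.c_growth
  have ed : RapidDecay (μ₁.prod μ₂) w e := RapidDecay.prod μ₁ μ₂ S₁.one_le S₂.one_le S₁.e_decay S₂.e_decay
  have cd : RapidDecay (μ₁.prod μ₂) w c := RapidDecay.prod μ₁ μ₂ S₁.one_le S₂.one_le S₁.c_decay S₂.c_decay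
  refine ⟨⟨S₁.J × S₂.J, inferInstance, w, hw, r, hr, e, c, eg, cg, ed, cd, fun g z => ?_⟩⟩
  have hs : Summable fun j => (∫ y, c j y * g y ∂(μ₁.prod μ₂)) * e j z := by
    refine Summable.of_norm_bounded (summable_of_growth_decay hw hr
      (p := fun j => schwartzNorm 0 (e j)) (q := fun j => ‖∫ y, c j y * g y ∂(μ₁.prod μ₂)‖)
      (fun _ => apply_nonneg _ _) (fun _ => norm_nonneg _) (eg 0) (cd.scalar g)) fun j => ?_
    rw [norm_mul]
    exact mul_le_mul_of_nonneg_left (norm_le_schwartzNorm 0 _ _) (norm_nonneg _)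
  have ht : ∑' j, (∫ y, c j y * g y ∂(μ₁.prod μ₂)) * e j z = g z := by
    -- With the second index outermost, each inner sum is the expansion on `E₁` of the contraction
    -- of `g` with `S₂.c j₂`; the outer sum is then the expansion of a slice of `g`.
    have hs' := (Equiv.prodComm S₂.J S₁.J).summable_iff.2 hs
    refine ((Equiv.prodComm S₂.J S₁.J).tsum_eq _).symm.trans (hs'.tsum_prod.trans ?_)
    obtain ⟨x, y⟩ := z
    have : ∀ j₂, ∑' j₁, (∫ y, c (j₁, j₂) y * g y ∂(μ₁.prod μ₂)) * e (j₁, j₂) (x, y) =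
        (∫ y', S₂.c j₂ y' * slice x g y' ∂μ₂) * S₂.e j₂ y := by
      intro j₂
      have h := ((S₁.hasSum (contract μ₂ (S₂.c j₂) g) x).mul_right (S₂.e j₂ y)).tsum_eq
      rw [contract_apply] at h
      refine Eq.trans ?_ h
      congr 1
      funext j₁
      rw [integral_tensor_mul, tensor_apply]
      ring
    change ∑' j₂, ∑' j₁, (∫ y, c (j₁, j₂) y * g y ∂(μ₁.prod μ₂)) * e (j₁, j₂) (x, y) = _
    simp_rw [this]
    exact (S₂.hasSum (slice x g) y).tsum_eq
  exact ht ▸ hs.hasSum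

end Product

/-! ### Gabor systems on every finite dimensional space -/

section Transport
variable {E E' V : Type} [NormedAddCommGroup E] [NormedSpace ℝ E] [MeasurableSpace E]
  [BorelSpace E] [SecondCountableTopology E] [FiniteDimensional ℝ E]
  [NormedAddCommGroup E'] [NormedSpace ℝ E'] [MeasurableSpace E']
  [BorelSpace E'] [SecondCountableTopology E'] [FiniteDimensional ℝ E']
  [NormedAddCommGroup V] [NormedSpace ℝ V]

theorem exists_integral_comp_equiv (L : E ≃L[ℝ] E') (μ : Measure E) [μ.IsAddHaarMeasure]
    (ν : Measure E') [ν.IsAddHaarMeasure] :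
    ∃ κ : ℝ, 0 < κ ∧ ∀ f : E' → ℂ, ∫ x, f x ∂ν = κ * ∫ x, f (L x) ∂μ := by
  have : (ν.map L.symm).IsAddHaarMeasure := L.symm.isAddHaarMeasure_map ν
  obtain ⟨κ, h⟩ : ∃ κ : NNReal, ν.map L.symm = κ • μ :=
    ⟨_, Measure.isAddLeftInvariant_eq_smul (ν.map L.symm) μ⟩
  have hne : κ ≠ 0 := by
    rintro rfl
    rw [zero_smul] at h
    have : (ν.map L.symm) Set.univ ≠ 0 := isOpen_univ.measure_ne_zero _ Set.univ_nonempty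
    rw [h] at this
    exact this rfl
  refine ⟨_, NNReal.coe_pos.2 (pos_iff_ne_zero.2 hne), fun f => ?_⟩
  have h1 : ∫ x, f x ∂ν = ∫ x, f (L x) ∂(ν.map L.symm) := by
    have := L.symm.toHomeomorph.measurableEmbedding.integral_map (μ := ν) fun x => f (L x)
    refine Eq.trans ?_ this.symm
    congr 1
    funext x
    exact congrArg f (L.apply_symm_apply x).symm
  rw [h1, h, integral_smul_nnreal_measure]
  simp [NNReal.smul_def]

/-- Both families are composed with `L⁻¹`. The change of variables multiplies integrals by a
constant `κ`, which the factor `κ⁻¹` on the analysing functions undoes. -/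
theorem GaborSystem.transport {μ : Measure E} [μ.IsAddHaarMeasure] (S : GaborSystem μ)
    (L : E ≃L[ℝ] E') (ν : Measure E') [ν.IsAddHaarMeasure] : Nonempty (GaborSystem ν) := by
  obtain ⟨κ, hκ, hint⟩ := exists_integral_comp_equiv L μ ν
  let T : 𝓢(E, ℂ) →L[ℂ] 𝓢(E', ℂ) := SchwartzMap.compCLMOfContinuousLinearEquiv ℂ L.symm
  have hT : ∀ f x, T f (L x) = f x := fun f x => by
    change f (L.symm (L x)) = f x
    rw [L.symm_apply_apply]
  have growth : ∀ {u : S.J → 𝓢(E, ℂ)} (A : 𝓢(E, ℂ) →L[ℂ] 𝓢(E', ℂ)), PolyGrowth S.w u →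
      PolyGrowth S.w fun j => A (u j) := by
    intro u A hu N
    obtain ⟨K, C, hC, h⟩ := exists_bound_clm A N
    obtain ⟨a, D, hD, h'⟩ := hu K
    exact ⟨a, C * D, by positivity, fun j => (h _).trans (by
      rw [mul_assoc]; exact mul_le_mul_of_nonneg_left (h' j) hC)⟩
  have hcon : ∀ {V : Type} [NormedAddCommGroup V] [NormedSpace ℝ V] (F : 𝓢(V × E', ℂ))
      (u : 𝓢(E, ℂ)), contract ν (T u) F = (κ : ℂ) • contract μ u
        (SchwartzMap.compCLMOfContinuousLinearEquiv ℂ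
          ((ContinuousLinearEquiv.refl ℝ V).prodCongr L) F) := by
    intro V _ _ F u
    ext v
    rw [contract_apply, hint, smul_apply, contract_apply, smul_eq_mul]
    simp only [hT]
    rfl
  have decay : ∀ {u : S.J → 𝓢(E, ℂ)} (a : ℂ), RapidDecay μ S.w u →
      RapidDecay ν S.w fun j => a • T (u j) := by
    intro u a hu V _ _ F M N
    obtain ⟨C, h⟩ := hu (SchwartzMap.compCLMOfContinuousLinearEquiv ℂ
          ((ContinuousLinearEquiv.refl ℝ V).prodCongr L) F) M N
    refine ⟨‖a * κ‖ * C, fun j => ?_⟩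
    rw [contract_smul_left, hcon, ← mul_smul, map_smul_eq_mul, mul_left_comm]
    exact mul_le_mul_of_nonneg_left (h j) (norm_nonneg _)
  refine ⟨⟨S.J, S.countable, S.w, S.one_le, S.r, S.summable, fun j => (1 : ℂ) • T (S.e j),
    fun j => (κ⁻¹ : ℂ) • T (S.c j), growth ((1 : ℂ) • T) S.e_growth,
    growth ((κ⁻¹ : ℂ) • T) S.c_growth, decay 1 S.e_decay, decay _ S.c_decay, fun g x => ?_⟩⟩
  have h := S.hasSum (SchwartzMap.compCLMOfContinuousLinearEquiv ℂ L g) (L.symm x)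
  have e1 : SchwartzMap.compCLMOfContinuousLinearEquiv ℂ L g (L.symm x) = g x := by
    change g (L (L.symm x)) = g x
    rw [L.apply_symm_apply]
  rw [e1] at h
  convert! h using 2 with j
  rw [hint, one_smul]
  simp only [smul_apply, hT, smul_eq_mul]
  have hκ' : (κ : ℂ) ≠ 0 := by exact_mod_cast hκ.ne'
  simp only [mul_assoc]
  rw [integral_const_mul, ← mul_assoc, ← mul_assoc, mul_inv_cancel₀ hκ', one_mul]
  rfl

/-- Dimension zero, the start of the induction: the single atom is the constant 1, and its dual is
the inverse of the mass of the point. -/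
theorem nonempty_gaborSystem_of_subsingleton [Subsingleton E] (μ : Measure E)
    [μ.IsAddHaarMeasure] : Nonempty (GaborSystem μ) := by
  let k : ℂ → 𝓢(E, ℂ) := fun a =>
    { toFun := fun _ => a
      smooth' := contDiff_const
      decay' := fun k n => ⟨‖(0 : E)‖ ^ k * ‖iteratedFDeriv ℝ n (fun _ : E => a) 0‖, fun x => by
        rw [Subsingleton.elim x 0]⟩ }
  have hfin : μ Set.univ ≠ ⊤ := (Set.subsingleton_univ.finite.isCompact).measure_ne_top
  have hpos : μ Set.univ ≠ 0 := isOpen_univ.measure_ne_zero _ Set.univ_nonempty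
  have hreal : ((μ.real Set.univ : ℝ) : ℂ) ≠ 0 := by
    exact_mod_cast (ENNReal.toReal_pos hpos hfin).ne'
  have growth : ∀ u : Unit → 𝓢(E, ℂ), PolyGrowth (fun _ : Unit => (1 : ℝ)) u := fun u N =>
    ⟨0, schwartzNorm N (u ()), apply_nonneg _ _, fun j => by simp⟩
  have decay : ∀ u : Unit → 𝓢(E, ℂ), RapidDecay μ (fun _ : Unit => (1 : ℝ)) u :=
    fun u V _ _ F M N => ⟨schwartzNorm N (contract μ (u ()) F), fun j => by simp⟩
  refine ⟨⟨Unit, inferInstance, fun _ => 1, fun _ => le_rfl, 0, Summable.of_finite,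
    fun _ => k 1, fun _ => k ((μ.real Set.univ : ℂ)⁻¹), growth _, growth _, decay _, decay _,
    fun g x => ?_⟩⟩
  have h : (∫ y, k ((μ.real Set.univ : ℂ)⁻¹) y * g y ∂μ) * k 1 x = g x := by
    have : ∀ y, k ((μ.real Set.univ : ℂ)⁻¹) y * g y = (μ.real Set.univ : ℂ)⁻¹ * g x := fun y => by
      rw [Subsingleton.elim y x]
      rfl
    simp_rw [this]
    rw [integral_const]
    change _ * (1 : ℂ) = _
    rw [mul_one, Complex.real_smul, mul_inv_cancel_left₀ hreal]
  rw [← h]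
  exact hasSum_unique (fun _ : Unit => (∫ y, k ((μ.real Set.univ : ℂ)⁻¹) y * g y ∂μ) * k 1 x)

theorem nonempty_gaborSystem_pi (d : ℕ) :
    Nonempty (GaborSystem (volume : Measure (Fin d → ℝ))) := by
  induction d with
  | zero => exact nonempty_gaborSystem_of_subsingleton _
  | succ d ih =>
    obtain ⟨S⟩ := ih
    obtain ⟨R⟩ := nonempty_gaborSystem_real
    have : ((volume : Measure ℝ).prod (volume : Measure (Fin d → ℝ))).IsAddHaarMeasure :=
      Measure.prod.instIsAddHaarMeasure volume volume
    obtain ⟨P⟩ := nonempty_gaborSystem_prod _ _ R S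
    refine P.transport (ContinuousLinearEquiv.ofFinrankEq ?_) _
    simp [add_comm]

/-- Every finite dimensional space has a Gabor system. -/
theorem nonempty_gaborSystem (μ : Measure E) [μ.IsAddHaarMeasure] :
    Nonempty (GaborSystem μ) := by
  obtain ⟨S⟩ := nonempty_gaborSystem_pi (Module.finrank ℝ E)
  exact S.transport (ContinuousLinearEquiv.ofFinrankEq (by simp)) μ

end Transport

/-! ### Pointwise sums of continuous linear maps -/

section Limits
open Filter Topology

/-- The Banach–Steinhaus theorem for the finite partial sums; `J` is countable so that the filter of
finite subsets is countably generated. -/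
theorem exists_clm_of_hasSum {X Y J : Type*} [AddCommGroup X] [Module ℂ X] [UniformSpace X]
    [IsUniformAddGroup X] [ContinuousSMul ℂ X] [BarrelledSpace ℂ X]
    [AddCommGroup Y] [Module ℂ Y] [UniformSpace Y] [IsUniformAddGroup Y] [ContinuousSMul ℂ Y]
    [PolynormableSpace ℂ Y] [T2Space Y] [Countable J] (A : J → X →L[ℂ] Y)
    (h : ∀ x, ∃ y, HasSum (fun j => A j x) y) :
    ∃ B : X →L[ℂ] Y, ∀ x, HasSum (fun j => A j x) (B x) := by
  choose f hf using h
  have ht : Tendsto (fun (s : Finset J) x => (∑ j ∈ s, A j) x) atTop (𝓝 f) := by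
    rw [tendsto_pi_nhds]
    intro x
    have := hf x
    rw [HasSum, SummationFilter.unconditional_filter] at this
    simpa using this
  exact ⟨continuousLinearMapOfTendsto (fun s : Finset J => ∑ j ∈ s, A j) ht, hf⟩

instance schwartz_polynormable {E : Type*} [NormedAddCommGroup E] [NormedSpace ℝ E] :
    PolynormableSpace ℂ 𝓢(E, ℂ) := (schwartz_withSeminorms ℂ E ℂ).toPolynormableSpace

end Limits

/-! ### Consequences of the expansion: lifting, continuity, density -/

section Expansion
variable {E V H : Type} [NormedAddCommGroup E] [NormedSpace ℝ E] [MeasurableSpace E] [BorelSpace E]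
  [SecondCountableTopology E] [NormedAddCommGroup V] [NormedSpace ℝ V]
  [NormedAddCommGroup H] [NormedSpace ℝ H] {μ : Measure E} [μ.HasTemperateGrowth]

theorem GaborSystem.hasSum_tensor (S : GaborSystem μ) (F : 𝓢(V × E, ℂ)) :
    HasSum (fun j => tensor (contract μ (S.c j) F) (S.e j)) F := by
  obtain ⟨s, hs, hp⟩ := schwartz_hasSum_of_norm
    (fun j => tensor (contract μ (S.c j) F) (S.e j)) fun N => by
      obtain ⟨C, hC, h⟩ := exists_tensor_norm_le (V := V) (E := E) N
      refine Summable.of_nonneg_of_le (fun _ => apply_nonneg _ _) (fun j => h _ _)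
        (Summable.mul_left C ?_)
      exact summable_of_growth_decay S.one_le S.summable (fun _ => apply_nonneg _ _)
        (fun _ => apply_nonneg _ _) (S.e_growth N) (fun M => S.c_decay F M N)
  have : s = F := by
    ext ⟨v, y⟩
    refine (hp (v, y)).unique ?_
    have := S.hasSum (slice v F) y
    convert! this using 2 with j
    rw [tensor_apply, contract_apply]
    rfl
  exact this ▸ hs

theorem GaborSystem.hasSum_smul (S : GaborSystem μ) (g : 𝓢(E, ℂ)) :
    HasSum (fun j => (∫ y, S.c j y * g y ∂μ) • S.e j) g := by
  obtain ⟨s, hs, hp⟩ := schwartz_hasSum_of_norm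
    (fun j => (∫ y, S.c j y * g y ∂μ) • S.e j) fun N => by
      simp_rw [map_smul_eq_mul]
      exact summable_of_growth_decay S.one_le S.summable (fun _ => apply_nonneg _ _)
        (fun _ => norm_nonneg _) (S.e_growth N) (fun M => RapidDecay.scalar S.c_decay g M)
  have : s = g := by
    ext y
    exact (hp y).unique (S.hasSum g y)
  exact this ▸ hs

/-- The lift is `F ↦ ∑ b(contract (c j) F, e j)`. It converges because `b` is jointly bounded, the
contractions decrease rapidly and the atoms grow polynomially; it is continuous as a pointwise sum.
On `f ⊗ g` it is the image under `b f` of the expansion of `g`. -/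
theorem GaborSystem.exists_lift (S : GaborSystem μ)
    (b : 𝓢(V, ℂ) →ₗ[ℂ] 𝓢(E, ℂ) →ₗ[ℂ] 𝓢(H, ℂ))
    (hr : ∀ f, Continuous fun g => b f g) (hl : ∀ g, Continuous fun f => b f g) :
    ∃ A : 𝓢(V × E, ℂ) →L[ℂ] 𝓢(H, ℂ), ∀ f g, A (tensor f g) = b f g := by
  have := S.countable
  let A : S.J → 𝓢(V × E, ℂ) →L[ℂ] 𝓢(H, ℂ) := fun j =>
    (⟨b.flip (S.e j), hl (S.e j)⟩ : 𝓢(V, ℂ) →L[ℂ] 𝓢(H, ℂ)).comp (contract μ (S.c j))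
  have hA : ∀ j F, A j F = b (contract μ (S.c j) F) (S.e j) := fun _ _ => rfl
  obtain ⟨B, hB⟩ := exists_clm_of_hasSum A fun F => by
    obtain ⟨s, hs, -⟩ := schwartz_hasSum_of_norm (fun j => A j F) fun N => by
      obtain ⟨M, C, hC, h⟩ := exists_bound_bilinear b hr hl N
      refine Summable.of_nonneg_of_le (fun _ => apply_nonneg _ _) (fun j => h _ _)
        (Summable.mul_left C ?_)
      exact summable_of_growth_decay S.one_le S.summable (fun _ => apply_nonneg _ _)
        (fun _ => apply_nonneg _ _) (S.e_growth M) (fun K => S.c_decay F K M)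
    exact ⟨s, hs⟩
  refine ⟨B, fun f g => (hB _).unique ?_⟩
  have h := (S.hasSum_smul g).mapL (⟨b f, hr f⟩ : 𝓢(E, ℂ) →L[ℂ] 𝓢(H, ℂ))
  convert! h using 2 with j
  rw [hA, contract_tensor, map_smul, LinearMap.smul_apply]
  exact ((b f).map_smul _ _).symm

theorem toDist_apply (f g : 𝓢(E, ℂ)) : toDist μ f g = ∫ y, f y * g y ∂μ := by
  refine (SchwartzMap.toTemperedDistributionCLM_apply_apply μ f g).trans ?_
  simp only [smul_eq_mul, mul_comm]

/-- A substitute for the closed graph theorem: `A x = ∑ ⟨c j, A x⟩ e j` is a pointwise sum of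
continuous maps of rank at most one on a barrelled space. -/
theorem GaborSystem.continuous_of_pairing (S : GaborSystem μ) {X : Type*} [AddCommGroup X]
    [Module ℂ X] [UniformSpace X] [IsUniformAddGroup X] [ContinuousSMul ℂ X] [BarrelledSpace ℂ X]
    (A : X →ₗ[ℂ] 𝓢(E, ℂ)) (h : ∀ k : 𝓢(E, ℂ), Continuous fun x => ∫ y, k y * A x y ∂μ) :
    Continuous A := by
  have := S.countable
  let p : 𝓢(E, ℂ) → 𝓢(E, ℂ) →ₗ[ℂ] ℂ := fun k => (toDist μ k).toLinearMap
  have hp : ∀ k g, p k g = ∫ y, k y * g y ∂μ := toDist_apply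
  let B : S.J → X →L[ℂ] 𝓢(E, ℂ) := fun j =>
    (⟨(p (S.c j)).comp A, by
      refine (h (S.c j)).congr fun x => ?_
      exact (hp _ _).symm⟩ : X →L[ℂ] ℂ).smulRight (S.e j)
  have hB : ∀ x, HasSum (fun j => B j x) (A x) := fun x => by
    refine (S.hasSum_smul (A x)).congr_fun ?_
    intro j
    rw [← hp]
    rfl
  obtain ⟨D, hD⟩ := exists_clm_of_hasSum B fun x => ⟨_, hB x⟩
  have : ⇑A = ⇑D := funext fun x => (hB x).unique (hD x)
  rw [this]
  exact D.continuous

/-- Applying `T` to the expansion of a test function gives weak convergence. This is how the density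
of `𝓢` in `𝓢'` is used. -/
theorem GaborSystem.hasSum_dist (S : GaborSystem μ) (T : 𝓢'(E, ℂ)) :
    HasSum (fun j => T (S.e j) • toDist μ (S.c j)) T := by
  rw [HasSum, SummationFilter.unconditional_filter, PointwiseConvergenceCLM.tendsto_iff_forall_tendsto]
  intro g
  have h := (S.hasSum_smul g).map (T : 𝓢(E, ℂ) →ₗ[ℂ] ℂ).toAddMonoidHom T.continuous
  rw [HasSum, SummationFilter.unconditional_filter] at h
  refine h.congr fun s => ?_
  rw [sum_apply]
  refine Finset.sum_congr rfl fun j _ => ?_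
  change T ((∫ y, S.c j y * g y ∂μ) • S.e j) = T (S.e j) • toDist μ (S.c j) g
  rw [map_smul, toDist_apply, smul_eq_mul, smul_eq_mul, mul_comm]

end Expansion

/-! ### Continuity and extensionality without a chosen Gabor system -/

section FiniteDim
variable {E V H : Type} [NormedAddCommGroup E] [NormedSpace ℝ E] [MeasurableSpace E] [BorelSpace E]
  [FiniteDimensional ℝ E] [SecondCountableTopology E] [NormedAddCommGroup V] [NormedSpace ℝ V]
  [NormedAddCommGroup H] [NormedSpace ℝ H]

theorem continuous_of_pairing (μ : Measure E) [μ.IsAddHaarMeasure] {X : Type*} [AddCommGroup X]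
    [Module ℂ X] [UniformSpace X] [IsUniformAddGroup X] [ContinuousSMul ℂ X] [BarrelledSpace ℂ X]
    (A : X →ₗ[ℂ] 𝓢(E, ℂ)) (h : ∀ k : 𝓢(E, ℂ), Continuous fun x => ∫ y, k y * A x y ∂μ) :
    Continuous A :=
  (nonempty_gaborSystem μ).some.continuous_of_pairing A h

theorem dist_ext (μ : Measure E) [μ.IsAddHaarMeasure] {X : Type*} [AddCommMonoid X]
    [TopologicalSpace X] [T2Space X] {φ ψ : 𝓢'(E, ℂ) →+ X} (hφ : Continuous φ) (hψ : Continuous ψ)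
    (h : ∀ f, φ (toDist μ f) = ψ (toDist μ f)) : φ = ψ := by
  ext T
  obtain ⟨S⟩ := nonempty_gaborSystem μ
  have h1 := (S.hasSum_dist T).map φ hφ
  have h2 := (S.hasSum_dist T).map ψ hψ
  refine h1.unique ?_
  have e : φ ∘ (fun j => T (S.e j) • toDist μ (S.c j)) =
      ψ ∘ fun j => T (S.e j) • toDist μ (S.c j) := by
    funext j
    change φ (T (S.e j) • toDist μ (S.c j)) = ψ (T (S.e j) • toDist μ (S.c j))
    rw [← map_smul, h]
  rwa [e]

end FiniteDim

/-! ### Density of elementary tensors and the kernel theorem -/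

section Tensor
variable {E V H : Type} [NormedAddCommGroup E] [NormedSpace ℝ E]
  [FiniteDimensional ℝ E] [NormedAddCommGroup V] [NormedSpace ℝ V]
  [NormedAddCommGroup H] [NormedSpace ℝ H]

/-- Every Schwartz function is a convergent sum of elementary tensors. Only additivity is asked, so
that conjugate linear maps are covered too. -/
theorem addMonoidHom_tensor_ext {X : Type*} [AddCommMonoid X] [TopologicalSpace X] [T2Space X]
    {φ ψ : 𝓢(V × E, ℂ) →+ X} (hφ : Continuous φ) (hψ : Continuous ψ)
    (h : ∀ f g, φ (tensor f g) = ψ (tensor f g)) : φ = ψ := by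
  borelize E
  have : SecondCountableTopology E := inferInstance
  obtain ⟨S⟩ := nonempty_gaborSystem (Measure.addHaar : Measure E)
  ext F
  have h1 := (S.hasSum_tensor F).map φ hφ
  have h2 := (S.hasSum_tensor F).map ψ hψ
  refine h1.unique ?_
  have e : φ ∘ (fun j => tensor (contract Measure.addHaar (S.c j) F) (S.e j)) =
      ψ ∘ fun j => tensor (contract Measure.addHaar (S.c j) F) (S.e j) := funext fun j => h _ _
  rwa [e]

/-- Continuous additive maps that agree on elementary tensors are equal. -/
theorem eq_of_tensor {X : Type*} [AddCommMonoid X] [TopologicalSpace X] [T2Space X]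
    {L₁ L₂ : Type*} [FunLike L₁ 𝓢(V × E, ℂ) X] [AddMonoidHomClass L₁ 𝓢(V × E, ℂ) X]
    [ContinuousMapClass L₁ 𝓢(V × E, ℂ) X]
    [FunLike L₂ 𝓢(V × E, ℂ) X] [AddMonoidHomClass L₂ 𝓢(V × E, ℂ) X]
    [ContinuousMapClass L₂ 𝓢(V × E, ℂ) X] (φ : L₁) (ψ : L₂)
    (h : ∀ f g, φ (tensor f g) = ψ (tensor f g)) (F : 𝓢(V × E, ℂ)) : φ F = ψ F :=
  DFunLike.congr_fun (addMonoidHom_tensor_ext (φ := (φ : 𝓢(V × E, ℂ) →+ X))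
    (ψ := (ψ : 𝓢(V × E, ℂ) →+ X)) (map_continuous φ) (map_continuous ψ) h) F

/-- The kernel theorem: a separately continuous bilinear map factors through the tensor
product. -/
theorem exists_lift (b : 𝓢(V, ℂ) →ₗ[ℂ] 𝓢(E, ℂ) →ₗ[ℂ] 𝓢(H, ℂ))
    (hr : ∀ f, Continuous fun g => b f g) (hl : ∀ g, Continuous fun f => b f g) :
    ∃ A : 𝓢(V × E, ℂ) →L[ℂ] 𝓢(H, ℂ), ∀ f g, A (tensor f g) = b f g := by
  borelize E
  have : SecondCountableTopology E := inferInstance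
  exact (nonempty_gaborSystem (Measure.addHaar : Measure E)).some.exists_lift b hr hl

end Tensor

/-! ### Moyal algebras of an abstract composition law -/

section MoyalAlgebra
variable {E : Type} [NormedAddCommGroup E] [NormedSpace ℝ E] [MeasurableSpace E] [BorelSpace E]
  [SecondCountableTopology E] [FiniteDimensional ℝ E]
  {m : CompositionLaw E} {τ : E ≃L[ℝ] E} {μ : Measure E} [μ.IsAddHaarMeasure]

theorem toDist_injective (μ : Measure E) [μ.IsAddHaarMeasure] :
    Function.Injective (toDist μ : 𝓢(E, ℂ) → 𝓢'(E, ℂ)) := by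
  refine (injective_iff_map_eq_zero _).2 fun f hf => ?_
  obtain ⟨S⟩ := nonempty_gaborSystem μ
  have h := S.hasSum_smul f
  have h0 : ∀ j, ∫ y, S.c j y * f y ∂μ = 0 := fun j => by
    have := congrArg (fun T : 𝓢'(E, ℂ) => T (S.c j)) hf
    rw [toDist_apply] at this
    simpa only [mul_comm] using! this
  simp only [h0, zero_smul] at h
  exact h.unique hasSum_zero

/-- The pairing `∫ f (g ∘ τ) dμ` of Schwartz functions. -/
noncomputable def pair (τ : E ≃L[ℝ] E) (μ : Measure E) [μ.HasTemperateGrowth] (f g : 𝓢(E, ℂ)) : ℂ :=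
  dual τ (toDist μ f) g

theorem pair_eq (f g : 𝓢(E, ℂ)) : pair τ μ f g = ∫ x, f x * g (τ x) ∂μ := toDist_apply _ _

theorem comp_comp_symm (h : 𝓢(E, ℂ)) : comp τ (comp τ.symm h) = h := by
  ext x; simp [comp]

theorem dual_ext {T U : 𝓢'(E, ℂ)} (h : ∀ k, dual τ T k = dual τ U k) : T = U := by
  ext k
  have := h (comp τ.symm k)
  rwa [dual, dual, comp_comp_symm] at this

theorem pair_ext {f g : 𝓢(E, ℂ)} (h : ∀ k, pair τ μ f k = pair τ μ g k) : f = g :=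
  toDist_injective μ (dual_ext (τ := τ) h)

theorem dual_add (T U : 𝓢'(E, ℂ)) (h : 𝓢(E, ℂ)) :
    dual τ (T + U) h = dual τ T h + dual τ U h := rfl

theorem dual_smul (c : ℂ) (T : 𝓢'(E, ℂ)) (h : 𝓢(E, ℂ)) :
    dual τ (c • T) h = c * dual τ T h := rfl

theorem dual_map_add (T : 𝓢'(E, ℂ)) (h k : 𝓢(E, ℂ)) :
    dual τ T (h + k) = dual τ T h + dual τ T k := by
  rw [dual, map_add, map_add]; rfl

theorem dual_map_smul (T : 𝓢'(E, ℂ)) (c : ℂ) (h : 𝓢(E, ℂ)) :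
    dual τ T (c • h) = c * dual τ T h := by
  rw [dual, map_smul, map_smul]; rfl

theorem continuous_dual (T : 𝓢'(E, ℂ)) : Continuous (dual τ T) :=
  T.continuous.comp (comp τ).continuous

theorem dual_starD (T : 𝓢'(E, ℂ)) (h : 𝓢(E, ℂ)) :
    dual τ (starD τ T) h = starRingEnd ℂ (dual τ T (starS τ h)) := rfl

/-- The distribution `T ∘ A`, with respect to the duality `⟨·,·⟩_τ`. -/
noncomputable def dualPull {E' : Type} [NormedAddCommGroup E'] [NormedSpace ℝ E']
    (τ : E ≃L[ℝ] E) (τ' : E' ≃L[ℝ] E') (A : 𝓢(E, ℂ) →L[ℂ] 𝓢(E', ℂ)) (T : 𝓢'(E', ℂ)) : 𝓢'(E, ℂ) :=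
  PointwiseConvergenceCLM.precomp ℂ ((comp τ').comp (A.comp (comp τ.symm))) T

theorem dual_dualPull {E' : Type} [NormedAddCommGroup E'] [NormedSpace ℝ E']
    (τ' : E' ≃L[ℝ] E') (A : 𝓢(E, ℂ) →L[ℂ] 𝓢(E', ℂ)) (T : 𝓢'(E', ℂ)) (h : 𝓢(E, ℂ)) :
    dual τ (dualPull τ τ' A T) h = dual τ' T (A h) := by
  change T (comp τ' (A (comp τ.symm (comp τ h)))) = _
  rw [comp_symm_comp]
  rfl

theorem toDist_eq_mulDS_iff {T : 𝓢'(E, ℂ)} {g k : 𝓢(E, ℂ)} :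
    toDist μ k = mulDS m τ T g ↔ ∀ h, pair τ μ k h = dual τ T (m.mul g h) :=
  ⟨fun e h => by rw [pair, e, dual_mulDS],
    fun e => dual_ext (τ := τ) fun h => by rw [dual_mulDS]; exact e h⟩

theorem toDist_eq_mulSD_iff {T : 𝓢'(E, ℂ)} {g k : 𝓢(E, ℂ)} :
    toDist μ k = mulSD m τ g T ↔ ∀ h, pair τ μ k h = dual τ T (m.mul h g) :=
  ⟨fun e h => by rw [pair, e, dual_mulSD],
    fun e => dual_ext (τ := τ) fun h => by rw [dual_mulSD]; exact e h⟩

theorem mem_moyal_iff {T : 𝓢'(E, ℂ)} : T ∈ moyal m τ μ ↔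
    (∀ g, ∃ k, ∀ h, pair τ μ k h = dual τ T (m.mul g h)) ∧
      ∀ g, ∃ k, ∀ h, pair τ μ k h = dual τ T (m.mul h g) := by
  rw [mem_moyal]
  simp only [toDist_eq_mulDS_iff, toDist_eq_mulSD_iff, forall_and]

/-- The pairing is nondegenerate, so `k` is unique and depends linearly on `g`; each of its pairings
is `T` applied to a continuous function of `g`, so it depends continuously on `g`. With the product
and its flip as `b`, this gives left and right multiplication by `T` as operators on `𝓢`. -/
theorem exists_clm_of_pair (T : 𝓢'(E, ℂ)) (b : 𝓢(E, ℂ) →ₗ[ℂ] 𝓢(E, ℂ) →ₗ[ℂ] 𝓢(E, ℂ))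
    (hb : ∀ h, Continuous fun g => b g h)
    (H : ∀ g, ∃ k, ∀ h, pair τ μ k h = dual τ T (b g h)) :
    ∃ L : 𝓢(E, ℂ) →L[ℂ] 𝓢(E, ℂ), ∀ g h, pair τ μ (L g) h = dual τ T (b g h) := by
  choose L hL using H
  have pa : ∀ f f' h, pair τ μ (f + f') h = pair τ μ f h + pair τ μ f' h := fun f f' h => by
    rw [pair, map_add, dual_add]; rfl
  have ps : ∀ (c : ℂ) f h, pair τ μ (c • f) h = c * pair τ μ f h := fun c f h => by
    rw [pair, map_smul, dual_smul]; rfl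
  let A : 𝓢(E, ℂ) →ₗ[ℂ] 𝓢(E, ℂ) :=
    { toFun := L
      map_add' := fun g g' => pair_ext (τ := τ) (μ := μ) fun h => by
        rw [pa, hL, hL, hL, map_add, LinearMap.add_apply, dual_map_add]
      map_smul' := fun c g => pair_ext (τ := τ) (μ := μ) fun h => by
        rw [RingHom.id_apply, ps, hL, hL, map_smul, LinearMap.smul_apply, dual_map_smul] }
  refine ⟨⟨A, continuous_of_pairing μ A fun k => ?_⟩, hL⟩
  have : (fun g => ∫ y, k y * A g y ∂μ) = fun g => dual τ T (b g (comp τ.symm k)) := by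
    funext g
    rw [← hL, pair, dual, comp_comp_symm, toDist_apply]
    congr 1
    funext y
    exact mul_comm _ _
  rw [this]
  exact (continuous_dual T).comp (hb _)

theorem exists_left_of_mem {T : 𝓢'(E, ℂ)} (hT : T ∈ moyal m τ μ) :
    ∃ L : 𝓢(E, ℂ) →L[ℂ] 𝓢(E, ℂ), ∀ g h, pair τ μ (L g) h = dual τ T (m.mul g h) :=
  exists_clm_of_pair T m.mul m.continuous_mul_left (mem_moyal_iff.1 hT).1

theorem exists_right_of_mem {T : 𝓢'(E, ℂ)} (hT : T ∈ moyal m τ μ) :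
    ∃ R : 𝓢(E, ℂ) →L[ℂ] 𝓢(E, ℂ), ∀ g h, pair τ μ (R g) h = dual τ T (m.mul h g) :=
  exists_clm_of_pair T m.mul.flip m.continuous_mul_right (mem_moyal_iff.1 hT).2

/-- Here `L` is left multiplication by `U`, and `L h` is the only Schwartz function that represents
`U # h`. So the product is `T ∘ L`, read in the duality. -/
theorem isMoyalProduct_iff {T U V : 𝓢'(E, ℂ)} {L : 𝓢(E, ℂ) →L[ℂ] 𝓢(E, ℂ)}
    (hL : ∀ g h, pair τ μ (L g) h = dual τ U (m.mul g h)) :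
    IsMoyalProduct m τ μ T U V ↔ ∀ h, dual τ V h = dual τ T (L h) := by
  refine ⟨fun H h => H h (L h) (toDist_eq_mulDS_iff.2 (hL h)), fun H h k hk => ?_⟩
  rw [H, pair_ext (f := L h) (g := k) (τ := τ) (μ := μ)]
  intro l
  rw [hL, toDist_eq_mulDS_iff.1 hk]

theorem isMoyalProduct_moyalMul {T U : 𝓢'(E, ℂ)} {L : 𝓢(E, ℂ) →L[ℂ] 𝓢(E, ℂ)}
    (hL : ∀ g h, pair τ μ (L g) h = dual τ U (m.mul g h)) :
    IsMoyalProduct m τ μ T U (moyalMul m τ μ T U) := by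
  have H : ∃ V, IsMoyalProduct m τ μ T U V :=
    ⟨dualPull τ τ L T, (isMoyalProduct_iff hL).2 fun h => dual_dualPull τ L T h⟩
  rw [moyalMul, dif_pos H]
  exact H.choose_spec

theorem dual_moyalMul {T U : 𝓢'(E, ℂ)} {L : 𝓢(E, ℂ) →L[ℂ] 𝓢(E, ℂ)}
    (hL : ∀ g h, pair τ μ (L g) h = dual τ U (m.mul g h)) (h : 𝓢(E, ℂ)) :
    dual τ (moyalMul m τ μ T U) h = dual τ T (L h) :=
  (isMoyalProduct_iff hL).1 (isMoyalProduct_moyalMul hL) h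

/-- The properties of a composition law, an involution and a duality on which the theory of the
Moyal algebra rests. -/
structure MoyalData (m : CompositionLaw E) (τ : E ≃L[ℝ] E) (μ : Measure E)
    [μ.IsAddHaarMeasure] : Prop where
  assoc : ∀ f g h, m.mul (m.mul f g) h = m.mul f (m.mul g h)
  star_mul : ∀ f g, starS τ (m.mul f g) = m.mul (starS τ g) (starS τ f)
  star_star : ∀ f : 𝓢(E, ℂ), starS τ (starS τ f) = f
  cyclic : ∀ f g h, pair τ μ (m.mul f g) h = pair τ μ f (m.mul g h)
  symm : ∀ f g, pair τ μ f g = pair τ μ g f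
  star_pair : ∀ f g, pair τ μ (starS τ f) (starS τ g) = starRingEnd ℂ (pair τ μ f g)
  nondeg : ∀ T, (∀ f g, dual τ T (m.mul f g) = 0) → T = 0

namespace MoyalData
variable (D : MoyalData m τ μ)
include D

theorem left_mul {U : 𝓢'(E, ℂ)} {L : 𝓢(E, ℂ) →L[ℂ] 𝓢(E, ℂ)}
    (hL : ∀ g h, pair τ μ (L g) h = dual τ U (m.mul g h)) (g h : 𝓢(E, ℂ)) :
    L (m.mul g h) = m.mul (L g) h :=
  pair_ext (τ := τ) (μ := μ) fun k => by rw [hL, D.assoc, D.cyclic, hL]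

theorem right_mul {U : 𝓢'(E, ℂ)} {R : 𝓢(E, ℂ) →L[ℂ] 𝓢(E, ℂ)}
    (hR : ∀ g h, pair τ μ (R g) h = dual τ U (m.mul h g)) (g h : 𝓢(E, ℂ)) :
    R (m.mul g h) = m.mul g (R h) :=
  pair_ext (τ := τ) (μ := μ) fun k => by
    rw [hR, D.symm (m.mul g (R h)), ← D.cyclic, D.symm, hR, D.assoc]

theorem left_moyalMul {T U : 𝓢'(E, ℂ)} {L L' : 𝓢(E, ℂ) →L[ℂ] 𝓢(E, ℂ)}
    (hL : ∀ g h, pair τ μ (L g) h = dual τ T (m.mul g h))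
    (hL' : ∀ g h, pair τ μ (L' g) h = dual τ U (m.mul g h)) (g h : 𝓢(E, ℂ)) :
    pair τ μ (L.comp L' g) h = dual τ (moyalMul m τ μ T U) (m.mul g h) := by
  rw [dual_moyalMul hL', D.left_mul hL', ← hL]
  rfl

theorem right_moyalMul {T U : 𝓢'(E, ℂ)} {L' R R' : 𝓢(E, ℂ) →L[ℂ] 𝓢(E, ℂ)}
    (hL' : ∀ g h, pair τ μ (L' g) h = dual τ U (m.mul g h))
    (hR : ∀ g h, pair τ μ (R g) h = dual τ T (m.mul h g))
    (hR' : ∀ g h, pair τ μ (R' g) h = dual τ U (m.mul h g)) (g h : 𝓢(E, ℂ)) :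
    pair τ μ (R'.comp R g) h = dual τ (moyalMul m τ μ T U) (m.mul h g) := by
  rw [dual_moyalMul hL', D.left_mul hL', ← hR, D.symm (R g) (L' h), hL', ← hR']
  rfl

/-- Cyclicity `⟨T, U # k⟩ = ⟨U, k # T⟩` in the Moyal algebra. For `k = f # g` both sides are the
pairing of `U # f` with `g # T`; nondegeneracy extends this to all `k`. The involution reverses
products because of it. -/
theorem dual_left_eq_dual_right {T U : 𝓢'(E, ℂ)} {L' R : 𝓢(E, ℂ) →L[ℂ] 𝓢(E, ℂ)}
    (hL' : ∀ g h, pair τ μ (L' g) h = dual τ U (m.mul g h))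
    (hR : ∀ g h, pair τ μ (R g) h = dual τ T (m.mul h g)) (k : 𝓢(E, ℂ)) :
    dual τ T (L' k) = dual τ U (R k) := by
  have h0 : dualPull τ τ L' T - dualPull τ τ R U = 0 := D.nondeg _ fun f g => by
    have e1 := dual_dualPull (τ := τ) τ L' T (m.mul f g)
    have e2 := dual_dualPull (τ := τ) τ R U (m.mul f g)
    change dual τ (dualPull τ τ L' T) (m.mul f g) - dual τ (dualPull τ τ R U) (m.mul f g) = 0
    rw [e1, e2, D.left_mul hL', ← hR, D.symm, hL', D.right_mul hR, sub_self]
  rw [← dual_dualPull (τ := τ) τ L' T k, ← dual_dualPull (τ := τ) τ R U k, sub_eq_zero.1 h0]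

theorem left_star {T : 𝓢'(E, ℂ)} {R : 𝓢(E, ℂ) →L[ℂ] 𝓢(E, ℂ)}
    (hR : ∀ g h, pair τ μ (R g) h = dual τ T (m.mul h g)) (g h : 𝓢(E, ℂ)) :
    pair τ μ (starS τ (R (starS τ g))) h = dual τ (starD τ T) (m.mul g h) := by
  rw [dual_starD, D.star_mul, ← hR, ← D.star_pair, D.star_star]

theorem right_star {T : 𝓢'(E, ℂ)} {L : 𝓢(E, ℂ) →L[ℂ] 𝓢(E, ℂ)}
    (hL : ∀ g h, pair τ μ (L g) h = dual τ T (m.mul g h)) (g h : 𝓢(E, ℂ)) :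
    pair τ μ (starS τ (L (starS τ g))) h = dual τ (starD τ T) (m.mul h g) := by
  rw [dual_starD, D.star_mul, ← hL, ← D.star_pair, D.star_star]

theorem star_mem {T : 𝓢'(E, ℂ)} (hT : T ∈ moyal m τ μ) : starD τ T ∈ moyal m τ μ := by
  obtain ⟨L, hL⟩ := exists_left_of_mem hT
  obtain ⟨R, hR⟩ := exists_right_of_mem hT
  exact mem_moyal_iff.2 ⟨fun g => ⟨_, D.left_star hR g⟩, fun g => ⟨_, D.right_star hL g⟩⟩

theorem mul_mem {T U : 𝓢'(E, ℂ)} (hT : T ∈ moyal m τ μ) (hU : U ∈ moyal m τ μ) :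
    moyalMul m τ μ T U ∈ moyal m τ μ := by
  obtain ⟨L, hL⟩ := exists_left_of_mem hT
  obtain ⟨R, hR⟩ := exists_right_of_mem hT
  obtain ⟨L', hL'⟩ := exists_left_of_mem hU
  obtain ⟨R', hR'⟩ := exists_right_of_mem hU
  exact mem_moyal_iff.2 ⟨fun g => ⟨_, D.left_moyalMul hL hL' g⟩,
    fun g => ⟨_, D.right_moyalMul hL' hR hR' g⟩⟩

/-- The Moyal algebra is a `*`-algebra. -/
theorem isMoyalStarAlgebra : IsMoyalStarAlgebra m τ μ where
  mul_spec T _ U hU := isMoyalProduct_moyalMul (exists_left_of_mem hU).choose_spec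
  mul_mem T hT U hU := D.mul_mem hT hU
  mul_assoc T hT U hU V hV := by
    obtain ⟨L', hL'⟩ := exists_left_of_mem hU
    obtain ⟨L'', hL''⟩ := exists_left_of_mem hV
    refine dual_ext (τ := τ) fun h => ?_
    rw [dual_moyalMul hL'', dual_moyalMul hL', dual_moyalMul (D.left_moyalMul hL' hL'')]
    rfl
  add_mul T hT U hU V hV := by
    obtain ⟨L, hL⟩ := exists_left_of_mem hV
    refine dual_ext (τ := τ) fun h => ?_
    rw [dual_moyalMul hL, dual_add, dual_add, dual_moyalMul hL, dual_moyalMul hL]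
  mul_add T hT U hU V hV := by
    obtain ⟨L, hL⟩ := exists_left_of_mem hU
    obtain ⟨L', hL'⟩ := exists_left_of_mem hV
    have hs : ∀ g h, pair τ μ ((L + L') g) h = dual τ (U + V) (m.mul g h) := fun g h => by
      rw [dual_add, ← hL, ← hL', pair, add_apply, map_add]
      rfl
    refine dual_ext (τ := τ) fun h => ?_
    rw [dual_moyalMul hs, dual_add, dual_moyalMul hL, dual_moyalMul hL', add_apply, dual_map_add]
  smul_mul c T hT U hU := by
    obtain ⟨L, hL⟩ := exists_left_of_mem hU
    refine dual_ext (τ := τ) fun h => ?_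
    rw [dual_moyalMul hL, dual_smul, dual_smul, dual_moyalMul hL]
  mul_smul c T hT U hU := by
    obtain ⟨L, hL⟩ := exists_left_of_mem hU
    have hs : ∀ g h, pair τ μ ((c • L) g) h = dual τ (c • U) (m.mul g h) := fun g h => by
      rw [dual_smul, ← hL, pair, smul_apply, map_smul]
      rfl
    refine dual_ext (τ := τ) fun h => ?_
    rw [dual_moyalMul hs, dual_smul, dual_moyalMul hL, smul_apply, dual_map_smul]
  star_mem T hT := D.star_mem hT
  star_star T _ := dual_ext (τ := τ) fun h => by
    rw [dual_starD, dual_starD, D.star_star, Complex.conj_conj]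
  star_add T _ U _ := dual_ext (τ := τ) fun h => by
    rw [dual_starD, dual_add, dual_add, dual_starD, dual_starD, map_add]
  star_smul c T _ := dual_ext (τ := τ) fun h => by
    rw [dual_starD, dual_smul, dual_smul, dual_starD, map_mul]
  star_mul T hT U hU := by
    obtain ⟨R, hR⟩ := exists_right_of_mem hT
    obtain ⟨L', hL'⟩ := exists_left_of_mem hU
    obtain ⟨L, hL⟩ := exists_left_of_mem (D.star_mem hT)
    refine dual_ext (τ := τ) fun h => ?_
    have : L h = starS τ (R (starS τ h)) := pair_ext (τ := τ) (μ := μ) fun k => by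
      rw [hL, D.left_star hR]
    rw [dual_starD, dual_moyalMul hL', dual_moyalMul hL, this, dual_starD, D.star_star,
      D.dual_left_eq_dual_right hL' hR]

end MoyalData

/-! ### Transport of Moyal algebras along an isomorphism of Schwartz algebras -/

section Transport
variable {E' : Type} [NormedAddCommGroup E'] [NormedSpace ℝ E'] [MeasurableSpace E']
  [BorelSpace E'] [SecondCountableTopology E'] [FiniteDimensional ℝ E']
  {m' : CompositionLaw E'} {τ' : E' ≃L[ℝ] E'} {μ' : Measure E'} [μ'.IsAddHaarMeasure]
  (Φ : 𝓢(E, ℂ) ≃L[ℂ] 𝓢(E', ℂ))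

/-- Transport of `MoyalData` along an isomorphism of Schwartz spaces. -/
theorem MoyalData.transport
    (hmul : ∀ f g, Φ (m.mul f g) = m'.mul (Φ f) (Φ g))
    (hstar : ∀ f, Φ (starS τ f) = starS τ' (Φ f))
    (hpair : ∀ f g, pair τ' μ' (Φ f) (Φ g) = pair τ μ f g)
    (D : MoyalData m τ μ) : MoyalData m' τ' μ' where
  assoc := Φ.surjective.forall.2 fun f => Φ.surjective.forall.2 fun g =>
    Φ.surjective.forall.2 fun h => by simp only [← hmul, D.assoc]
  star_mul := Φ.surjective.forall.2 fun f => Φ.surjective.forall.2 fun g => by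
    simp only [← hmul, ← hstar, D.star_mul]
  star_star := Φ.surjective.forall.2 fun f => by simp only [← hstar, D.star_star]
  cyclic := Φ.surjective.forall.2 fun f => Φ.surjective.forall.2 fun g =>
    Φ.surjective.forall.2 fun h => by simp only [← hmul, hpair, D.cyclic]
  symm := Φ.surjective.forall.2 fun f => Φ.surjective.forall.2 fun g => by
    simp only [hpair, D.symm f g]
  star_pair := Φ.surjective.forall.2 fun f => Φ.surjective.forall.2 fun g => by
    simp only [← hstar, hpair, D.star_pair]
  nondeg T hT := by
    have h0 := D.nondeg (dualPull τ τ' (Φ : 𝓢(E, ℂ) →L[ℂ] 𝓢(E', ℂ)) T) fun f g => by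
      rw [dual_dualPull, ContinuousLinearEquiv.coe_coe, hmul]
      exact hT _ _
    refine dual_ext (τ := τ') (Φ.surjective.forall.2 fun h => ?_)
    have := dual_dualPull (τ := τ) τ' (Φ : 𝓢(E, ℂ) →L[ℂ] 𝓢(E', ℂ)) T h
    rw [h0] at this
    exact this.symm

variable {Ψ : 𝓢'(E, ℂ) →L[ℂ] 𝓢'(E', ℂ)}

/-- The hypothesis on `Ψ` says that it is the transpose of `Φ⁻¹` for the two dualities. Membership
involves only the product, the pairing and the duality, all of which correspond. -/
theorem mem_moyal_transport
    (hmul : ∀ f g, Φ (m.mul f g) = m'.mul (Φ f) (Φ g))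
    (hpair : ∀ f g, pair τ' μ' (Φ f) (Φ g) = pair τ μ f g)
    (hΨ : ∀ T h, dual τ' (Ψ T) (Φ h) = dual τ T h) (T : 𝓢'(E, ℂ)) : Ψ T ∈ moyal m' τ' μ' ↔ T ∈ moyal m τ μ := by
  simp only [mem_moyal_iff, Φ.surjective.forall, Φ.surjective.exists, ← hmul, hpair, hΨ]

theorem bijective_transport (hΨ : ∀ T h, dual τ' (Ψ T) (Φ h) = dual τ T h) :
    Function.Bijective Ψ := by
  refine ⟨fun T U h => dual_ext (τ := τ) fun k => ?_, fun T => ?_⟩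
  · rw [← hΨ, h, hΨ]
  · refine ⟨dualPull τ τ' (Φ : 𝓢(E, ℂ) →L[ℂ] 𝓢(E', ℂ)) T,
      dual_ext (τ := τ') (Φ.surjective.forall.2 fun h => ?_)⟩
    rw [hΨ, dual_dualPull]
    rfl

theorem bijOn_transport
    (hmul : ∀ f g, Φ (m.mul f g) = m'.mul (Φ f) (Φ g))
    (hpair : ∀ f g, pair τ' μ' (Φ f) (Φ g) = pair τ μ f g)
    (hΨ : ∀ T h, dual τ' (Ψ T) (Φ h) = dual τ T h) :
    Set.BijOn Ψ (moyal m τ μ) (moyal m' τ' μ') := by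
  have hb := bijective_transport Φ hΨ
  refine ⟨fun T hT => (mem_moyal_transport Φ hmul hpair hΨ T).2 hT,
    hb.injective.injOn, fun T hT => ?_⟩
  obtain ⟨U, rfl⟩ := hb.surjective T
  exact ⟨U, (mem_moyal_transport Φ hmul hpair hΨ U).1 hT, rfl⟩

theorem isMoyalStarHom_transport
    (hmul : ∀ f g, Φ (m.mul f g) = m'.mul (Φ f) (Φ g))
    (hstar : ∀ f, Φ (starS τ f) = starS τ' (Φ f))
    (hpair : ∀ f g, pair τ' μ' (Φ f) (Φ g) = pair τ μ f g)
    (hΨ : ∀ T h, dual τ' (Ψ T) (Φ h) = dual τ T h) :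
    IsMoyalStarHom m τ μ m' τ' μ' Ψ where
  mapsTo T hT := (mem_moyal_transport Φ hmul hpair hΨ T).2 hT
  map_mul T hT U hU := by
    obtain ⟨L, hL⟩ := exists_left_of_mem hU
    obtain ⟨L', hL'⟩ := exists_left_of_mem ((mem_moyal_transport Φ hmul hpair hΨ U).2 hU)
    refine dual_ext (τ := τ') (Φ.surjective.forall.2 fun h => ?_)
    have : L' (Φ h) = Φ (L h) := pair_ext (τ := τ') (μ := μ')
      (Φ.surjective.forall.2 fun k => by rw [hL', hpair, hL, ← hmul, hΨ])
    rw [hΨ, dual_moyalMul hL, dual_moyalMul hL', this, hΨ]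
  map_star T hT := dual_ext (τ := τ') (Φ.surjective.forall.2 fun h => by
    rw [hΨ, dual_starD, dual_starD, ← hstar, hΨ])

end Transport
end MoyalAlgebra

/-! ### Schwartz kernels of operators from `𝓢'` to `𝓢` -/

section Kernel
variable {E : Type} [NormedAddCommGroup E] [NormedSpace ℝ E] [MeasurableSpace E] [BorelSpace E]
  [SecondCountableTopology E] [FiniteDimensional ℝ E]

/-- The functional `h ↦ ∫ f h dμ`. -/
noncomputable def intCLM (μ : Measure E) [μ.HasTemperateGrowth] (f : 𝓢(E, ℂ)) :
    𝓢(E, ℂ) →L[ℂ] ℂ := ⟨(toDist μ f).toLinearMap, (toDist μ f).continuous⟩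

theorem intCLM_apply (μ : Measure E) [μ.HasTemperateGrowth] (f g : 𝓢(E, ℂ)) :
    intCLM μ f g = ∫ y, f y * g y ∂μ := toDist_apply f g

theorem eq_of_integral_mul (μ : Measure E) [μ.IsAddHaarMeasure] {f g : 𝓢(E, ℂ)}
    (h : ∀ k : 𝓢(E, ℂ), ∫ x, f x * k x ∂μ = ∫ x, g x * k x ∂μ) : f = g := by
  refine toDist_injective μ ?_
  ext k
  rw [toDist_apply, toDist_apply, h]

variable {μ : Measure E} [μ.IsAddHaarMeasure] {A A' : 𝓢(E, ℂ) →L[ℂ] 𝓢(E, ℂ)}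

theorem summable_weight_mul {J : Type} {w : J → ℝ} {u : J → 𝓢(E, ℂ)} (hw : ∀ j, 1 ≤ w j)
    (hu : RapidDecay μ w u) (M : ℕ) (h : 𝓢(E, ℂ)) :
    ∃ C : ℝ, ∀ j, ‖((w j ^ M : ℝ) : ℂ) * ∫ y, u j y * h y ∂μ‖ ≤ C := by
  obtain ⟨C, hC⟩ := RapidDecay.scalar hu h M
  refine ⟨C, fun j => ?_⟩
  have := one_pos.trans_le (hw j)
  rw [norm_mul, Complex.norm_real, Real.norm_of_nonneg (by positivity)]
  exact hC j

theorem summable_lp_mul {J : Type} (a : lp (fun _ : J => ℂ) 1) {b : J → ℂ} {C : ℝ}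
    (hb : ∀ j, ‖b j‖ ≤ C) : Summable fun j => a j * b j := by
  have ha : Summable fun j => ‖a j‖ := by
    have := (lp.memℓp a).summable (by simp)
    simpa using this
  refine Summable.of_norm_bounded (ha.mul_right C) fun j => ?_
  rw [norm_mul]
  exact mul_le_mul_of_nonneg_left (hb j) (norm_nonneg _)

/-- The functional on `ℓ¹` given by a bounded sequence. -/
theorem exists_lp_functional {J : Type} {b : J → ℂ} {C : ℝ} (hb : ∀ j, ‖b j‖ ≤ C) :
    Continuous fun a : lp (fun _ : J => ℂ) 1 => ∑' j, a j * b j := by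
  let φ : lp (fun _ : J => ℂ) 1 →ₗ[ℂ] ℂ :=
    { toFun := fun a => ∑' j, a j * b j
      map_add' := fun a a' => by
        rw [← (summable_lp_mul a hb).tsum_add (summable_lp_mul a' hb)]
        congr 1
        funext j
        rw [lp.coeFn_add, Pi.add_apply, add_mul]
      map_smul' := fun c a => by
        rw [RingHom.id_apply, smul_eq_mul, ← tsum_mul_left]
        congr 1
        funext j
        rw [lp.coeFn_smul, Pi.smul_apply, smul_eq_mul, mul_assoc] }
  refine AddMonoidHomClass.continuous_of_bound φ C fun a => ?_
  have ha : HasSum (fun j => ‖a j‖) ‖a‖ := by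
    have := lp.hasSum_norm (p := 1) (by simp) a
    simpa using this
  refine (tsum_of_norm_bounded (ha.mul_left C) fun j => ?_)
  rw [norm_mul, mul_comm C]
  exact mul_le_mul_of_nonneg_left (hb j) (norm_nonneg _)

/-- The family `w j ^ M • u j` is weakly bounded, so every `a ∈ ℓ¹` gives a distribution `∑ a j w j
^ M u j`, which the extension of `A` sends into `𝓢`. The resulting map `ℓ¹ → 𝓢` is continuous, and
its values on unit vectors are the functions `w j ^ M • A (u j)`, which are therefore bounded in
every norm. -/
theorem RapidDecay.smoothing {J : Type} [Countable J] {w : J → ℝ} {u : J → 𝓢(E, ℂ)}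
    (hw : ∀ j, 1 ≤ w j) (hu : RapidDecay μ w u)
    (ht : ∀ u v : 𝓢(E, ℂ), ∫ x, u x * A v x ∂μ = ∫ x, v x * A' u x ∂μ)
    (hA : ∀ T : 𝓢'(E, ℂ), ∃ k : 𝓢(E, ℂ), ∀ h, ∫ x, k x * h x ∂μ = T (A' h)) (M N : ℕ) :
    ∃ C : ℝ, ∀ j, w j ^ M * schwartzNorm N (A (u j)) ≤ C := by
  classical
  have hT : ∀ a : lp (fun _ : J => ℂ) 1, ∃ T : 𝓢'(E, ℂ), ∀ h, HasSum (fun j =>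
      a j * (((w j ^ M : ℝ) : ℂ) * ∫ y, u j y * h y ∂μ)) (T h) := fun a => by
    obtain ⟨B, hB⟩ := exists_clm_of_hasSum
      (fun j => (a j * ((w j ^ M : ℝ) : ℂ)) • intCLM μ (u j)) fun h => by
        obtain ⟨C, hC⟩ := summable_weight_mul hw hu M h
        refine ⟨_, (summable_lp_mul a hC).hasSum.congr_fun fun j => ?_⟩
        rw [smul_apply, intCLM_apply, smul_eq_mul, mul_assoc]
    refine ⟨ContinuousLinearMap.toPointwiseConvergenceCLM _ _ _ _ B, fun h =>
      (hB h).congr_fun fun j => ?_⟩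
    rw [smul_apply, intCLM_apply, smul_eq_mul, mul_assoc]
  have hk : ∀ a : lp (fun _ : J => ℂ) 1, ∃ k : 𝓢(E, ℂ), ∀ h, HasSum (fun j =>
      a j * (((w j ^ M : ℝ) : ℂ) * ∫ y, u j y * A' h y ∂μ)) (∫ x, k x * h x ∂μ) := fun a => by
    obtain ⟨T, hT⟩ := hT a
    obtain ⟨k, hk⟩ := hA T
    exact ⟨k, fun h => by rw [hk]; exact hT _⟩
  choose k hk using hk
  let Φ : lp (fun _ : J => ℂ) 1 →ₗ[ℂ] 𝓢(E, ℂ) :=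
    { toFun := k
      map_add' := fun a a' => eq_of_integral_mul μ fun h => by
        refine (hk _ h).unique ?_
        have h2 := (hk a h).add (hk a' h)
        have : ∫ x, (k a + k a') x * h x ∂μ = ∫ x, k a x * h x ∂μ + ∫ x, k a' x * h x ∂μ := by
          simp only [← toDist_apply, map_add]
          rfl
        rw [this]
        refine h2.congr_fun fun j => ?_
        rw [lp.coeFn_add, Pi.add_apply, add_mul]
      map_smul' := fun c a => eq_of_integral_mul μ fun h => by
        refine (hk _ h).unique ?_
        have h2 := (hk a h).mul_left c
        have : ∫ x, (c • k a) x * h x ∂μ = c * ∫ x, k a x * h x ∂μ := by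
          simp only [← toDist_apply, map_smul]
          rfl
        rw [RingHom.id_apply, this]
        refine h2.congr_fun fun j => ?_
        rw [lp.coeFn_smul, Pi.smul_apply, smul_eq_mul, mul_assoc] }
  have hΦ : Continuous Φ := continuous_of_pairing μ Φ fun h => by
    obtain ⟨C, hC⟩ := summable_weight_mul hw hu M (A' h)
    refine (exists_lp_functional hC).congr fun a => ?_
    rw [(hk a h).tsum_eq]
    congr 1
    funext x
    exact mul_comm _ _
  have hb : Continuous fun a => schwartzNorm N (Φ a) := (continuous_schwartzNorm N).comp hΦ
  obtain ⟨C, hC, hb⟩ := Seminorm.bound_of_continuous_normedSpace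
    ((schwartzNorm N).comp Φ) hb
  refine ⟨C, fun j => ?_⟩
  have e : Φ (lp.single 1 j (1 : ℂ)) = ((w j ^ M : ℝ) : ℂ) • A (u j) :=
    eq_of_integral_mul μ fun h => by
      refine (hk _ h).unique ?_
      have : ∫ x, (((w j ^ M : ℝ) : ℂ) • A (u j)) x * h x ∂μ =
          ((w j ^ M : ℝ) : ℂ) * ∫ y, u j y * A' h y ∂μ := by
        rw [← ht, ← integral_const_mul]
        congr 1
        funext x
        rw [smul_apply, smul_eq_mul]
        ring
      rw [this]
      have h1 := hasSum_single (f := fun i => (lp.single 1 j (1 : ℂ) : lp (fun _ : J => ℂ) 1) i *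
        (((w i ^ M : ℝ) : ℂ) * ∫ y, u i y * A' h y ∂μ)) j fun i hi => by
          rw [lp.single_apply_ne _ _ _ hi, zero_mul]
      rwa [lp.single_apply_self, one_mul] at h1
  have h1 := hb (lp.single 1 j (1 : ℂ))
  rw [Seminorm.comp_apply, e, map_smul_eq_mul, lp.norm_single (by simp), norm_one, mul_one,
    Complex.norm_real, Real.norm_of_nonneg (pow_nonneg (zero_le_one.trans (hw j)) _)] at h1
  exact h1

/-- An operator on the Schwartz space that extends to a map `𝓢' → 𝓢` has a Schwartz kernel. -/
theorem exists_kernel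
    (ht : ∀ u v : 𝓢(E, ℂ), ∫ x, u x * A v x ∂μ = ∫ x, v x * A' u x ∂μ)
    (hA : ∀ T : 𝓢'(E, ℂ), ∃ k : 𝓢(E, ℂ), ∀ h, ∫ x, k x * h x ∂μ = T (A' h)) :
    ∃ K : 𝓢(E × E, ℂ), ∀ v, contract μ v K = A v := by
  -- Applying `A` to `v = ∑ ⟨c j, v⟩ e j` shows that the kernel must be `∑ A(e j) ⊗ c j`.
  obtain ⟨S⟩ := nonempty_gaborSystem μ
  have := S.countable
  obtain ⟨K, hK, -⟩ := schwartz_hasSum_of_norm (fun j => tensor (A (S.e j)) (S.c j)) fun N => by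
    obtain ⟨C, hC, h⟩ := exists_tensor_norm_le (V := E) (E := E) N
    refine Summable.of_nonneg_of_le (fun _ => apply_nonneg _ _) (fun j => h _ _)
      (Summable.mul_left C ?_)
    exact summable_of_growth_decay S.one_le S.summable (fun _ => apply_nonneg _ _)
      (fun _ => apply_nonneg _ _) (S.c_growth N)
      (fun M => RapidDecay.smoothing S.one_le S.e_decay ht hA M N)
  refine ⟨K, fun v => (hK.mapL (contract μ v)).unique ?_⟩
  refine ((S.hasSum_smul v).mapL A).congr_fun fun j => ?_
  rw [contract_tensor, map_smul]
  congr 2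
  funext y
  exact mul_comm _ _

end Kernel

/-! ### Invariance of Haar measure under linear involutions -/

section Involution
variable {E : Type} [NormedAddCommGroup E] [NormedSpace ℝ E] [MeasurableSpace E] [BorelSpace E]
  [FiniteDimensional ℝ E]

/-- A linear involution preserves Haar measure. -/
theorem integral_comp_involution (μ : Measure E) [μ.IsAddHaarMeasure] (τ : E ≃L[ℝ] E)
    (hτ : ∀ x, τ (τ x) = x) (f : E → ℂ) : ∫ x, f (τ x) ∂μ = ∫ x, f x ∂μ := by
  obtain ⟨κ, hκ, h⟩ := exists_integral_comp_equiv τ μ μ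
  have h0 : ∀ f : E → ℂ, ∫ x, f x ∂μ = (κ : ℂ) * ∫ x, f (τ x) ∂μ := h
  by_cases h1 : κ = 1
  · rw [h0 f, h1]; simp
  -- Two applications of the involution give `∫ f = κ² ∫ f`. If the positive number `κ` is not 1,
  -- every integral vanishes and the claim is trivial, so no test function is needed to exclude this
  -- case.
  have h2 : ∀ f : E → ℂ, ∫ x, f x ∂μ = 0 := fun f => by
    have e := h0 (fun x => f (τ x))
    simp only [hτ] at e
    have e2 := h0 f
    rw [e] at e2
    have e3 : (1 - (κ : ℂ) * κ) * ∫ x, f x ∂μ = 0 := by linear_combination e2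
    refine (mul_eq_zero.1 e3).resolve_left fun h3 => h1 ?_
    have h4 : (κ * κ : ℝ) = 1 := by exact_mod_cast (sub_eq_zero.1 h3).symm
    nlinarith
  rw [h2, h2]

end Involution

/-! ### The symplectic Fourier transformation -/

section Fourier
open FourierTransform
variable {n : ℕ}

theorem symplecticFourier_eq (f : 𝓢(Phase n, ℂ)) (Y : Phase n) :
    symplecticFourier n f Y = (((2 * Real.pi)⁻¹ ^ n : ℝ) : ℂ) *
      𝓕 (SchwartzMap.compCLMOfContinuousLinearEquiv ℂ (WithLp.prodContinuousLinearEquiv 2 ℝ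
        (EuclideanSpace ℝ (Fin n)) (EuclideanSpace ℝ (Fin n))) f) (fourierVar n Y) := rfl

/-- Scaling by `(2π)⁻¹` in dimension `2n` produces `(2π)²ⁿ`, which cancels the explicit constant
against the one in the Haar measure. The swap and the reflection are involutions, hence preserve the
measure. -/
theorem integral_fourierVar (F : WithLp 2 (EuclideanSpace ℝ (Fin n) × EuclideanSpace ℝ (Fin n)) → ℂ) :
    ∫ v, F v = (((2 * Real.pi)⁻¹ ^ n : ℝ) : ℂ) * ∫ X, F (fourierVar n X) ∂(haar n) := by
  have hH : (volume : Measure (Phase n)).IsAddHaarMeasure :=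
    Measure.prod.instIsAddHaarMeasure volume volume
  have h1 : ∫ v, F v = ∫ z : Phase n, F (WithLp.toLp 2 z) :=
    ((WithLp.volume_preserving_toLp (EuclideanSpace ℝ (Fin n))
      (EuclideanSpace ℝ (Fin n))).integral_comp (MeasurableEquiv.toLp 2 _).measurableEmbedding F).symm
  have h2 := Measure.integral_comp_smul (volume : Measure (Phase n))
    (fun z => F (WithLp.toLp 2 z)) (2 * Real.pi)⁻¹
  have h3 := integral_comp_involution (volume : Measure (Phase n))
    ((ContinuousLinearEquiv.refl ℝ _).prodCongr (ContinuousLinearEquiv.neg ℝ)) (fun x => by simp)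
    (fun z => F (WithLp.toLp 2 ((2 * Real.pi)⁻¹ • z)))
  have h4 := integral_comp_involution (volume : Measure (Phase n))
    (ContinuousLinearEquiv.prodComm ℝ _ _) (fun x => by simp)
    (fun z => F (WithLp.toLp 2 ((2 * Real.pi)⁻¹ •
      ((ContinuousLinearEquiv.refl ℝ _).prodCongr (ContinuousLinearEquiv.neg ℝ)) z)))
  have h5 : ∫ X : Phase n, F (fourierVar n X) = ∫ z : Phase n, F (WithLp.toLp 2 ((2 * Real.pi)⁻¹ • z)) :=
    h4.trans h3
  have hpi : (Real.pi : ℝ) ≠ 0 := Real.pi_ne_zero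
  have hd : Module.finrank ℝ (Phase n) = n + n := by simp
  rw [integral_haar, h5, h2, h1, hd, Complex.real_smul, ← mul_assoc, ← mul_assoc,
    ← Complex.ofReal_mul, ← Complex.ofReal_mul, abs_of_pos (by positivity), pow_add, mul_inv,
    mul_inv_cancel₀]
  · simp
  · positivity

theorem inner_fourierVar (X Y : Phase n) :
    2 * Real.pi * inner ℝ (fourierVar n X) (WithLp.toLp 2 Y) = -sigma Y X := by
  have hv : fourierVar n X = WithLp.toLp 2 ((2 * Real.pi)⁻¹ • X.2, (2 * Real.pi)⁻¹ • (-X.1)) := rfl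
  have hpi : (Real.pi : ℝ) ≠ 0 := Real.pi_ne_zero
  rw [hv]
  simp only [WithLp.prod_inner_apply, inner_smul_left, inner_neg_left, sigma]
  rw [real_inner_comm Y.1 X.2]
  simp
  field_simp
  ring

/-- The symplectic Fourier transformation is an involution. -/
theorem symplecticFourier_symplecticFourier (f : 𝓢(Phase n, ℂ)) :
    symplecticFourier n (symplecticFourier n f) = f := by
  ext Y
  let g := SchwartzMap.compCLMOfContinuousLinearEquiv ℂ (WithLp.prodContinuousLinearEquiv 2 ℝ
        (EuclideanSpace ℝ (Fin n)) (EuclideanSpace ℝ (Fin n))) f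
  have h1 : f Y = (𝓕⁻ (𝓕 g)) (WithLp.toLp 2 Y) := by
    rw [fourierInv_fourier_eq]
    rfl
  rw [h1, SchwartzMap.fourierInv_coe, Real.fourierInv_eq', integral_fourierVar,
    symplecticFourier_apply, ← integral_const_mul]
  congr 1
  funext Z
  rw [symplecticFourier_eq, smul_eq_mul, inner_fourierVar]
  push_cast
  rw [mul_left_comm, mul_comm (-(sigma Y Z : ℂ)), mul_neg]

/-- The symplectic Fourier transformation composed with the reflection. -/
noncomputable def reflFourier (n : ℕ) : 𝓢(Phase n, ℂ) →L[ℂ] 𝓢(Phase n, ℂ) :=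
  (comp (ContinuousLinearEquiv.neg ℝ)).comp (symplecticFourier n)

theorem reflFourier_apply (f : 𝓢(Phase n, ℂ)) (X : Phase n) :
    reflFourier n f X = symplecticFourier n f (-X) := rfl

theorem integral_symplecticFourier_mul (f g : 𝓢(Phase n, ℂ)) :
    ∫ X, symplecticFourier n f X * g X ∂(haar n) = ∫ X, f X * reflFourier n g X ∂(haar n) := by
  have hf := f.integrable (μ := haar n)
  have hg := g.integrable (μ := haar n)
  have hs : Continuous fun z : Phase n × Phase n => sigma z.1 z.2 := by
    unfold sigma
    fun_prop
  have hi : Integrable (Function.uncurry fun X Z =>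
      Complex.exp (-(Complex.I * sigma X Z)) * f Z * g X) ((haar n).prod (haar n)) := by
    refine (hg.mul_prod hf).mono (Continuous.aestronglyMeasurable ?_)
      (Filter.Eventually.of_forall fun z => ?_)
    · have h1 := f.continuous
      have h2 := g.continuous
      unfold Function.uncurry
      fun_prop
    · rw [Function.uncurry, norm_mul, norm_mul, norm_mul,
        show -(Complex.I * (sigma z.1 z.2 : ℂ)) = ((-sigma z.1 z.2 : ℝ) : ℂ) * Complex.I by
          push_cast; ring, Complex.norm_exp_ofReal_mul_I, one_mul, mul_comm]
  simp only [symplecticFourier_apply, reflFourier_apply, ← integral_const_mul, ← integral_mul_const]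
  rw [integral_integral_swap hi]
  congr 1
  funext X
  congr 1
  funext Z
  rw [show sigma (-X) Z = sigma Z X by simp [sigma]; ring]
  ring

theorem integral_neg_phase (f : Phase n → ℂ) : ∫ X, f (-X) ∂(haar n) = ∫ X, f X ∂(haar n) :=
  integral_comp_involution (haar n) (ContinuousLinearEquiv.neg ℝ) (fun x => neg_neg x) f

theorem symplecticFourier_comp_neg (f : 𝓢(Phase n, ℂ)) (X : Phase n) :
    symplecticFourier n (reflFourier n f) X = symplecticFourier n (symplecticFourier n f) (-X) := by
  rw [symplecticFourier_apply, symplecticFourier_apply, ← integral_neg_phase]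
  congr 1
  funext Z
  rw [reflFourier_apply, neg_neg]
  congr 2
  simp [sigma]
  
/-- Parseval's formula in bilinear form: the reflection takes the place of complex conjugation. -/
theorem integral_symplecticFourier_mul_neg (f g : 𝓢(Phase n, ℂ)) :
    ∫ X, symplecticFourier n f X * symplecticFourier n g (-X) ∂(haar n) =
      ∫ X, f X * g X ∂(haar n) := by
  have h := integral_symplecticFourier_mul f (reflFourier n g)
  have e : reflFourier n (reflFourier n g) = g := by
    ext X
    rw [reflFourier_apply, symplecticFourier_comp_neg, neg_neg]
    exact congrArg (fun f : 𝓢(Phase n, ℂ) => f X) (symplecticFourier_symplecticFourier g)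
  rw [e] at h
  exact h

theorem symplecticFourier_conj (f : 𝓢(Phase n, ℂ)) (X : Phase n) :
    symplecticFourier n (conjS f) X = starRingEnd ℂ (symplecticFourier n f (-X)) := by
  rw [symplecticFourier_apply, symplecticFourier_apply, ← integral_conj]
  congr 1
  funext Z
  rw [conjS_apply, map_mul, ← Complex.exp_conj]
  congr 2
  simp [sigma]
  ring

end Fourier

/-! ### Tensor products of operators, flips and conjugation -/

section TensorMap
variable {V E V' E' V'' E'' : Type} [NormedAddCommGroup V] [NormedSpace ℝ V]
  [NormedAddCommGroup E] [NormedSpace ℝ E] [FiniteDimensional ℝ E]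
  [NormedAddCommGroup V'] [NormedSpace ℝ V']
  [NormedAddCommGroup E'] [NormedSpace ℝ E'] [FiniteDimensional ℝ E']
  [NormedAddCommGroup V''] [NormedSpace ℝ V'']
  [NormedAddCommGroup E''] [NormedSpace ℝ E'']

theorem tensor_add_left (f f' : 𝓢(V, ℂ)) (g : 𝓢(E, ℂ)) :
    tensor (f + f') g = tensor f g + tensor f' g := by
  ext z; simp [add_mul]

theorem tensor_smul_left (c : ℂ) (f : 𝓢(V, ℂ)) (g : 𝓢(E, ℂ)) :
    tensor (c • f) g = c • tensor f g := by
  ext z; simp [mul_assoc]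

theorem tensor_add_right (f : 𝓢(V, ℂ)) (g g' : 𝓢(E, ℂ)) :
    tensor f (g + g') = tensor f g + tensor f g' := map_add (tensorCLM f) g g'

theorem tensor_smul_right (c : ℂ) (f : 𝓢(V, ℂ)) (g : 𝓢(E, ℂ)) :
    tensor f (c • g) = c • tensor f g := map_smul (tensorCLM f) c g

theorem exists_tensorMap (A : 𝓢(V, ℂ) →L[ℂ] 𝓢(V', ℂ)) (B : 𝓢(E, ℂ) →L[ℂ] 𝓢(E', ℂ)) :
    ∃ D : 𝓢(V × E, ℂ) →L[ℂ] 𝓢(V' × E', ℂ), ∀ f g, D (tensor f g) = tensor (A f) (B g) :=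
  exists_lift (LinearMap.mk₂ ℂ (fun f g => tensor (A f) (B g))
    (fun f f' g => by rw [map_add, tensor_add_left]) (fun c f g => by rw [map_smul, tensor_smul_left])
    (fun f g g' => by rw [map_add, tensor_add_right])
    (fun c f g => by rw [map_smul, tensor_smul_right]))
    (fun f => (continuous_tensor_right (A f)).comp B.continuous)
    (fun g => (continuous_tensor_left (B g)).comp A.continuous)

/-- The tensor product `A ⊗ B` of continuous linear maps of Schwartz spaces. -/
noncomputable def tensorMap (A : 𝓢(V, ℂ) →L[ℂ] 𝓢(V', ℂ)) (B : 𝓢(E, ℂ) →L[ℂ] 𝓢(E', ℂ)) :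
    𝓢(V × E, ℂ) →L[ℂ] 𝓢(V' × E', ℂ) := (exists_tensorMap A B).choose

@[simp]
theorem tensorMap_tensor (A : 𝓢(V, ℂ) →L[ℂ] 𝓢(V', ℂ)) (B : 𝓢(E, ℂ) →L[ℂ] 𝓢(E', ℂ))
    (f : 𝓢(V, ℂ)) (g : 𝓢(E, ℂ)) : tensorMap A B (tensor f g) = tensor (A f) (B g) :=
  (exists_tensorMap A B).choose_spec f g

theorem tensorMap_tensorMap_cancel (A : 𝓢(V, ℂ) →L[ℂ] 𝓢(V', ℂ)) (B : 𝓢(E, ℂ) →L[ℂ] 𝓢(E', ℂ))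
    (A' : 𝓢(V', ℂ) →L[ℂ] 𝓢(V, ℂ)) (B' : 𝓢(E', ℂ) →L[ℂ] 𝓢(E, ℂ)) (hA : ∀ f, A' (A f) = f)
    (hB : ∀ f, B' (B f) = f) (F : 𝓢(V × E, ℂ)) : tensorMap A' B' (tensorMap A B F) = F :=
  eq_of_tensor ((tensorMap A' B').comp (tensorMap A B)) (ContinuousLinearMap.id ℂ _)
    (fun f g => by simp [hA, hB]) F

/-- The flip `F ↦ ((x, y) ↦ F (y, x))`. -/
noncomputable def flipS : 𝓢(V × E, ℂ) →L[ℂ] 𝓢(E × V, ℂ) :=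
  SchwartzMap.compCLMOfContinuousLinearEquiv ℂ (ContinuousLinearEquiv.prodComm ℝ E V)

theorem flipS_apply (F : 𝓢(V × E, ℂ)) (x : E) (y : V) : flipS F (x, y) = F (y, x) := rfl

theorem flipS_flipS (F : 𝓢(V × E, ℂ)) : flipS (flipS F) = F := rfl

@[simp]
theorem flipS_tensor (f : 𝓢(V, ℂ)) (g : 𝓢(E, ℂ)) : flipS (tensor f g) = tensor g f := by
  ext ⟨x, y⟩
  rw [flipS_apply, tensor_apply, tensor_apply, mul_comm]

theorem conjS_conjS (f : 𝓢(V, ℂ)) : conjS (conjS f) = f := by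
  ext x
  rw [conjS_apply, conjS_apply, Complex.conj_conj]

theorem conjS_tensor (f : 𝓢(V, ℂ)) (g : 𝓢(E, ℂ)) :
    conjS (tensor f g) = tensor (conjS f) (conjS g) := by
  ext z
  rw [conjS_apply, tensor_apply, map_mul]
  rfl

theorem contract_conjS [MeasurableSpace E] [BorelSpace E] [SecondCountableTopology E]
    (μ : Measure E) [μ.HasTemperateGrowth] (u : 𝓢(E, ℂ)) (K : 𝓢(V × E, ℂ)) :
    contract μ u (conjS K) = conjS (contract μ (conjS u) K) := by
  ext X
  rw [conjS_apply, contract_apply, contract_apply, ← integral_conj]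
  congr 1
  funext Y
  rw [map_mul, conjS_apply, conjS_apply, Complex.conj_conj]

end TensorMap

/-! ### Integral operators with Schwartz kernels -/

section Contract
variable {V E : Type} [NormedAddCommGroup V] [NormedSpace ℝ V] [MeasurableSpace V] [BorelSpace V]
  [SecondCountableTopology V] [FiniteDimensional ℝ V]
  [NormedAddCommGroup E] [NormedSpace ℝ E] [MeasurableSpace E] [BorelSpace E]
  [SecondCountableTopology E] [FiniteDimensional ℝ E]
  {ν : Measure V} [ν.IsAddHaarMeasure] {μ : Measure E} [μ.IsAddHaarMeasure]

theorem integral_mul_contract (u : 𝓢(V, ℂ)) (h : 𝓢(E, ℂ)) (K : 𝓢(V × E, ℂ)) :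
    ∫ x, u x * contract μ h K x ∂ν = ∫ y, h y * contract ν u (flipS K) y ∂μ := by
  rw [← integral_tensor_mul, ← integral_tensor_mul, ← integral_prod_swap]
  congr 1
  funext z
  rw [tensor_apply, tensor_apply, mul_comm (h z.1)]
  rfl

theorem eq_of_contract {W : Type} [NormedAddCommGroup W] [NormedSpace ℝ W]
    {K K' : 𝓢(W × E, ℂ)} (h : ∀ k, contract μ k K = contract μ k K') : K = K' := by
  ext ⟨v, y⟩
  have : slice v K = slice v K' := eq_of_integral_mul μ fun k => by
    have := congrArg (fun f : 𝓢(W, ℂ) => f v) (h k)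
    simp only [contract_apply] at this
    simpa only [slice_apply, mul_comm] using! this
  exact congrArg (fun f : 𝓢(E, ℂ) => f y) this

theorem contract_add_left (h h' : 𝓢(E, ℂ)) (K : 𝓢(V × E, ℂ)) :
    contract μ (h + h') K = contract μ h K + contract μ h' K := by
  ext v
  rw [add_apply, contract_apply, contract_apply, contract_apply,
    ← integral_add (contract_integrable μ h K v) (contract_integrable μ h' K v)]
  congr 1
  funext y
  rw [add_apply, add_mul]

/-- The integral operator `h ↦ (x ↦ ∫ h(y) K(x, y) dμ(y))` with kernel `K`. -/
noncomputable def kernelOp (ν : Measure V) [ν.IsAddHaarMeasure] (μ : Measure E)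
    [μ.IsAddHaarMeasure] (K : 𝓢(V × E, ℂ)) : 𝓢(E, ℂ) →L[ℂ] 𝓢(V, ℂ) :=
  ⟨{ toFun := fun h => contract μ h K
     map_add' := fun h h' => contract_add_left h h' K
     map_smul' := fun c h => contract_smul_left μ c h K }, by
    refine continuous_of_pairing ν _ fun k => ?_
    refine (intCLM μ (contract ν k (flipS K))).continuous.congr fun h => ?_
    rw [intCLM_apply]
    refine Eq.trans ?_ (integral_mul_contract k h K).symm
    simp only [mul_comm]⟩

end Contract

/-! ### From composition of kernels to the crossed product -/

section CrossedProduct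
variable {n : ℕ}

theorem reflFourier_reflFourier (f : 𝓢(Phase n, ℂ)) : reflFourier n (reflFourier n f) = f := by
  ext X
  rw [reflFourier_apply, symplecticFourier_comp_neg, neg_neg]
  exact congrArg (fun f : 𝓢(Phase n, ℂ) => f X) (symplecticFourier_symplecticFourier f)

/-- The map `a ⊗ b ↦ ((X, Y) ↦ (𝔉 a)(X) (𝔉 b)(Y - X))` that turns the composition of kernels into
the crossed product. -/
noncomputable def kernelToCrossed (n : ℕ) :
    𝓢(Phase n × Phase n, ℂ) ≃L[ℂ] 𝓢(Phase n × Phase n, ℂ) :=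
  ContinuousLinearEquiv.equivOfInverse
    ((comp (modVar n)).comp (tensorMap (reflFourier n) (reflFourier n)))
    ((tensorMap (reflFourier n) (reflFourier n)).comp (comp (modVar n).symm))
    (fun F => by
      change tensorMap (reflFourier n) (reflFourier n) (comp (modVar n).symm (comp (modVar n)
        (tensorMap (reflFourier n) (reflFourier n) F))) = F
      rw [comp_symm_comp, tensorMap_tensorMap_cancel] <;> exact reflFourier_reflFourier)
    (fun F => by
      change comp (modVar n) (tensorMap (reflFourier n) (reflFourier n)
        (tensorMap (reflFourier n) (reflFourier n) (comp (modVar n).symm F))) = F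
      rw [tensorMap_tensorMap_cancel, comp_comp_symm] <;> exact reflFourier_reflFourier)

theorem kernelToCrossed_tensor (a b : 𝓢(Phase n, ℂ)) (X Y : Phase n) :
    kernelToCrossed n (tensor a b) (X, Y) =
      symplecticFourier n a X * symplecticFourier n b (Y - X) := by
  change tensorMap (reflFourier n) (reflFourier n) (tensor a b) (-X, X - Y) = _
  rw [tensorMap_tensor, tensor_apply, reflFourier_apply, reflFourier_apply, neg_neg, neg_sub]

/-- This is the rule `(a ⊗ b)(c ⊗ d) = ⟨b, c⟩ a ⊗ d` for operators of rank at most one: after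
translation by `X` the inner integral is `∫ (𝔉 b)(Z) (𝔉 c)(-Z) dZ`, and Parseval's formula applies.
-/
theorem diamond_kernelToCrossed (a b c d : 𝓢(Phase n, ℂ)) :
    (diamond n).mul (kernelToCrossed n (tensor a b)) (kernelToCrossed n (tensor c d)) =
      (∫ X, b X * c X ∂(haar n)) • kernelToCrossed n (tensor a d) := by
  ext ⟨X, Y⟩
  rw [diamond_apply, smul_apply, kernelToCrossed_tensor, ← integral_symplecticFourier_mul_neg,
    smul_eq_mul, ← integral_mul_const,
    ← integral_sub_right_eq_self (μ := haar n) (fun Z => symplecticFourier n b Z *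
      symplecticFourier n c (-Z) * _) X]
  congr 1
  funext Z
  rw [kernelToCrossed_tensor, kernelToCrossed_tensor, neg_sub, sub_sub_sub_cancel_right]
  ring

/-- The composition of kernels, transported to the crossed product. -/
theorem contract_crossed (k : 𝓢(Phase n, ℂ)) (K L : 𝓢(Phase n × Phase n, ℂ)) :
    contract (haar n) k ((kernelToCrossed n).symm
      ((diamond n).mul (kernelToCrossed n K) (kernelToCrossed n L))) =
        contract (haar n) (contract (haar n) k L) K := by
  refine eq_of_tensor ((contract (haar n) k).comp
    (((kernelToCrossed n).symm : 𝓢(Phase n × Phase n, ℂ) →L[ℂ] 𝓢(Phase n × Phase n, ℂ)).comp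
    (((diamond n).L (kernelToCrossed n K)).comp
      (kernelToCrossed n : 𝓢(Phase n × Phase n, ℂ) →L[ℂ] 𝓢(Phase n × Phase n, ℂ)))))
    ((kernelOp (haar n) (haar n) K).comp (contract (haar n) k)) (fun c d => ?_) L
  refine eq_of_tensor ((contract (haar n) k).comp
    (((kernelToCrossed n).symm : 𝓢(Phase n × Phase n, ℂ) →L[ℂ] 𝓢(Phase n × Phase n, ℂ)).comp
    (((diamond n).R (kernelToCrossed n (tensor c d))).comp
      (kernelToCrossed n : 𝓢(Phase n × Phase n, ℂ) →L[ℂ] 𝓢(Phase n × Phase n, ℂ)))))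
    (contract (haar n) (contract (haar n) k (tensor c d))) (fun a b => ?_) K
  change contract (haar n) k ((kernelToCrossed n).symm
      ((diamond n).mul (kernelToCrossed n (tensor a b)) (kernelToCrossed n (tensor c d)))) = _
  rw [diamond_kernelToCrossed, map_smul, ContinuousLinearEquiv.symm_apply_apply, map_smul,
    contract_tensor (haar n) k d c, contract_smul_left, contract_tensor, contract_tensor, smul_comm]
  simp only [mul_comm]

/-- The conjugate transposed kernel corresponds to the involution of the crossed product. -/
theorem starS_kernelToCrossed (K : 𝓢(Phase n × Phase n, ℂ)) :
    starS (tDiamond n) (kernelToCrossed n K) = kernelToCrossed n (conjS (flipS K)) := by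
  let Φ : 𝓢(Phase n × Phase n, ℂ) →+ 𝓢(Phase n × Phase n, ℂ) :=
    (conjS : 𝓢(Phase n × Phase n, ℂ) →L[ℝ] 𝓢(Phase n × Phase n, ℂ)).toLinearMap.toAddMonoidHom
  have h := addMonoidHom_tensor_ext
    (φ := Φ.comp ((comp (tDiamond n)).toLinearMap.toAddMonoidHom.comp
      (kernelToCrossed n).toLinearMap.toAddMonoidHom))
    (ψ := (kernelToCrossed n).toLinearMap.toAddMonoidHom.comp
      (Φ.comp flipS.toLinearMap.toAddMonoidHom))
    (conjS.continuous.comp ((comp (tDiamond n)).continuous.comp (kernelToCrossed n).continuous))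
    ((kernelToCrossed n).continuous.comp (conjS.continuous.comp flipS.continuous))
    fun a b => by
      change starS (tDiamond n) (kernelToCrossed n (tensor a b)) =
        kernelToCrossed n (conjS (flipS (tensor a b)))
      have : conjS (flipS (tensor a b)) = tensor (conjS b) (conjS a) := by
        rw [flipS_tensor, conjS_tensor]
      ext ⟨X, Y⟩
      rw [this, kernelToCrossed_tensor, starS_apply, tDiamond_apply, kernelToCrossed_tensor,
        symplecticFourier_conj, symplecticFourier_conj, map_mul, mul_comm]
      congr 3 <;> abel
  exact DFunLike.congr_fun h K

/-- The functional `F ↦ ∫ F(X, 0) dX` plays the part of the trace, and the duality of `⋄` is the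
trace of the product. -/
theorem integral_diamond (F G : 𝓢(Phase n × Phase n, ℂ)) :
    ∫ X, (diamond n).mul F G (X, 0) ∂(haar n) = pair (tDiamond n) (haar2 n) F G := by
  rw [pair_eq, haar2, integral_prod]
  · congr 1
    funext X
    rw [diamond_apply]
    simp only [zero_sub]
    rfl
  · have := (SchwartzMap.smulLeftCLM ℂ F (comp (tDiamond n) G)).integrable (μ := haar2 n)
    simpa [SchwartzMap.smulLeftCLM_apply F.hasTemperateGrowth] using! this

end CrossedProduct

/-! ### The kernel map `κ` and the law `□` -/

section CompositionLaws
variable {n : ℕ} {P : CompositionLaw (Phase n)}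

theorem dual_tId (T : 𝓢'(Phase n, ℂ)) (h : 𝓢(Phase n, ℂ)) : dual (tId n) T h = T h := rfl

theorem HypothesisB.exists_sandwich (hB : HypothesisB P) (f g : 𝓢(Phase n, ℂ)) (T : 𝓢'(Phase n, ℂ)) :
    ∃ k : 𝓢(Phase n, ℂ), ∀ h, ∫ X, k X * h X ∂(haar n) = T (P.mul (P.mul g h) f) := by
  obtain ⟨k, hk⟩ := hB f g T
  refine ⟨k, fun h => ?_⟩
  rw [← toDist_apply, hk, ← dual_tId, dual_mulDS, dual_mulSD, dual_tId]

namespace HypothesisA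
variable (hA : HypothesisA P)
include hA

theorem integral_mul_left (f g h : 𝓢(Phase n, ℂ)) :
    ∫ X, P.mul f g X * h X ∂(haar n) = ∫ X, f X * P.mul g h X ∂(haar n) := by
  rw [← hA.integral_mul, ← hA.integral_mul, hA.assoc]

theorem integral_mul_right (f g h : 𝓢(Phase n, ℂ)) :
    ∫ X, P.mul f g X * h X ∂(haar n) = ∫ X, g X * P.mul h f X ∂(haar n) := by
  have := hA.integral_mul_left h f g
  simp only [mul_comm] at this ⊢
  exact this.symm

/-- By cyclicity, the transpose of `k ↦ f # k # g` is `h ↦ g # h # f`. -/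
theorem integral_sandwich (f g h k : 𝓢(Phase n, ℂ)) :
    ∫ X, h X * P.mul (P.mul f k) g X ∂(haar n) = ∫ X, k X * P.mul (P.mul g h) f X ∂(haar n) := by
  rw [← hA.integral_mul_right]
  simp only [mul_comm (P.mul g h _)]
  rw [hA.integral_mul_right]

variable (hB : HypothesisB P)
include hB

theorem exists_kernel_sandwich (f g : 𝓢(Phase n, ℂ)) : ∃ K : 𝓢(Phase n × Phase n, ℂ),
    ∀ k, contract (haar n) k K = P.mul (P.mul f k) g :=
  exists_kernel (A := (P.R g).comp (P.L f)) (A' := (P.R f).comp (P.L g))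
    (fun h k => hA.integral_sandwich f g h k) (hB.exists_sandwich f g)

/-- A kernel is determined by its operator, so it is bilinear in `(f, g)`. Its contractions `f # k #
g` are separately continuous in `f` and `g`, hence so is the kernel, and the kernel theorem lifts
the bilinear map. -/
theorem exists_kernelMap : ∃ κ : 𝓢(Phase n × Phase n, ℂ) →L[ℂ] 𝓢(Phase n × Phase n, ℂ),
    ∀ f g k, contract (haar n) k (κ (tensor f g)) = P.mul (P.mul f k) g := by
  choose κ hκ using hA.exists_kernel_sandwich hB
  let b : 𝓢(Phase n, ℂ) →ₗ[ℂ] 𝓢(Phase n, ℂ) →ₗ[ℂ] 𝓢(Phase n × Phase n, ℂ) :=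
    LinearMap.mk₂ ℂ κ
      (fun f f' g => eq_of_contract (μ := haar n) fun k => by simp only [map_add, hκ, LinearMap.add_apply])
      (fun c f g => eq_of_contract (μ := haar n) fun k => by simp only [map_smul, hκ, LinearMap.smul_apply])
      (fun f g g' => eq_of_contract (μ := haar n) fun k => by simp only [map_add, hκ])
      (fun c f g => eq_of_contract (μ := haar n) fun k => by simp only [map_smul, hκ])
  obtain ⟨S⟩ := nonempty_gaborSystem (haar n)
  have := S.countable
  have : ((haar n).prod (haar n)).HasTemperateGrowth :=
    inferInstanceAs (haar2 n).HasTemperateGrowth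
  -- pairing with a Schwartz function is a limit of continuous functionals
  have key : ∀ (A : 𝓢(Phase n, ℂ) →ₗ[ℂ] 𝓢(Phase n × Phase n, ℂ)),
      (∀ k, Continuous fun f => contract (haar n) k (A f)) → Continuous A := fun A hc =>
    continuous_of_pairing (haar2 n) A fun G => by
      have h1 : ∀ f, HasSum (fun j => ∫ x, contract (haar n) (S.c j) G x *
          contract (haar n) (S.e j) (A f) x ∂(haar n)) (∫ z, G z * A f z ∂(haar2 n)) := fun f => by
        have := (S.hasSum_tensor G).mapL (intCLM (haar2 n) (A f))
        simp only [intCLM_apply] at this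
        simp only [mul_comm (A f _)] at this
        refine this.congr_fun fun j => ?_
        exact (integral_tensor_mul (haar n) (haar n) _ _ _).symm
      obtain ⟨D, hD⟩ := exists_clm_of_hasSum (fun j =>
        (intCLM (haar n) (contract (haar n) (S.c j) G)).comp
          (⟨(contract (haar n) (S.e j)).toLinearMap.comp A, hc (S.e j)⟩ :
            𝓢(Phase n, ℂ) →L[ℂ] 𝓢(Phase n, ℂ))) fun f =>
        ⟨_, (h1 f).congr_fun fun j => intCLM_apply _ _ _⟩
      refine D.continuous.congr fun f => (hD f).unique ?_
      exact (h1 f).congr_fun fun j => intCLM_apply _ _ _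
  obtain ⟨A, hA'⟩ := exists_lift b
    (fun f => key (b f) fun k => by
      refine (P.L (P.mul f k)).continuous.congr fun g => ?_
      exact (hκ f g k).symm)
    (fun g => key (b.flip g) fun k => by
      refine ((P.R g).continuous.comp (P.R k).continuous).congr fun f => ?_
      exact (hκ f g k).symm)
  exact ⟨A, fun f g k => by rw [hA', ← hκ]; rfl⟩

end HypothesisA

/-- The continuous linear map that takes `f ⊗ g` to the Schwartz kernel of `k ↦ f # k # g`. -/
structure IsKernelMap (P : CompositionLaw (Phase n))
    (κ : 𝓢(Phase n × Phase n, ℂ) →L[ℂ] 𝓢(Phase n × Phase n, ℂ)) : Prop where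
  contract_map : ∀ f g k, contract (haar n) k (κ (tensor f g)) = P.mul (P.mul f k) g

/-- The law `□` on `𝓢(Ξ × Ξ)`. -/
theorem exists_isSquare (P : CompositionLaw (Phase n)) :
    ∃ B : CompositionLaw (Phase n × Phase n), IsSquare P B := by
  obtain ⟨l, hl⟩ := exists_lift P.mul P.continuous_mul_right P.continuous_mul_left
  -- The first variables are grouped in order and the second variables in reverse, since the second
  -- factors multiply in the opposite order.
  let σ : ((Phase n × Phase n) × (Phase n × Phase n)) ≃L[ℝ]
      ((Phase n × Phase n) × (Phase n × Phase n)) :=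
    ContinuousLinearEquiv.mk
      { toFun := fun z => ((z.1.1, z.2.1), (z.2.2, z.1.2))
        invFun := fun z => ((z.1.1, z.2.2), (z.1.2, z.2.1))
        map_add' := fun z w => rfl
        map_smul' := fun c z => rfl
        left_inv := fun z => rfl
        right_inv := fun z => rfl }
      (by dsimp only; fun_prop) (by dsimp only; fun_prop)
  let A := (tensorMap l l).comp (comp σ.symm)
  refine ⟨⟨LinearMap.mk₂ ℂ (fun F G => A (tensor F G))
    (fun F F' G => by rw [tensor_add_left, map_add])
    (fun c F G => by rw [tensor_smul_left, map_smul])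
    (fun F G G' => by rw [tensor_add_right, map_add])
    (fun c F G => by rw [tensor_smul_right, map_smul]),
    fun F => A.continuous.comp (continuous_tensor_right F),
    fun G => A.continuous.comp (continuous_tensor_left G)⟩, fun f h g k => ?_⟩
  have : comp σ.symm (tensor (tensor f h) (tensor g k)) = tensor (tensor f g) (tensor k h) := by
    ext z
    change f z.1.1 * h z.2.2 * (g z.1.2 * k z.2.1) = f z.1.1 * g z.1.2 * (k z.2.1 * h z.2.2)
    ring
  change tensorMap l l (comp σ.symm (tensor (tensor f h) (tensor g k))) = _
  rw [this, tensorMap_tensor, hl, hl]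

theorem mul_eq_of_tensor {V E : Type} [NormedAddCommGroup V] [NormedSpace ℝ V]
    [NormedAddCommGroup E] [NormedSpace ℝ E] [FiniteDimensional ℝ E] {X : Type*} [AddCommGroup X]
    [Module ℂ X] [TopologicalSpace X] [T2Space X]
    {b b' : 𝓢(V × E, ℂ) →ₗ[ℂ] 𝓢(V × E, ℂ) →ₗ[ℂ] X}
    (hr : ∀ F, Continuous (b F)) (hl : ∀ G, Continuous (b.flip G))
    (hr' : ∀ F, Continuous (b' F)) (hl' : ∀ G, Continuous (b'.flip G))
    (h : ∀ f g f' g', b (tensor f g) (tensor f' g') = b' (tensor f g) (tensor f' g'))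
    (F G : 𝓢(V × E, ℂ)) : b F G = b' F G := by
  refine eq_of_tensor (⟨b F, hr F⟩ : _ →L[ℂ] X) (⟨b' F, hr' F⟩ : _ →L[ℂ] X) (fun f' g' => ?_) G
  exact eq_of_tensor (⟨b.flip (tensor f' g'), hl _⟩ : _ →L[ℂ] X)
    (⟨b'.flip (tensor f' g'), hl' _⟩ : _ →L[ℂ] X) (fun f g => h f g f' g') F

theorem IsSquare.unique {B B' : CompositionLaw (Phase n × Phase n)} (h : IsSquare P B)
    (h' : IsSquare P B') : B = B' := by
  have : B.mul = B'.mul := LinearMap.ext₂ fun F G =>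
    mul_eq_of_tensor B.continuous_mul_right B.continuous_mul_left B'.continuous_mul_right
      B'.continuous_mul_left (fun f g f' g' => by rw [h, h']) F G
  cases B
  cases B'
  congr

end CompositionLaws

/-! ### Algebraic properties of the kernel map -/

section KernelMap
variable {n : ℕ} {P : CompositionLaw (Phase n)} {B : CompositionLaw (Phase n × Phase n)}
  {κ : 𝓢(Phase n × Phase n, ℂ) →L[ℂ] 𝓢(Phase n × Phase n, ℂ)}

/-- A tempered distribution as a continuous linear functional. -/
noncomputable def distCLM {E : Type} [NormedAddCommGroup E] [NormedSpace ℝ E] (T : 𝓢'(E, ℂ)) :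
    𝓢(E, ℂ) →L[ℂ] ℂ := ⟨T.toLinearMap, T.continuous⟩

theorem distCLM_apply {E : Type} [NormedAddCommGroup E] [NormedSpace ℝ E] (T : 𝓢'(E, ℂ))
    (f : 𝓢(E, ℂ)) : distCLM T f = T f := rfl

/-- The partial application of a distribution in the second variable. -/
theorem exists_partial_dist {V E : Type} [NormedAddCommGroup V] [NormedSpace ℝ V]
    [NormedAddCommGroup E] [NormedSpace ℝ E] [FiniteDimensional ℝ E] (T : 𝓢'(E, ℂ)) :
    ∃ D : 𝓢(V × E, ℂ) →L[ℂ] 𝓢(V, ℂ), ∀ a b, D (tensor a b) = T b • a :=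
  exists_lift (LinearMap.mk₂ ℂ (fun a b => T b • a) (fun _ _ _ => smul_add _ _ _)
    (fun _ _ _ => smul_comm _ _ _) (fun a b b' => by rw [map_add, add_smul])
    (fun c a b => by rw [map_smul, smul_assoc]))
    (fun a => T.continuous.smul continuous_const) (fun b => continuous_const_smul (T b))

theorem integral_tensor2 (f g : 𝓢(Phase n, ℂ)) :
    ∫ z, tensor f g z ∂(haar2 n) = (∫ X, f X ∂(haar n)) * ∫ X, g X ∂(haar n) :=
  integral_prod_mul f g

theorem integral_tensor2_mul (f g : 𝓢(Phase n, ℂ)) (G : 𝓢(Phase n × Phase n, ℂ)) :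
    ∫ z, tensor f g z * G z ∂(haar2 n) = ∫ X, f X * contract (haar n) g G X ∂(haar n) := by
  have : ((haar n).prod (haar n)).HasTemperateGrowth :=
    inferInstanceAs (haar2 n).HasTemperateGrowth
  exact integral_tensor_mul (haar n) (haar n) f g G

/-- This is the trace formula `tr(KL) = ∬ K(x, y) L(y, x)`. On elementary tensors both sides are
`⟨a, d⟩⟨b, c⟩`, by the composition rule and Parseval's formula. -/
theorem pair_kernelToCrossed (K L : 𝓢(Phase n × Phase n, ℂ)) :
    pair (tDiamond n) (haar2 n) (kernelToCrossed n K) (kernelToCrossed n L) =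
      ∫ z, K z * flipS L z ∂(haar2 n) := by
  let Ψ : 𝓢(Phase n × Phase n, ℂ) →L[ℂ] 𝓢(Phase n × Phase n, ℂ) := kernelToCrossed n
  rw [← intCLM_apply]
  refine eq_of_tensor ((intCLM (haar2 n) (Ψ K)).comp ((comp (tDiamond n)).comp Ψ))
    ((intCLM (haar2 n) K).comp flipS) (fun c d => ?_) L
  change pair (tDiamond n) (haar2 n) (Ψ K) (Ψ (tensor c d)) = _
  rw [pair_eq, ContinuousLinearMap.comp_apply, intCLM_apply]
  have e1 : ∀ K, ∫ z, Ψ K z * Ψ (tensor c d) (tDiamond n z) ∂(haar2 n) =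
      ((intCLM (haar2 n) (comp (tDiamond n) (Ψ (tensor c d)))).comp Ψ) K := fun K => by
    rw [ContinuousLinearMap.comp_apply, intCLM_apply]
    simp only [mul_comm]
    rfl
  have e2 : ∀ K : 𝓢(Phase n × Phase n, ℂ), ∫ z, K z * flipS (tensor c d) z ∂(haar2 n) =
      intCLM (haar2 n) (flipS (tensor c d)) K := fun K => by
    rw [intCLM_apply]
    simp only [mul_comm]
  rw [e1, e2]
  refine eq_of_tensor _ _ (fun a b => ?_) K
  rw [← e1, ← e2, ← pair_eq, flipS_tensor, ← integral_diamond]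
  change ∫ X, (diamond n).mul (kernelToCrossed n (tensor a b)) (kernelToCrossed n (tensor c d))
    (X, 0) ∂(haar n) = _
  rw [diamond_kernelToCrossed, integral_tensor2_mul, contract_tensor]
  simp only [smul_apply, smul_eq_mul, kernelToCrossed_tensor, zero_sub, integral_const_mul,
    mul_left_comm _ (∫ X, _ ∂(haar n))]
  rw [integral_symplecticFourier_mul_neg]

/-- The inverse of `kernelToCrossed` in terms of the duality of the crossed product. -/
theorem flipS_tensorMap_kernelToCrossed (K : 𝓢(Phase n × Phase n, ℂ)) :
    flipS (tensorMap (symplecticFourier n) (symplecticFourier n)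
      (comp (modVar n).symm (comp (tDiamond n) (kernelToCrossed n K)))) = K := by
  refine eq_of_tensor (flipS.comp ((tensorMap (symplecticFourier n) (symplecticFourier n)).comp
    ((comp (modVar n).symm).comp ((comp (tDiamond n)).comp
      (kernelToCrossed n : 𝓢(Phase n × Phase n, ℂ) →L[ℂ] 𝓢(Phase n × Phase n, ℂ))))))
      (ContinuousLinearMap.id ℂ _) (fun a b => ?_) K
  have : comp (modVar n).symm (comp (tDiamond n) (kernelToCrossed n (tensor a b))) =
      tensor (symplecticFourier n b) (symplecticFourier n a) := by
    ext ⟨X, Y⟩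
    change kernelToCrossed n (tensor a b) (-X - (-X - Y), -(-X - Y)) = _
    rw [kernelToCrossed_tensor, tensor_apply, mul_comm]
    congr 2 <;> abel
  change flipS (tensorMap (symplecticFourier n) (symplecticFourier n)
    (comp (modVar n).symm (comp (tDiamond n) (kernelToCrossed n (tensor a b))))) = tensor a b
  rw [this, tensorMap_tensor, flipS_tensor, symplecticFourier_symplecticFourier,
    symplecticFourier_symplecticFourier]

theorem IsSquare.integral_mul (hS : IsSquare P B) (hA : HypothesisA P)
    (F G : 𝓢(Phase n × Phase n, ℂ)) :
    ∫ z, B.mul F G z ∂(haar2 n) = ∫ z, F z * G z ∂(haar2 n) := by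
  have e : ∀ H : 𝓢(Phase n × Phase n, ℂ), ∫ z, H z ∂(haar2 n) = SchwartzMap.integralCLM ℂ (haar2 n) H :=
    fun H => (SchwartzMap.integralCLM_apply _ _).symm
  rw [e, ← intCLM_apply]
  refine eq_of_tensor ((SchwartzMap.integralCLM ℂ (haar2 n)).comp (B.L F)) (intCLM (haar2 n) F)
    (fun g k => ?_) G
  have e2 : intCLM (haar2 n) F (tensor g k) = intCLM (haar2 n) (tensor g k) F := by
    simp only [intCLM_apply, mul_comm]
  rw [e2]
  refine eq_of_tensor ((SchwartzMap.integralCLM ℂ (haar2 n)).comp (B.R (tensor g k))) _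
    (fun f h => ?_) F
  change SchwartzMap.integralCLM ℂ (haar2 n) (B.mul (tensor f h) (tensor g k)) = _
  rw [← e, hS, integral_tensor2, hA.integral_mul, hA.integral_mul, intCLM_apply,
    integral_tensor2_mul, contract_tensor]
  simp only [smul_apply, smul_eq_mul, mul_left_comm _ (∫ X, _ ∂(haar n)), integral_const_mul]
  simp only [mul_comm]

namespace IsKernelMap
variable (hκ : IsKernelMap P κ)
include hκ

/-- On elementary tensors this is `(f # g) # u # (k # h) = f # (g # u # k) # h`: the sandwich
operators compose as `□` prescribes. -/
theorem map_square (hA : HypothesisA P) (hS : IsSquare P B) (F G : 𝓢(Phase n × Phase n, ℂ)) :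
    kernelToCrossed n (κ (B.mul F G)) =
      (diamond n).mul (kernelToCrossed n (κ F)) (kernelToCrossed n (κ G)) := by
  let Φ : 𝓢(Phase n × Phase n, ℂ) →L[ℂ] 𝓢(Phase n × Phase n, ℂ) :=
    (kernelToCrossed n : 𝓢(Phase n × Phase n, ℂ) →L[ℂ] 𝓢(Phase n × Phase n, ℂ)).comp κ
  refine eq_of_tensor (Φ.comp (B.L F)) (((diamond n).L (Φ F)).comp Φ) (fun g k => ?_) G
  refine eq_of_tensor (Φ.comp (B.R (tensor g k))) (((diamond n).R (Φ (tensor g k))).comp Φ)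
    (fun f h => ?_) F
  change kernelToCrossed n (κ (B.mul (tensor f h) (tensor g k))) =
    (diamond n).mul (kernelToCrossed n (κ (tensor f h))) (kernelToCrossed n (κ (tensor g k)))
  refine (kernelToCrossed n).symm.injective (eq_of_contract (μ := haar n) fun u => ?_)
  rw [contract_crossed, ContinuousLinearEquiv.symm_apply_apply, hS, hκ.contract_map,
    hκ.contract_map, hκ.contract_map]
  simp only [hA.assoc]

/-- For `F = f ⊗ g` and `G = h ⊗ k` both sides are `∫ f # k # g # h`. -/
theorem transpose (hA : HypothesisA P) (F G : 𝓢(Phase n × Phase n, ℂ)) :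
    ∫ z, κ F z * G z ∂(haar2 n) = ∫ z, F z * κ (flipS G) z ∂(haar2 n) := by
  rw [← intCLM_apply, ← intCLM_apply]
  refine eq_of_tensor (intCLM (haar2 n) (κ F)) ((intCLM (haar2 n) F).comp (κ.comp flipS))
    (fun h k => ?_) G
  have e1 : intCLM (haar2 n) (κ F) (tensor h k) = (intCLM (haar2 n) (tensor h k)).comp κ F := by
    simp only [intCLM_apply, ContinuousLinearMap.comp_apply, mul_comm]
  have e2 : (intCLM (haar2 n) F).comp (κ.comp flipS) (tensor h k) =
      intCLM (haar2 n) (κ (tensor k h)) F := by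
    simp only [intCLM_apply, ContinuousLinearMap.comp_apply, mul_comm, flipS_tensor]
  rw [e1, e2]
  refine eq_of_tensor _ _ (fun f g => ?_) F
  rw [ContinuousLinearMap.comp_apply, intCLM_apply, intCLM_apply, integral_tensor2_mul,
    hκ.contract_map, hA.integral_sandwich]
  simp only [mul_comm (κ (tensor k h) _)]
  rw [integral_tensor2_mul, hκ.contract_map]
  simp only [mul_comm (k _)]
  rw [hA.integral_mul_right, ← hA.assoc]

theorem contract_flip (hA : HypothesisA P) (f g u : 𝓢(Phase n, ℂ)) :
    contract (haar n) u (flipS (κ (tensor f g))) = P.mul (P.mul g u) f := by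
  refine eq_of_integral_mul (haar n) fun k => ?_
  simp only [mul_comm _ (k _)]
  rw [integral_mul_contract, flipS_flipS, hκ.contract_map, hA.integral_sandwich]

/-- The adjoint of the sandwich operator of `f, g` is that of `conj f, conj g`, because conjugation
reverses products. Both sides are conjugate linear in `F`, so the additive form of tensor
extensionality is used. -/
theorem map_conj (hA : HypothesisA P) (F : 𝓢(Phase n × Phase n, ℂ)) :
    κ (conjS F) = conjS (flipS (κ F)) := by
  let Φ : 𝓢(Phase n × Phase n, ℂ) →+ 𝓢(Phase n × Phase n, ℂ) :=
    (conjS : 𝓢(Phase n × Phase n, ℂ) →L[ℝ] 𝓢(Phase n × Phase n, ℂ)).toLinearMap.toAddMonoidHom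
  have h := addMonoidHom_tensor_ext (φ := κ.toLinearMap.toAddMonoidHom.comp Φ)
    (ψ := Φ.comp (flipS.toLinearMap.toAddMonoidHom.comp κ.toLinearMap.toAddMonoidHom))
    (κ.continuous.comp conjS.continuous)
    (conjS.continuous.comp (flipS.continuous.comp κ.continuous)) fun f g => by
      change κ (conjS (tensor f g)) = conjS (flipS (κ (tensor f g)))
      refine eq_of_contract (μ := haar n) fun u => ?_
      rw [conjS_tensor, hκ.contract_map, contract_conjS, hκ.contract_flip hA, hA.conj_mul, hA.conj_mul,
        conjS_conjS, hA.assoc]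
  exact DFunLike.congr_fun h F

/-- Applying `e_Z` to the second variable of the kernel `κ(f ⊗ g)` gives `f # e_Z # g`; applying
`e_{-Z}` to the first then takes `a ⊗ b` to `(𝔉 a)(Z) (𝔉 b)(-Z)`, which is the value of
`kernelToCrossed` at `(Z, 0)`. -/
theorem sandwich_eq (hA : HypothesisA P) (f g : 𝓢(Phase n, ℂ)) (Z : Phase n) :
    sandwich P (planeWave (-Z)) f (planeWave Z) g =
      kernelToCrossed n (κ (tensor f g)) (Z, 0) := by
  obtain ⟨D, hD⟩ := exists_partial_dist (V := Phase n) (planeWave Z)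
  have hDu : ∀ K u, ∫ X, D K X * u X ∂(haar n) =
      planeWave Z (contract (haar n) u (flipS K)) := fun K u => by
    have := eq_of_tensor ((intCLM (haar n) u).comp D)
      ((distCLM (planeWave Z)).comp ((contract (haar n) u).comp flipS)) (fun a b => by
        simp only [ContinuousLinearMap.comp_apply, hD, map_smul, flipS_tensor,
          MoyalModulation.contract_tensor,
          intCLM_apply, smul_eq_mul, distCLM_apply, mul_comm]) K
    rw [ContinuousLinearMap.comp_apply, intCLM_apply] at this
    simp only [mul_comm (D K _)]
    exact this
  have hk : toDist (haar n) (D (κ (tensor f g))) =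
      mulDS P (tId n) (mulSD P (tId n) f (planeWave Z)) g := by
    ext u
    rw [toDist_apply, hDu, hκ.contract_flip hA, ← dual_tId, ← dual_tId, dual_mulDS, dual_mulSD]
  have hr : repS (haar n) (mulDS P (tId n) (mulSD P (tId n) f (planeWave Z)) g) =
      D (κ (tensor f g)) := by
    have H : ∃ k, toDist (haar n) k = mulDS P (tId n) (mulSD P (tId n) f (planeWave Z)) g :=
      ⟨_, hk⟩
    rw [repS, dif_pos H]
    exact toDist_injective (haar n) (H.choose_spec.trans hk.symm)
  rw [sandwich, hr]
  refine eq_of_tensor ((distCLM (planeWave (-Z))).comp D)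
    ((distCLM (TemperedDistribution.delta (Z, (0 : Phase n)))).comp
      (kernelToCrossed n : 𝓢(Phase n × Phase n, ℂ) →L[ℂ] 𝓢(Phase n × Phase n, ℂ)))
    (fun a b => ?_) (κ (tensor f g))
  change planeWave (-Z) (D (tensor a b)) = kernelToCrossed n (tensor a b) (Z, 0)
  rw [hD, kernelToCrossed_tensor, map_smul, zero_sub, smul_eq_mul, mul_comm]
  congr 1
  change symplecticFourier n a (- -Z) = _
  rw [neg_neg]

/-- On elementary tensors this is (C), by `sandwich_eq`. -/
theorem trace (hA : HypothesisA P) (hC : HypothesisC P) (F : 𝓢(Phase n × Phase n, ℂ)) :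
    ∫ X, kernelToCrossed n (κ F) (X, 0) ∂(haar n) = ∫ z, F z ∂(haar2 n) := by
  have e : ∀ H : 𝓢(Phase n × Phase n, ℂ), ∫ z, H z ∂(haar2 n) = SchwartzMap.integralCLM ℂ (haar2 n) H :=
    fun H => (SchwartzMap.integralCLM_apply _ _).symm
  rw [e]
  refine eq_of_tensor ((distCLM (TemperedDistribution.delta (0 : Phase n))).comp
    ((partialIntegral (haar n)).comp (flipS.comp
      ((kernelToCrossed n : 𝓢(Phase n × Phase n, ℂ) →L[ℂ] 𝓢(Phase n × Phase n, ℂ)).comp κ))))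
    _ (fun f g => ?_) F
  rw [← e, integral_tensor2, ← hC]
  simp only [hκ.sandwich_eq hA]
  rfl

theorem pair_map (hA : HypothesisA P) (hC : HypothesisC P) (hS : IsSquare P B)
    (F G : 𝓢(Phase n × Phase n, ℂ)) :
    pair (tDiamond n) (haar2 n) (kernelToCrossed n (κ F)) (kernelToCrossed n (κ G)) =
      ∫ z, F z * G z ∂(haar2 n) := by
  rw [← integral_diamond, ← hκ.map_square hA hS, hκ.trace hA hC, hS.integral_mul hA]

/-- In terms of kernels, `pair_map` reads `∫ κ(G) · flip(κ F) = ∫ G F`. Moving `κ` across by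
`transpose` gives `∫ G · κ(κ F) = ∫ G F` for all `G`. -/
theorem involutive (hA : HypothesisA P) (hC : HypothesisC P) (F : 𝓢(Phase n × Phase n, ℂ)) :
    κ (κ F) = F := by
  obtain ⟨B, hS⟩ := exists_isSquare P
  refine eq_of_integral_mul (haar2 n) fun G => ?_
  have h := hκ.pair_map hA hC hS G F
  rw [pair_kernelToCrossed, hκ.transpose hA, flipS_flipS] at h
  simpa only [mul_comm] using! h

end IsKernelMap
end KernelMap

/-! ### Moyal data for `#` and `□`, and the modulation map -/

section Main
variable {n : ℕ} {P : CompositionLaw (Phase n)} {B : CompositionLaw (Phase n × Phase n)}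
  {κ : 𝓢(Phase n × Phase n, ℂ) →L[ℂ] 𝓢(Phase n × Phase n, ℂ)}
  {N : 𝓢'(Phase n × Phase n, ℂ) →L[ℂ] 𝓢'(Phase n × Phase n, ℂ)}

theorem pair_tId (f g : 𝓢(Phase n, ℂ)) :
    pair (tId n) (haar n) f g = ∫ X, f X * g X ∂(haar n) := pair_eq f g

theorem pair_tId2 (f g : 𝓢(Phase n × Phase n, ℂ)) :
    pair (tId2 n) (haar2 n) f g = ∫ z, f z * g z ∂(haar2 n) := pair_eq f g

theorem dual_tId2 (T : 𝓢'(Phase n × Phase n, ℂ)) (h : 𝓢(Phase n × Phase n, ℂ)) :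
    dual (tId2 n) T h = T h := rfl

theorem starS_tId (f : 𝓢(Phase n, ℂ)) : starS (tId n) f = conjS f := rfl

theorem starS_tId2 (f : 𝓢(Phase n × Phase n, ℂ)) : starS (tId2 n) f = conjS f := rfl

theorem integral_conjS_mul {E : Type} [NormedAddCommGroup E] [NormedSpace ℝ E] [MeasurableSpace E]
    (μ : Measure E) (f g : 𝓢(E, ℂ)) :
    ∫ x, conjS f x * conjS g x ∂μ = starRingEnd ℂ (∫ x, f x * g x ∂μ) := by
  rw [← integral_conj]
  congr 1
  funext x
  rw [map_mul]
  rfl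

theorem exists_integral_mul_ne_zero {h : 𝓢(Phase n, ℂ)} (hh : h ≠ 0) :
    ∃ d : 𝓢(Phase n, ℂ), ∫ X, h X * d X ∂(haar n) ≠ 0 := by
  by_contra! H
  refine hh (eq_of_integral_mul (haar n) fun k => ?_)
  rw [H]
  simp

theorem IsKernelMap.moyalData (hκ : IsKernelMap P κ) (hA : HypothesisA P) (hC : HypothesisC P) :
    MoyalData P (tId n) (haar n) where
  assoc := hA.assoc
  star_mul := hA.conj_mul
  star_star := conjS_conjS
  cyclic f g h := by rw [pair_tId, pair_tId, hA.integral_mul_left]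
  symm f g := by simp only [pair_tId, mul_comm]
  star_pair f g := by rw [pair_tId, pair_tId, starS_tId, starS_tId, integral_conjS_mul]
  -- If `T` kills all products, it kills all contractions of kernels in the range of `κ`. The
  -- involution `κ` is onto, so `a ⊗ a` is such a kernel, and its contraction with `k` is `⟨k, a⟩
  -- a`.
  nondeg T hT := by
    have h1 : ∀ k F, T (contract (haar n) k (κ F)) = 0 := fun k F => by
      refine eq_of_tensor ((distCLM T).comp ((contract (haar n) k).comp κ)) (0 : _ →L[ℂ] ℂ)
        (fun f g => ?_) F
      change T (contract (haar n) k (κ (tensor f g))) = 0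
      rw [hκ.contract_map, ← dual_tId, hT]
    ext a
    by_cases ha : a = 0
    · rw [ha, map_zero, map_zero]
    obtain ⟨k, hk⟩ := exists_integral_mul_ne_zero ha
    have h2 := h1 k (κ (tensor a a))
    rw [hκ.involutive hA hC, contract_tensor, map_smul, smul_eq_mul] at h2
    simp only [mul_comm (k _)] at h2
    exact (mul_eq_zero.1 h2).resolve_left hk

theorem IsSquare.assoc (hS : IsSquare P B) (hA : HypothesisA P)
    (F G H : 𝓢(Phase n × Phase n, ℂ)) : B.mul (B.mul F G) H = B.mul F (B.mul G H) := by
  refine eq_of_tensor (B.L (B.mul F G)) ((B.L F).comp (B.L G)) (fun a b => ?_) H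
  refine eq_of_tensor ((B.R (tensor a b)).comp (B.L F)) ((B.L F).comp (B.R (tensor a b)))
    (fun c d => ?_) G
  refine eq_of_tensor ((B.R (tensor a b)).comp (B.R (tensor c d)))
    (B.R (B.mul (tensor c d) (tensor a b))) (fun f g => ?_) F
  change B.mul (B.mul (tensor f g) (tensor c d)) (tensor a b) =
    B.mul (tensor f g) (B.mul (tensor c d) (tensor a b))
  rw [hS, hS, hS, hS, hA.assoc, hA.assoc]

theorem IsSquare.conj_mul (hS : IsSquare P B) (hA : HypothesisA P)
    (F G : 𝓢(Phase n × Phase n, ℂ)) : conjS (B.mul F G) = B.mul (conjS G) (conjS F) := by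
  let Φ : 𝓢(Phase n × Phase n, ℂ) →+ 𝓢(Phase n × Phase n, ℂ) :=
    (conjS : 𝓢(Phase n × Phase n, ℂ) →L[ℝ] 𝓢(Phase n × Phase n, ℂ)).toLinearMap.toAddMonoidHom
  refine DFunLike.congr_fun (addMonoidHom_tensor_ext
    (φ := Φ.comp (B.L F).toLinearMap.toAddMonoidHom)
    (ψ := (B.R (conjS F)).toLinearMap.toAddMonoidHom.comp Φ)
    (conjS.continuous.comp (B.L F).continuous)
    ((B.R (conjS F)).continuous.comp conjS.continuous) fun g k => ?_) G
  refine DFunLike.congr_fun (addMonoidHom_tensor_ext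
    (φ := Φ.comp (B.R (tensor g k)).toLinearMap.toAddMonoidHom)
    (ψ := (B.L (conjS (tensor g k))).toLinearMap.toAddMonoidHom.comp Φ)
    (conjS.continuous.comp (B.R (tensor g k)).continuous)
    ((B.L (conjS (tensor g k))).continuous.comp conjS.continuous) fun f h => ?_) F
  change conjS (B.mul (tensor f h) (tensor g k)) =
    B.mul (conjS (tensor g k)) (conjS (tensor f h))
  rw [hS, conjS_tensor, conjS_tensor, conjS_tensor, hS, hA.conj_mul, hA.conj_mul]

theorem IsSquare.moyalData (hS : IsSquare P B) (hA : HypothesisA P)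
    (D : MoyalData P (tId n) (haar n)) : MoyalData B (tId2 n) (haar2 n) where
  assoc := hS.assoc hA
  star_mul := hS.conj_mul hA
  star_star := conjS_conjS
  cyclic f g h := by
    rw [pair_tId2, pair_tId2, ← hS.integral_mul hA, ← hS.integral_mul hA, hS.assoc hA]
  symm f g := by simp only [pair_tId2, mul_comm]
  star_pair f g := by rw [pair_tId2, pair_tId2, starS_tId2, starS_tId2, integral_conjS_mul]
  nondeg T hT := by
    -- Nondegeneracy for `#` is applied to one variable at a time, the first and then the second.
    have h0 : ∀ f g h k, T (tensor (P.mul f g) (P.mul k h)) = 0 := fun f g h k => by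
      rw [← hS, ← dual_tId2, hT]
    have h1 : ∀ a h k, T (tensor a (P.mul k h)) = 0 := fun a h k => by
      have := D.nondeg (ContinuousLinearMap.toPointwiseConvergenceCLM _ _ _ _
        ((distCLM T).comp ((flipS : 𝓢(Phase n × Phase n, ℂ) →L[ℂ] _).comp
          (tensorCLM (P.mul k h))))) fun f g => by
            change T (flipS (tensor (P.mul k h) (P.mul f g))) = 0
            rw [flipS_tensor, h0]
      have := congrArg (fun S : 𝓢'(Phase n, ℂ) => S a) this
      change T (flipS (tensor (P.mul k h) a)) = 0 at this
      rwa [flipS_tensor] at this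
    have h2 : ∀ a b, T (tensor a b) = 0 := fun a b => by
      have := D.nondeg (ContinuousLinearMap.toPointwiseConvergenceCLM _ _ _ _
        ((distCLM T).comp (tensorCLM a))) fun f g => h1 a g f
      exact congrArg (fun S : 𝓢'(Phase n, ℂ) => S b) this
    ext F
    exact eq_of_tensor (distCLM T) (0 : _ →L[ℂ] ℂ) h2 F

/-- The modulation mapping on Schwartz functions, as an isomorphism. -/
noncomputable def IsKernelMap.equiv (hκ : IsKernelMap P κ) (hA : HypothesisA P)
    (hC : HypothesisC P) : 𝓢(Phase n × Phase n, ℂ) ≃L[ℂ] 𝓢(Phase n × Phase n, ℂ) :=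
  (ContinuousLinearEquiv.equivOfInverse κ κ (hκ.involutive hA hC) (hκ.involutive hA hC)).trans
    (kernelToCrossed n)

theorem IsKernelMap.equiv_apply (hκ : IsKernelMap P κ) (hA : HypothesisA P)
    (hC : HypothesisC P) (F : 𝓢(Phase n × Phase n, ℂ)) :
    hκ.equiv hA hC F = kernelToCrossed n (κ F) := rfl

/-- By cyclicity `⟨ĝ₁ # f₁, ĝ₂ # f₂⟩ = ⟨f₁, ĝ₂ # f₂ # ĝ₁⟩`, which is `f₁ ⊗ f₂` paired with the
kernel `κ(ĝ₂ ⊗ ĝ₁)`. So `𝐍` is an explicit transpose and extends to all distributions. -/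
theorem IsKernelMap.isNMap (hκ : IsKernelMap P κ) (hA : HypothesisA P) :
    IsNMap P (PointwiseConvergenceCLM.precomp ℂ (κ.comp (flipS.comp
      (tensorMap (symplecticFourier n) (symplecticFourier n))))) := fun f₁ f₂ g₁ g₂ => by
  change toDist (haar2 n) (tensor f₁ f₂) (κ (flipS (tensorMap (symplecticFourier n)
    (symplecticFourier n) (tensor g₁ g₂)))) = _
  rw [toDist_apply, tensorMap_tensor, flipS_tensor, integral_tensor2_mul, hκ.contract_map]
  simp only [mul_comm (f₁ _)]
  rw [hA.integral_mul_left]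
  simp only [mul_comm]

theorem IsNMap.unique {N' : 𝓢'(Phase n × Phase n, ℂ) →L[ℂ] 𝓢'(Phase n × Phase n, ℂ)}
    (hN : IsNMap P N) (hN' : IsNMap P N') : N = N' := by
  have h : ∀ F, N (toDist (haar2 n) F) = N' (toDist (haar2 n) F) := fun F => by
    refine eq_of_tensor (N.comp (toDist (haar2 n))) (N'.comp (toDist (haar2 n)))
      (fun f₁ f₂ => ?_) F
    ext G
    exact eq_of_tensor (distCLM (N (toDist (haar2 n) (tensor f₁ f₂))))
      (distCLM (N' (toDist (haar2 n) (tensor f₁ f₂))))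
      (fun g₁ g₂ => (hN f₁ f₂ g₁ g₂).trans (hN' f₁ f₂ g₁ g₂).symm) G
  have := dist_ext (haar2 n) (φ := N.toLinearMap.toAddMonoidHom)
    (ψ := N'.toLinearMap.toAddMonoidHom) N.continuous N'.continuous h
  ext1 T
  exact DFunLike.congr_fun this T

/-- This identifies `𝐌` as the transpose of `Φ⁻¹`: the Fourier transformations and changes of
variables in `𝐍`, `C` and the duality of `⋄` invert `kernelToCrossed`, and `κ ∘ κ = id` does the
rest. -/
theorem IsKernelMap.dual_modulation (hκ : IsKernelMap P κ) (hA : HypothesisA P)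
    (hC : HypothesisC P) (hN : IsNMap P N) (T : 𝓢'(Phase n × Phase n, ℂ))
    (F : 𝓢(Phase n × Phase n, ℂ)) :
    dual (tDiamond n) (modulation N T) (hκ.equiv hA hC F) = dual (tId2 n) T F := by
  rw [hN.unique (hκ.isNMap hA), dual_tId2, hκ.equiv_apply]
  change T (κ (flipS (tensorMap (symplecticFourier n) (symplecticFourier n)
      (comp (modVar n).symm (comp (tDiamond n) (kernelToCrossed n (κ F))))))) = T F
  rw [flipS_tensorMap_kernelToCrossed, hκ.involutive hA hC]

/-! ### Localization at an idempotent window -/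

section Localization
variable {h : 𝓢(Phase n, ℂ)} {T U : 𝓢'(Phase n, ℂ)}

theorem tensorDist_eq (T : 𝓢'(Phase n, ℂ)) (G : 𝓢(Phase n × Phase n, ℂ)) :
    tensorDist (haar n) h T G = T (contract (haar n) h G) := rfl

theorem tensorDist_injective (hh : h ≠ 0) :
    Function.Injective (tensorDist (F := Phase n) (haar n) h) := fun T U e => by
  obtain ⟨d, hd⟩ := exists_integral_mul_ne_zero hh
  ext a
  have := congrArg (fun S : 𝓢'(Phase n × Phase n, ℂ) => S (tensor a d)) e
  simp only [tensorDist_eq, contract_tensor, map_smul, smul_eq_mul] at this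
  exact mul_left_cancel₀ hd this

theorem tensorDist_starD (hc : conjS h = h) (T : 𝓢'(Phase n, ℂ)) :
    tensorDist (haar n) h (starD (tId n) T) = starD (tId2 n) (tensorDist (haar n) h T) := by
  ext G
  rw [tensorDist_eq, starD_apply, starD_apply, tensorDist_eq, starS_tId, starS_tId2,
    contract_conjS, hc]

/-- Formally `(T ⊗ h) □ (a ⊗ b) = (T # a) ⊗ (b # h)`, so left multiplication by `T ⊗ h` is left
multiplication by `T` tensored with right multiplication by `h`. -/
theorem IsSquare.left_tensorDist (hS : IsSquare P B) (hA : HypothesisA P)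
    {L : 𝓢(Phase n, ℂ) →L[ℂ] 𝓢(Phase n, ℂ)}
    (hL : ∀ g k, pair (tId n) (haar n) (L g) k = dual (tId n) T (P.mul g k))
    (G H : 𝓢(Phase n × Phase n, ℂ)) :
    pair (tId2 n) (haar2 n) (tensorMap L (P.R h) G) H =
      dual (tId2 n) (tensorDist (haar n) h T) (B.mul G H) := by
  rw [pair_tId2, ← intCLM_apply]
  refine eq_of_tensor (intCLM (haar2 n) (tensorMap L (P.R h) G))
    ((distCLM (tensorDist (haar n) h T)).comp (B.L G)) (fun c d => ?_) H
  have e : intCLM (haar2 n) (tensorMap L (P.R h) G) (tensor c d) =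
      (intCLM (haar2 n) (tensor c d)).comp (tensorMap L (P.R h)) G := by
    simp only [intCLM_apply, ContinuousLinearMap.comp_apply, mul_comm]
  rw [e]
  refine eq_of_tensor _ ((distCLM (tensorDist (haar n) h T)).comp (B.R (tensor c d)))
    (fun a b => ?_) G
  change intCLM (haar2 n) (tensor c d) (tensorMap L (P.R h) (tensor a b)) =
    tensorDist (haar n) h T (B.mul (tensor a b) (tensor c d))
  rw [hS, tensorDist_eq, contract_tensor, map_smul, ← dual_tId T, ← hL, pair_tId, intCLM_apply,
    tensorMap_tensor, integral_tensor2_mul, contract_tensor]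
  have e2 : ∫ X, d X * P.R h b X ∂(haar n) = ∫ X, h X * P.mul d b X ∂(haar n) := by
    simp only [mul_comm (h _)]
    exact (hA.integral_mul_left d b h).symm
  rw [e2]
  simp only [smul_apply, smul_eq_mul, mul_left_comm _ (∫ X, _ ∂(haar n)), integral_const_mul,
    mul_comm (c _)]

theorem IsSquare.right_tensorDist (hS : IsSquare P B) (hA : HypothesisA P)
    {R : 𝓢(Phase n, ℂ) →L[ℂ] 𝓢(Phase n, ℂ)}
    (hR : ∀ g k, pair (tId n) (haar n) (R g) k = dual (tId n) T (P.mul k g))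
    (G H : 𝓢(Phase n × Phase n, ℂ)) :
    pair (tId2 n) (haar2 n) (tensorMap R (P.L h) G) H =
      dual (tId2 n) (tensorDist (haar n) h T) (B.mul H G) := by
  rw [pair_tId2, ← intCLM_apply]
  refine eq_of_tensor (intCLM (haar2 n) (tensorMap R (P.L h) G))
    ((distCLM (tensorDist (haar n) h T)).comp (B.R G)) (fun c d => ?_) H
  have e : intCLM (haar2 n) (tensorMap R (P.L h) G) (tensor c d) =
      (intCLM (haar2 n) (tensor c d)).comp (tensorMap R (P.L h)) G := by
    simp only [intCLM_apply, ContinuousLinearMap.comp_apply, mul_comm]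
  rw [e]
  refine eq_of_tensor _ ((distCLM (tensorDist (haar n) h T)).comp (B.L (tensor c d)))
    (fun a b => ?_) G
  change intCLM (haar2 n) (tensor c d) (tensorMap R (P.L h) (tensor a b)) =
    tensorDist (haar n) h T (B.mul (tensor c d) (tensor a b))
  rw [hS, tensorDist_eq, contract_tensor, map_smul, ← dual_tId T, ← hR, pair_tId, intCLM_apply,
    tensorMap_tensor, integral_tensor2_mul, contract_tensor]
  have e2 : ∫ X, d X * P.L h b X ∂(haar n) = ∫ X, h X * P.mul b d X ∂(haar n) := by
    simp only [mul_comm (d _)]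
    exact hA.integral_mul_left h b d
  rw [e2]
  simp only [smul_apply, smul_eq_mul, mul_left_comm _ (∫ X, _ ∂(haar n)), integral_const_mul,
    mul_comm (c _)]

/-- Conversely to the formulas above, `(T ⊗ h) □ (g ⊗ h) = (T # g) ⊗ h` since `h` is idempotent. A
contraction with some `d` such that `⟨h, d⟩ ≠ 0` then exhibits `T # g` as a Schwartz function, and
likewise `g # T`. -/
theorem IsSquare.tensorDist_mem_moyal (hS : IsSquare P B) (hA : HypothesisA P)
    (hh : P.mul h h = h) (h0 : h ≠ 0) :
    tensorDist (haar n) h T ∈ moyal B (tId2 n) (haar2 n) ↔ T ∈ moyal P (tId n) (haar n) := by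
  refine ⟨fun H => ?_, fun H => ?_⟩
  · obtain ⟨d, hd⟩ := exists_integral_mul_ne_zero h0
    have e : ∀ K c, ∫ z, K z * tensor c d z ∂(haar2 n) =
        ∫ X, contract (haar n) d K X * c X ∂(haar n) := fun K c => by
      simp only [mul_comm (K _), mul_comm _ (c _)]
      exact integral_tensor2_mul c d K
    have hsm : ∀ K k, pair (tId n) (haar n)
        ((∫ X, h X * d X ∂(haar n))⁻¹ • contract (haar n) d K) k =
          (∫ X, h X * d X ∂(haar n))⁻¹ * ∫ z, K z * tensor k d z ∂(haar2 n) := fun K k => by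
      rw [pair_tId, e, ← integral_const_mul]
      congr 1
      funext X
      rw [smul_apply, smul_eq_mul, mul_assoc]
    obtain ⟨H1, H2⟩ := mem_moyal_iff.1 H
    refine mem_moyal_iff.2 ⟨fun g => ?_, fun g => ?_⟩
    · obtain ⟨K, hK⟩ := H1 (tensor g h)
      refine ⟨_, fun k => (hsm K k).trans ?_⟩
      have e2 : ∫ X, h X * P.mul d h X ∂(haar n) = ∫ X, h X * d X ∂(haar n) := by
        have := hA.integral_mul_left d h h
        rw [hh] at this
        simpa only [mul_comm] using! this
      rw [← pair_tId2, hK, dual_tId2, hS, tensorDist_eq, contract_tensor, e2, map_smul,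
        smul_eq_mul, inv_mul_cancel_left₀ hd, dual_tId]
    · obtain ⟨K, hK⟩ := H2 (tensor g h)
      refine ⟨_, fun k => (hsm K k).trans ?_⟩
      have e2 : ∫ X, h X * P.mul h d X ∂(haar n) = ∫ X, h X * d X ∂(haar n) := by
        rw [← hA.integral_mul_left, hh]
      rw [← pair_tId2, hK, dual_tId2, hS, tensorDist_eq, contract_tensor, e2, map_smul,
        smul_eq_mul, inv_mul_cancel_left₀ hd, dual_tId]
  · obtain ⟨L, hL⟩ := exists_left_of_mem H
    obtain ⟨R, hR⟩ := exists_right_of_mem H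
    exact mem_moyal_iff.2 ⟨fun G => ⟨_, hS.left_tensorDist hA hL G⟩,
      fun G => ⟨_, hS.right_tensorDist hA hR G⟩⟩

/-- The second factor of the product is `h # h = h`; for test functions this is `⟨h, b # h⟩ = ⟨h,
b⟩`. -/
theorem IsSquare.tensorDist_moyalMul (hS : IsSquare P B) (hA : HypothesisA P)
    (hh : P.mul h h = h) (hU : U ∈ moyal P (tId n) (haar n)) :
    tensorDist (haar n) h (moyalMul P (tId n) (haar n) T U) =
      moyalMul B (tId2 n) (haar2 n) (tensorDist (haar n) h T) (tensorDist (haar n) h U) := by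
  obtain ⟨L, hL⟩ := exists_left_of_mem hU
  ext G
  rw [← dual_tId2 (moyalMul B (tId2 n) (haar2 n) _ _), dual_moyalMul (hS.left_tensorDist hA hL),
    dual_tId2, tensorDist_eq, tensorDist_eq, ← dual_tId (moyalMul P (tId n) (haar n) T U),
    dual_moyalMul hL, dual_tId]
  congr 1
  refine eq_of_tensor (L.comp (contract (haar n) h))
    ((contract (haar n) h).comp (tensorMap L (P.R h))) (fun a b => ?_) G
  rw [ContinuousLinearMap.comp_apply, ContinuousLinearMap.comp_apply, tensorMap_tensor,
    contract_tensor, contract_tensor, map_smul]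
  congr 1
  have := hA.integral_mul_left b h h
  rw [hh] at this
  simp only [mul_comm (h _)]
  exact this.symm

/-- The localized modulation mapping restricts to a morphism of `*`-algebras. -/
theorem isMoyalStarHom_modulationAt (hS : IsSquare P B) (hA : HypothesisA P)
    (hM : IsMoyalStarHom B (tId2 n) (haar2 n) (diamond n) (tDiamond n) (haar2 n) (modulation N))
    (hh : P.mul h h = h) (hc : conjS h = h) (h0 : h ≠ 0) :
    IsMoyalStarHom P (tId n) (haar n) (diamond n) (tDiamond n) (haar2 n) (modulationAt N h) where
  mapsTo T hT := hM.mapsTo _ ((hS.tensorDist_mem_moyal hA hh h0).2 hT)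
  map_mul T hT U hU := by
    change modulation N (tensorDist (haar n) h (moyalMul P (tId n) (haar n) T U)) = _
    rw [hS.tensorDist_moyalMul hA hh hU]
    exact hM.map_mul _ ((hS.tensorDist_mem_moyal hA hh h0).2 hT) _
      ((hS.tensorDist_mem_moyal hA hh h0).2 hU)
  map_star T hT := by
    change modulation N (tensorDist (haar n) h (starD (tId n) T)) = _
    rw [tensorDist_starD hc]
    exact hM.map_star _ ((hS.tensorDist_mem_moyal hA hh h0).2 hT)

end Localization

theorem IsMoyalStarSubalgebra.comap {E E' : Type} [NormedAddCommGroup E] [NormedSpace ℝ E]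
    [MeasurableSpace E] [BorelSpace E] [SecondCountableTopology E]
    [NormedAddCommGroup E'] [NormedSpace ℝ E']
    [MeasurableSpace E'] [BorelSpace E'] [SecondCountableTopology E']
    {m : CompositionLaw E} {τ : E ≃L[ℝ] E} {μ : Measure E} [μ.HasTemperateGrowth]
    {m' : CompositionLaw E'} {τ' : E' ≃L[ℝ] E'} {μ' : Measure E'} [μ'.HasTemperateGrowth]
    {Φ : 𝓢'(E, ℂ) →L[ℂ] 𝓢'(E', ℂ)} (hΦ : IsMoyalStarHom m τ μ m' τ' μ' Φ)
    (hle : (moyal m' τ' μ').comap Φ.toLinearMap ≤ moyal m τ μ) {𝔏 : Submodule ℂ 𝓢'(E', ℂ)}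
    (h𝔏 : IsMoyalStarSubalgebra m' τ' μ' 𝔏) :
    IsMoyalStarSubalgebra m τ μ (𝔏.comap Φ.toLinearMap) where
  le_moyal := (Submodule.comap_mono h𝔏.le_moyal).trans hle
  mul_mem T hT U hU := by
    have hm := (Submodule.comap_mono h𝔏.le_moyal).trans hle
    change Φ _ ∈ 𝔏
    rw [hΦ.map_mul T (hm hT) U (hm hU)]
    exact h𝔏.mul_mem _ hT _ hU
  star_mem T hT := by
    have hm := (Submodule.comap_mono h𝔏.le_moyal).trans hle
    change Φ _ ∈ 𝔏
    rw [hΦ.map_star T (hm hT)]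
    exact h𝔏.star_mem _ hT

end Main
end MoyalModulation
open MoyalModulation in
theorem mainTheorem9 (n : ℕ) (P : CompositionLaw (Phase n))
    (hA : HypothesisA P) (hB : HypothesisB P) (hC : HypothesisC P) :
    (∃! B : CompositionLaw (Phase n × Phase n), IsSquare P B) ∧
    (∃! N : 𝓢'(Phase n × Phase n, ℂ) →L[ℂ] 𝓢'(Phase n × Phase n, ℂ), IsNMap P N) ∧
    ∀ (B : CompositionLaw (Phase n × Phase n))
      (N : 𝓢'(Phase n × Phase n, ℂ) →L[ℂ] 𝓢'(Phase n × Phase n, ℂ)),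
      IsSquare P B → IsNMap P N →
      -- the three Moyal algebras are `*`-algebras
      IsMoyalStarAlgebra P (tId n) (haar n) ∧
      IsMoyalStarAlgebra B (tId2 n) (haar2 n) ∧
      IsMoyalStarAlgebra (diamond n) (tDiamond n) (haar2 n) ∧
      -- `𝐌` restricts to an isomorphism of `*`-algebras
      (IsMoyalStarHom B (tId2 n) (haar2 n) (diamond n) (tDiamond n) (haar2 n) (modulation N) ∧
        Set.BijOn (modulation N) (moyal B (tId2 n) (haar2 n))
          (moyal (diamond n) (tDiamond n) (haar2 n))) ∧
      ∀ h : 𝓢(Phase n, ℂ), P.mul h h = h → conjS h = h → h ≠ 0 →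
        -- `𝐌_h` restricts to an injective morphism of `*`-algebras
        (IsMoyalStarHom P (tId n) (haar n) (diamond n) (tDiamond n) (haar2 n) (modulationAt N h) ∧
          Set.InjOn (modulationAt N h) (moyal P (tId n) (haar n)) ∧
          induced N h (moyal (diamond n) (tDiamond n) (haar2 n)) = moyal P (tId n) (haar n)) ∧
        -- induced `*`-subalgebras
        ∀ 𝔏 : Submodule ℂ 𝓢'(Phase n × Phase n, ℂ),
          IsMoyalStarSubalgebra (diamond n) (tDiamond n) (haar2 n) 𝔏 →
          IsMoyalStarSubalgebra P (tId n) (haar n) (induced N h 𝔏) := by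
  obtain ⟨κ, hκ⟩ := hA.exists_kernelMap hB
  replace hκ : IsKernelMap P κ := ⟨hκ⟩
  obtain ⟨B₀, hB₀⟩ := exists_isSquare P
  refine ⟨⟨B₀, hB₀, fun B hS => hS.unique hB₀⟩,
    ⟨_, hκ.isNMap hA, fun N hN => hN.unique (hκ.isNMap hA)⟩, fun B N hS hN => ?_⟩
  have D := hκ.moyalData hA hC
  have D2 := hS.moyalData hA D
  let Φ := hκ.equiv hA hC
  have hmul : ∀ F G, Φ (B.mul F G) = (diamond n).mul (Φ F) (Φ G) := hκ.map_square hA hS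
  have hstar : ∀ F, Φ (starS (tId2 n) F) = starS (tDiamond n) (Φ F) := fun F => by
    rw [hκ.equiv_apply, hκ.equiv_apply, starS_kernelToCrossed, starS_tId2, hκ.map_conj hA]
  have hpair : ∀ F G, pair (tDiamond n) (haar2 n) (Φ F) (Φ G) = pair (tId2 n) (haar2 n) F G :=
    fun F G => by rw [hκ.equiv_apply, hκ.equiv_apply, hκ.pair_map hA hC hS, pair_tId2]
  have hΨ := hκ.dual_modulation hA hC hN
  have hM := isMoyalStarHom_transport Φ hmul hstar hpair hΨ
  -- The axioms for `⋄` (associativity, cyclicity, nondegeneracy and the rest) are not computed from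
  -- its integral formula but transported from `□` along `Φ`.
  refine ⟨D.isMoyalStarAlgebra, D2.isMoyalStarAlgebra,
    (MoyalData.transport Φ hmul hstar hpair D2).isMoyalStarAlgebra,
    ⟨hM, bijOn_transport Φ hmul hpair hΨ⟩, fun h hh hc h0 => ?_⟩
  have hMh := isMoyalStarHom_modulationAt hS hA hM hh hc h0
  have hind : induced N h (moyal (diamond n) (tDiamond n) (haar2 n)) =
      moyal P (tId n) (haar n) := by
    ext T
    exact (mem_moyal_transport Φ hmul hpair hΨ _).trans
      (hS.tensorDist_mem_moyal hA hh h0)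
  refine ⟨⟨hMh, ?_, hind⟩, fun 𝔏 h𝔏 => IsMoyalStarSubalgebra.comap hMh hind.le h𝔏⟩
  exact ((bijective_transport Φ hΨ).injective.comp
    (tensorDist_injective h0)).injOn
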